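/- Let $f:(\mathbb C^3,0)\to(\mathbb C^3,0)$ be the germ $$f(x,y,z)=\bigl(x+yz(y-z)+P,\; y+x(x^2-z^2)+Q,\; z+xz(y-z)+R\bigr),$$ where $P,Q,R$ are holomorphic germs of order at least $4$ at the origin. Denote by $P^{(4)},R^{(4)}$ the homogeneous parts of degree $4$ of $P,R$ and by $R_{040}$ the coefficient of $y^4$ in $R$. Assume $$R_{040}\neq 0,\qquad P^{(4)}(1,1,1)\neq R^{(4)}(1,1,1),\qquad P^{(4)}(-1,1,1)\neq -R^{(4)}(-1,1,1).$$ Let $X_1\to\mathbb C^3$ be the blow-up of the origin, and let $p_3,p_4,p_5$ be the points of its exceptional divisor in the directions $[1:1:1]$, $[-1:1:1]$, $[0:1:0]$. Let $X_2\to X_1$ be the blow-up of $p_5$, in the coordinates $(x,y,z)\mapsto(xy,y,yz)$ of $X_1$ centered at $p_5$. Let $X_3\to X_2$ be the blow-up of the point of $X_2$ over $p_5$ in the direction $[1:0:0]$, that is, of the origin of the chart $(x,y,z)\mapsto(x,xy,xz)$ of $X_2\to X_1$. Let $X_4\to X_3$ be the blow-up of the projective line $L$ which is $\{x=y=0\}$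 in the chart $(x,y,z)\mapsto(x,xy,xz)$ and $\{y=z=0\}$ in the chart $(x,y,z)\mapsto(xz,yz,z)$ of $X_3\to X_2$ (in these coordinates). Let $\widetilde X\to X_4$ be the blow-up of the points $p_3$ and $p_4$ of $X_4$, and let $\widetilde\pi:\widetilde X\to(\mathbb C^3,0)$ be the composition. Then $f$ lifts to a germ of holomorphic map $\widetilde f$ of $\widetilde X$ along $\widetilde\pi^{-1}(0)$, which fixes $\widetilde\pi^{-1}(0)$ pointwise and is tangent to the identity at each of its points. It has only finitely many singular points on $\widetilde\pi^{-1}(0)$, and at each of them the germ of $\widetilde f$ is a simple corner, a degenerate spike or a spinning corner. Here a tangent to the identity germ $g$ at $p$ is singular at $p$ if its saturated infinitesimal generator vanishes at $p$; the infinitesimal generator is the unique formal vector field $\chi$ of multiplicity at least $2$ with $g=\exp\chi$, and its saturation is $\chi$ divided by the greatest common divisor of its components. Writing $\mathfrak m$ for the maximal ideal of the ring of holomorphic germs at the origin, a tangent to the identity germ is * a simple corner if, in suitable local coordinates, it is $\bigl(x+x^ay^bz^c\,x(\lambda+A),\ y+x^ay^bz^c\,y(\mu+B),\ z+x^ay^bz^c\,C\bigr)$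 with integers $a,b\ge1$, $c\ge0$, $\lambda\in\mathbb C^*$, $\mu\in\mathbb C\setminus\lambda\mathbb Q_{>0}$, $A,B,C\in\mathfrak m$, and $z\mid C$ if $c>0$; * a degenerate spike if, in suitable local coordinates, it is $\bigl(x+z^c(\lambda x+A),\ y+z^c(\mu y+B),\ z+z^{c+1}C\bigr)$ with $c\ge1$, $\lambda\in\mathbb C^*$, $\mu\in\lambda\mathbb R_{<0}$, $A,B\in\mathfrak m^2$, $C\in\mathfrak m$; * a spinning corner if, in suitable local coordinates, it is $\bigl(x+y^bz^c(x+A),\ y+y^{b+1}z^cB,\ z+y^bz^{c+1}C\bigr)$ with $b,c\ge1$, $A\in\mathfrak m^2$, $B,C\in\mathfrak m$. -/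

import Mathlib

open Topology

noncomputable section

/-- The space `ℂ³` with coordinates `x = w 0`, `y = w 1`, `z = w 2`. -/
abbrev C3 : Type := Fin 3 → ℂ

/-! ### Taylor series of holomorphic germs -/

/-- The partial derivative with respect to the `i`-th coordinate. -/
def partialDeriv (i : Fin 3) (g : C3 → ℂ) : C3 → ℂ :=
  fun w => fderiv ℂ g w (Pi.single i 1)

/-- The coefficient of `x ^ d 0 * y ^ d 1 * z ^ d 2` in the Taylor series of `g` at the origin. -/
def taylorCoeff (g : C3 → ℂ) (d : Fin 3 →₀ ℕ) : ℂ :=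
  ((partialDeriv 0)^[d 0] ((partialDeriv 1)^[d 1] ((partialDeriv 2)^[d 2] g))) 0 /
    ((d 0).factorial * (d 1).factorial * (d 2).factorial : ℕ)

/-- The Taylor series of `g` at the origin, as a formal power series. -/
def taylor (g : C3 → ℂ) : MvPowerSeries (Fin 3) ℂ := fun d => taylorCoeff g d

/-- The value at `v` of the homogeneous part of degree `n` of (the Taylor series at the origin of)
`g`. -/
def homPart (n : ℕ) (g : C3 → ℂ) (v : C3) : ℂ :=
  ∑ d ∈ (Finset.univ : Finset (Fin 3)).finsuppAntidiag n, taylorCoeff g d * ∏ i, v i ^ d i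

/-- `g` is a holomorphic germ at the origin, of order at least `n`. -/
def HasOrderAtLeast (n : ℕ) (g : C3 → ℂ) : Prop :=
  AnalyticAt ℂ g 0 ∧ (n : ℕ∞) ≤ (taylor g).order

/-- `g` belongs to the maximal ideal of the ring of holomorphic germs at the origin. -/
def InMax (g : C3 → ℂ) : Prop := AnalyticAt ℂ g 0 ∧ g 0 = 0

/-- `g` belongs to the square of the maximal ideal. -/
def InMaxSq (g : C3 → ℂ) : Prop := AnalyticAt ℂ g 0 ∧ g 0 = 0 ∧ fderiv ℂ g 0 = 0

/-! ### Tangent to the identity germs and infinitesimal generators -/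

/-- `G` is (a representative of) a tangent to the identity germ at the origin of `ℂ³`. -/
def IsTangentToId (G : C3 → C3) : Prop :=
  AnalyticAt ℂ G 0 ∧ G 0 = 0 ∧ fderiv ℂ G 0 = ContinuousLinearMap.id ℂ C3

/-- A formal vector field `χ 0 ∂_x + χ 1 ∂_y + χ 2 ∂_z` at the origin. -/
abbrev FormalField : Type := Fin 3 → MvPowerSeries (Fin 3) ℂ

/-- The action of a formal vector field on formal power series, as a derivation. -/
def FormalField.act (χ : FormalField) (φ : MvPowerSeries (Fin 3) ℂ) : MvPowerSeries (Fin 3) ℂ :=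
  ∑ i, χ i * MvPowerSeries.pderiv ℂ i φ

/-- `χ` is the infinitesimal generator of `G`: it has multiplicity at least two and
`G = exp χ`, that is, `x_i ∘ G = ∑ n, χ ^ n (x_i) / n!` for each coordinate `x_i`. Since `χ ^ n (x_i)`
has order at least `n + 1`, the coefficient of a monomial of degree `k` in this series only
involves the terms with `n ≤ k`. -/
def IsInfinitesimalGenerator (χ : FormalField) (G : C3 → C3) : Prop :=
  (∀ i, 2 ≤ (χ i).order) ∧
  ∀ (i : Fin 3) (d : Fin 3 →₀ ℕ),
    MvPowerSeries.coeff d (taylor fun w => G w i) =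
      ∑ n ∈ Finset.range (d.degree + 1),
        MvPowerSeries.coeff d (χ.act^[n] (MvPowerSeries.X i)) / (n.factorial : ℂ)

/-- `Y` is a saturation of `χ`: it is obtained from `χ` by dividing out the greatest common divisor
of the components. -/
def IsSaturation (Y χ : FormalField) : Prop :=
  (∃ l : MvPowerSeries (Fin 3) ℂ, l ≠ 0 ∧ ∀ i, χ i = l * Y i) ∧
  ∀ h : MvPowerSeries (Fin 3) ℂ, (∀ i, h ∣ Y i) → IsUnit h

/-- The germ `G` is singular at the origin: its saturated infinitesimal generator vanishes
there. -/
def IsSingularGerm (G : C3 → C3) : Prop :=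
  ∃ χ Y : FormalField, IsInfinitesimalGenerator χ G ∧ IsSaturation Y χ ∧
    ∀ i, MvPowerSeries.constantCoeff (Y i) = 0

/-! ### The three classes of germs -/

/-- In suitable holomorphic local coordinates at the origin, the germ `G` is given by `N`. -/
def InSomeCoordinates (G N : C3 → C3) : Prop :=
  ∃ φ : C3 → C3, AnalyticAt ℂ φ 0 ∧ φ 0 = 0 ∧ (fderiv ℂ φ 0).IsInvertible ∧
    ∀ᶠ w in 𝓝 (0 : C3), φ (G w) = N (φ w)

/-- Simple corners. -/
def IsSimpleCorner (G : C3 → C3) : Prop :=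
  IsTangentToId G ∧
  ∃ (a b c : ℕ) (l m : ℂ) (P Q R : C3 → ℂ),
    1 ≤ a ∧ 1 ≤ b ∧ l ≠ 0 ∧ (∀ q : ℚ, 0 < q → m ≠ l * (q : ℂ)) ∧
    InMax P ∧ InMax Q ∧ InMax R ∧
    (0 < c → ∃ S : C3 → ℂ, AnalyticAt ℂ S 0 ∧ ∀ᶠ w in 𝓝 (0 : C3), R w = w 2 * S w) ∧
    InSomeCoordinates G fun w =>
      ![w 0 + (w 0 ^ a * w 1 ^ b * w 2 ^ c) * (w 0 * (l + P w)),
        w 1 + (w 0 ^ a * w 1 ^ b * w 2 ^ c) * (w 1 * (m + Q w)),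
        w 2 + (w 0 ^ a * w 1 ^ b * w 2 ^ c) * R w]

/-- Degenerate spikes (of Siegel type). -/
def IsDegenerateSpike (G : C3 → C3) : Prop :=
  IsTangentToId G ∧
  ∃ (c : ℕ) (l m : ℂ) (P Q R : C3 → ℂ),
    1 ≤ c ∧ l ≠ 0 ∧ (∃ t : ℝ, t < 0 ∧ m = l * (t : ℂ)) ∧
    InMaxSq P ∧ InMaxSq Q ∧ InMax R ∧
    InSomeCoordinates G fun w =>
      ![w 0 + w 2 ^ c * (l * w 0 + P w),
        w 1 + w 2 ^ c * (m * w 1 + Q w),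
        w 2 + w 2 ^ (c + 1) * R w]

/-- Spinning corners. -/
def IsSpinningCorner (G : C3 → C3) : Prop :=
  IsTangentToId G ∧
  ∃ (b c : ℕ) (P Q R : C3 → ℂ),
    1 ≤ b ∧ 1 ≤ c ∧ InMaxSq P ∧ InMax Q ∧ InMax R ∧
    InSomeCoordinates G fun w =>
      ![w 0 + w 1 ^ b * w 2 ^ c * (w 0 + P w),
        w 1 + w 1 ^ (b + 1) * w 2 ^ c * Q w,
        w 2 + w 1 ^ b * w 2 ^ (c + 1) * R w]

/-! ### Smooth modifications of `(ℂ³, 0)`, given by coordinate charts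

A modification `π : X → ℂ³` which is biholomorphic outside `π⁻¹(0)` is given by its coordinate
charts `ψ i : dom i → X`, through the maps `proj i = π ∘ ψ i`. As `X` is Hausdorff and `π` is
injective outside `π⁻¹(0)`, which has a dense complement, `ψ i x = ψ j y` holds if and only if `(x, y)`
is a limit of pairs `(x', y')` with `proj i x' = proj j y' ≠ 0`. -/

/-- The charts of a modification of `(ℂ³, 0)`. -/
structure Model where
  /-- The index set of the charts. -/
  chart : Type
  /-- The subset of `ℂ³` on which the coordinates of a chart take values. -/
  dom : chart → Set C3
  /-- The expression of the modification in the coordinates of a chart. -/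
  proj : chart → C3 → C3

namespace Model

/-- The point with coordinates `x` in the chart `i` and the point with coordinates `y` in the chart
`j` are the same point of the modification. -/
def Glued (M : Model) (i j : M.chart) (x y : C3) : Prop :=
  (x, y) ∈ closure {q : C3 × C3 | q.1 ∈ M.dom i ∧ q.2 ∈ M.dom j ∧
    M.proj i q.1 = M.proj j q.2 ∧ M.proj i q.1 ≠ 0}

/-- The set of points of the modification: the charts glued together. -/
def Space (M : Model) : Type :=
  Quot fun p q : (Σ i : M.chart, M.dom i) => M.Glued p.1 q.1 p.2 q.2

/-- The point with coordinates `x` in the chart `i`. -/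
def point (M : Model) (i : M.chart) (x : M.dom i) : M.Space := Quot.mk _ ⟨i, x⟩

/-- The trivial modification of `ℂ³`. -/
def affine : Model where
  chart := Unit
  dom _ := Set.univ
  proj _ := id

end Model

/-- A local description, in the chart `chart`, of a smooth center: the set of points `x` of the
chart with `x s = base s` for all `s ∈ dirs`. It is a point if `dirs` is everything, and a curve if
`dirs` has two elements. -/
structure CenterPiece (I : Type) where
  /-- The chart in which the center is described. -/
  chart : I
  /-- A point of the center. -/
  base : C3
  /-- The coordinates which are constant on the center. -/
  dirs : Finset (Fin 3)

/-- The blow-up of `{x s = 0 for s ∈ S}` in the `j`-th chart, `j ∈ S`: the coordinates `x s` with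
`s ∈ S`, `s ≠ j` are multiplied by `x j`. -/
def blowChart (S : Finset (Fin 3)) (j : Fin 3) (x : C3) : C3 :=
  fun s => if s ∈ S ∧ s ≠ j then x s * x j else x s

namespace Model

/-- The point with coordinates `y` in the chart `j` belongs to the center described by the
pieces `Z`. -/
def InCenter (M : Model) {K : Type} (Z : K → CenterPiece M.chart) (j : M.chart) (y : C3) : Prop :=
  ∃ (k : K) (x : C3), x ∈ M.dom (Z k).chart ∧ (∀ s ∈ (Z k).dirs, x s = (Z k).base s) ∧
    M.Glued (Z k).chart j x y

/-- The blow-up of the smooth center described by the pieces `Z`. Its charts are the old ones,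
with the center removed, and the charts of the blow-up of each of the pieces. -/
def blowUp (M : Model) {K : Type} (Z : K → CenterPiece M.chart) : Model where
  chart := M.chart ⊕ (Σ k : K, {j : Fin 3 // j ∈ (Z k).dirs})
  dom
    | Sum.inl j => {y | y ∈ M.dom j ∧ ¬ M.InCenter Z j y}
    | Sum.inr ⟨k, j⟩ => {x | (Z k).base + blowChart (Z k).dirs j x ∈ M.dom (Z k).chart}
  proj
    | Sum.inl j => M.proj j
    | Sum.inr ⟨k, j⟩ => fun x => M.proj (Z k).chart ((Z k).base + blowChart (Z k).dirs j x)

/-- The blow-up of the point with coordinates `a` in the chart `i`. -/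
def blowPoint (M : Model) (i : M.chart) (a : C3) : Model :=
  M.blowUp fun _ : Unit => ⟨i, a, Finset.univ⟩

/-- The three new charts of the blow-up of a point: `newChart M i a 0`, `newChart M i a 1` and
`newChart M i a 2` are the `x`-chart, the `y`-chart and the `z`-chart. -/
def newChart (M : Model) (i : M.chart) (a : C3) (j : Fin 3) : (M.blowPoint i a).chart :=
  Sum.inr ⟨(), ⟨j, Finset.mem_univ j⟩⟩

/-- An old chart, as a chart of the blow-up of a point. -/
def oldChart (M : Model) (i : M.chart) (a : C3) (j : M.chart) : (M.blowPoint i a).chart :=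
  Sum.inl j

/-- `F` is, in the coordinates of the chart `i`, the germ at the point with coordinates `x` of the
lift of `f` to the modification, and it fixes this point. -/
def IsLiftAt (M : Model) (f : C3 → C3) (i : M.chart) (x : C3) (F : C3 → C3) : Prop :=
  AnalyticAt ℂ F x ∧ F x = x ∧ ∀ᶠ y in 𝓝 x, M.proj i (F y) = f (M.proj i y)

end Model

/-- The germ `F` at a fixed point `x`, written in coordinates centered at `x`. -/
def germAt (x : C3) (F : C3 → C3) : C3 → C3 := fun w => F (x + w) - x

/-! ### The family of germs and its resolution -/

/-- The germ
`(x, y, z) ↦ (x + y z (y - z) + P, y + x (x² - z²) + Q, z + x z (y - z) + R)`. -/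
def exampleGerm (P Q R : C3 → ℂ) : C3 → C3 := fun w =>
  ![w 0 + w 1 * w 2 * (w 1 - w 2) + P w,
    w 1 + w 0 * (w 0 ^ 2 - w 2 ^ 2) + Q w,
    w 2 + w 0 * w 2 * (w 1 - w 2) + R w]

/-- The blow-up of the origin of `ℂ³`. -/
def model1 : Model := Model.affine.blowPoint () 0

/-- The chart `(x, y, z) ↦ (x y, y, y z)` of `model1`, whose origin is the point `p₅` of the
exceptional divisor in the direction `[0 : 1 : 0]`. -/
def chart1y : model1.chart := Model.affine.newChart () 0 1

/-- The chart `(x, y, z) ↦ (x z, y z, z)` of `model1`, in which the points `p₃` and `p₄` of the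
exceptional divisor in the directions `[1 : 1 : 1]` and `[-1 : 1 : 1]` have coordinates `(1, 1, 0)`
and `(-1, 1, 0)`. -/
def chart1z : model1.chart := Model.affine.newChart () 0 2

/-- The blow-up of `p₅` in `model1`. -/
def model2 : Model := model1.blowPoint chart1y 0

/-- The `x`-chart over `p₅`, whose origin is the point in the direction `[1 : 0 : 0]`. -/
def chart2x : model2.chart := model1.newChart chart1y 0 0

/-- The blow-up of the origin of `chart2x` in `model2`. -/
def model3 : Model := model2.blowPoint chart2x 0

/-- The `x`-chart of the third blow-up. -/
def chart3x : model3.chart := model2.newChart chart2x 0 0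

/-- The `z`-chart of the third blow-up. -/
def chart3z : model3.chart := model2.newChart chart2x 0 2

/-- The projective line in `model3` given by `{x = y = 0}` in `chart3x` and by `{y = z = 0}` in
`chart3z`. -/
def lineL : Fin 2 → CenterPiece model3.chart :=
  ![⟨chart3x, 0, {0, 1}⟩, ⟨chart3z, 0, {1, 2}⟩]

/-- The blow-up of the line `lineL` in `model3`. -/
def model4 : Model := model3.blowUp lineL

/-- The chart `chart1z`, as a chart of `model4`. -/
def chart4z : model4.chart :=
  Sum.inl (model2.oldChart chart2x 0 (model1.oldChart chart1y 0 chart1z))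

/-- The blow-up of `p₃` in `model4`. -/
def model5 : Model := model4.blowPoint chart4z ![1, 1, 0]

/-- The chart `chart1z`, as a chart of `model5`. -/
def chart5z : model5.chart := model4.oldChart chart4z ![1, 1, 0] chart4z

/-- The blow-up of `p₄` in `model5`. -/
def model6 : Model := model5.blowPoint chart5z ![-1, 1, 0]

end

/-!
The resolution can be followed by hand, because at every stage the lift has an explicit form: in
each chart it is `id + m V`, where `m` is a monomial in equations of the exceptional divisor and `V`
is a holomorphic vector field obtained from the previous one by pullback and division (`HasLift`,
`blowField`). As `m` is always divisible by the square of an equation of the exceptional divisor,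
the lift fixes the divisor pointwise and is tangent to the identity (`HasLift.isTangentToId`).

A point where `V` does not vanish is not singular. Indeed, if `G = id + m V` is the exponential of
`χ`, the components of `χ` belong to the ideal `(m)`, by successive approximation and because
principal ideals of formal power series are closed; then `χ = m U` with `U 0 = V 0 ≠ 0`, and a
saturation of `χ` is a unit multiple of `U` (`IsNonsingular.not_isSingularGerm`). So only the zeros
of `V` matter, and there the linear part of `V` decides, after a linear change of coordinates:
`isSimpleCorner_of_eigenvalues`, `isSpinningCorner_of_eigenvalue` and
`isDegenerateSpike_of_exchange`. The lift does not change outside the center of a blow-up, so that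
each blow-up only requires the study of its new exceptional divisor (`ResolvedOff.blowUp`). Since
`proj` is injective outside the exceptional divisor in each chart, lifts are unique
(`IsGood.isLiftAt_unique`), which turns the knowledge of one lift at each point into the result
about all lifts (`ResolvedOff.conclusion`).

The zeros of `V` on the first exceptional divisor are the characteristic directions of the cubic
part of the germ. There are five of them: `[0 : 0 : 1]` and `[0 : 1 : 1]`, which are degenerate
spikes, and `p₃`, `p₄` and `p₅` (`resolved_firstBlowUp`).

At `p₃` and `p₄`, in centered coordinates, the linear part of `V` is `(α z, β x + γ y + δ z, 0)`,
where `β γ ≠ 0`, and `α ≠ 0` is the hypothesis on the values of `P` and `R` in these directions. The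
blow-up creates two singular points, a simple corner and a spinning corner (`resolvedAt_blowPoint`).

At `p₅`, the linear part of `V` is nilpotent, of rank two because of the coefficient `ρ ≠ 0` of
`y ^ 4` in `R`, and the only singular point of the blow-up is given by its kernel
(`resolvedAt_secondBlowUp`). There the field is `cornerField`, whose linear part is `(0, 0, ρ y)`,
so that the next blow-up has the line `L` as its singular locus (`resolvedAt_thirdBlowUp`). The
blow-up of `L` isolates the singularities, a spinning corner and four simple corners with a pair of
eigenvalues in the ratio `-2` or `-3`, up to order; the two points on the overlap of the charts are
met twice (`resolvedAt_lineBlowUp_zero_zero`, `resolvedAt_lineBlowUp_zero_one`,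
`resolvedAt_lineBlowUp_two_two`, `resolvedAt_lineBlowUp_two_one`).
-/

noncomputable section

open Model

/-! ### Partial derivatives of analytic germs -/

@[fun_prop]
theorem analyticAt_coord (i : Fin 3) (x : C3) : AnalyticAt ℂ (fun w : C3 => w i) x :=
  (ContinuousLinearMap.proj (R := ℂ) (φ := fun _ : Fin 3 => ℂ) i).analyticAt x

theorem partialDeriv_congr {f g : C3 → ℂ} {x : C3} (h : f =ᶠ[𝓝 x] g) (i : Fin 3) :
    partialDeriv i f =ᶠ[𝓝 x] partialDeriv i g := by
  filter_upwards [h.fderiv (𝕜 := ℂ)] with w hw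
  simp [partialDeriv, hw]

theorem analyticAt_partialDeriv {f : C3 → ℂ} {x : C3} (hf : AnalyticAt ℂ f x) (i : Fin 3) :
    AnalyticAt ℂ (partialDeriv i f) x :=
  (ContinuousLinearMap.apply ℂ ℂ (Pi.single i 1 : C3)).analyticAt _ |>.comp hf.fderiv

/-- An equality of germs: symmetry of second derivatives holds where `f` is analytic. -/
theorem partialDeriv_comm {f : C3 → ℂ} {x : C3} (hf : AnalyticAt ℂ f x) (i j : Fin 3) :
    partialDeriv i (partialDeriv j f) =ᶠ[𝓝 x] partialDeriv j (partialDeriv i f) := by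
  have key : ∀ (i j : Fin 3) (w : C3), AnalyticAt ℂ f w → partialDeriv i (partialDeriv j f) w =
      fderiv ℂ (fderiv ℂ f) w (Pi.single i 1) (Pi.single j 1) := by
    intro i j w hw
    have h1 : HasFDerivAt (fun v => fderiv ℂ f v) (fderiv ℂ (fderiv ℂ f) w) w :=
      hw.fderiv.differentiableAt.hasFDerivAt
    have h2 := h1.clm_apply (hasFDerivAt_const (Pi.single j 1 : C3) w)
    unfold partialDeriv
    rw [h2.fderiv]
    simp
  filter_upwards [hf.eventually_analyticAt] with w hw
  rw [key i j w hw, key j i w hw]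
  exact (hw.contDiffAt (n := ⊤)).isSymmSndFDerivAt (by simp) _ _

theorem partialDeriv_add {f g : C3 → ℂ} {x : C3} (hf : AnalyticAt ℂ f x) (hg : AnalyticAt ℂ g x)
    (i : Fin 3) : partialDeriv i (f + g) =ᶠ[𝓝 x] partialDeriv i f + partialDeriv i g := by
  filter_upwards [hf.eventually_analyticAt, hg.eventually_analyticAt] with w h1 h2
  simp [partialDeriv, fderiv_add h1.differentiableAt h2.differentiableAt]

theorem partialDeriv_mul {f g : C3 → ℂ} {x : C3} (hf : AnalyticAt ℂ f x) (hg : AnalyticAt ℂ g x)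
    (i : Fin 3) :
    partialDeriv i (f * g) =ᶠ[𝓝 x] f * partialDeriv i g + g * partialDeriv i f := by
  filter_upwards [hf.eventually_analyticAt, hg.eventually_analyticAt] with w h1 h2
  simp [partialDeriv, fderiv_mul h1.differentiableAt h2.differentiableAt]

theorem iterate_partialDeriv_congr {f g : C3 → ℂ} {x : C3} (h : f =ᶠ[𝓝 x] g) (i : Fin 3) (n : ℕ) :
    (partialDeriv i)^[n] f =ᶠ[𝓝 x] (partialDeriv i)^[n] g := by
  induction n with
  | zero => exact h
  | succ n ih =>
    rw [Function.iterate_succ_apply', Function.iterate_succ_apply']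
    exact partialDeriv_congr ih i

theorem analyticAt_iterate_partialDeriv {f : C3 → ℂ} {x : C3} (hf : AnalyticAt ℂ f x) (i : Fin 3)
    (n : ℕ) : AnalyticAt ℂ ((partialDeriv i)^[n] f) x := by
  induction n with
  | zero => exact hf
  | succ n ih =>
    rw [Function.iterate_succ_apply']
    exact analyticAt_partialDeriv ih i

theorem partialDeriv_iterate_comm {f : C3 → ℂ} {x : C3} (hf : AnalyticAt ℂ f x) (i j : Fin 3)
    (n : ℕ) : (partialDeriv i)^[n] (partialDeriv j f) =ᶠ[𝓝 x]
      partialDeriv j ((partialDeriv i)^[n] f) := by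
  induction n with
  | zero => exact Filter.EventuallyEq.rfl
  | succ n ih =>
    rw [Function.iterate_succ_apply', Function.iterate_succ_apply']
    exact (partialDeriv_congr ih i).trans
      (partialDeriv_comm (analyticAt_iterate_partialDeriv hf i n) i j)

/-! ### Taylor series -/

theorem taylor_congr {f g : C3 → ℂ} (h : f =ᶠ[𝓝 0] g) : taylor f = taylor g := by
  funext d
  have := (iterate_partialDeriv_congr (iterate_partialDeriv_congr
    (iterate_partialDeriv_congr h 2 (d 2)) 1 (d 1)) 0 (d 0)).eq_of_nhds
  simp only [taylor, taylorCoeff, this]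

theorem coeff_taylor (f : C3 → ℂ) (d : Fin 3 →₀ ℕ) :
    MvPowerSeries.coeff d (taylor f) = taylorCoeff f d := rfl

theorem constantCoeff_taylor (f : C3 → ℂ) : MvPowerSeries.constantCoeff (taylor f) = f 0 := by
  rw [← MvPowerSeries.coeff_zero_eq_constantCoeff_apply, coeff_taylor]
  simp [taylorCoeff]

/-- Taking Taylor series commutes with partial derivatives. Iterated partial derivatives are taken
in a fixed order in `taylorCoeff`, hence the appeals to the symmetry of second derivatives. -/
theorem pderiv_taylor {f : C3 → ℂ} (hf : AnalyticAt ℂ f 0) (i : Fin 3) :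
    MvPowerSeries.pderiv ℂ i (taylor f) = taylor (partialDeriv i f) := by
  ext d
  rw [MvPowerSeries.coeff_pderiv, coeff_taylor, coeff_taylor]
  have a2 := analyticAt_iterate_partialDeriv hf 2 (d 2)
  have a1 := analyticAt_iterate_partialDeriv a2 1 (d 1)
  have e2 := partialDeriv_iterate_comm hf 2 i (d 2)
  have e1 := (iterate_partialDeriv_congr e2 1 (d 1)).trans (partialDeriv_iterate_comm a2 1 i (d 1))
  have e0 := (iterate_partialDeriv_congr e1 0 (d 0)).trans (partialDeriv_iterate_comm a1 0 i (d 0))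
  have h0 : ((d i : ℂ) + 1) ≠ 0 := by exact_mod_cast Nat.succ_ne_zero (d i)
  have f0 := Nat.cast_ne_zero (R := ℂ).2 (Nat.factorial_ne_zero (d 0))
  have f1 := Nat.cast_ne_zero (R := ℂ).2 (Nat.factorial_ne_zero (d 1))
  have f2 := Nat.cast_ne_zero (R := ℂ).2 (Nat.factorial_ne_zero (d 2))
  fin_cases i
  · simp only [Fin.zero_eta] at *
    have : taylorCoeff f (d + Finsupp.single 0 1) =
        ((partialDeriv 0)^[d 0 + 1] ((partialDeriv 1)^[d 1] ((partialDeriv 2)^[d 2] f))) 0 /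
        ((d 0 + 1).factorial * (d 1).factorial * (d 2).factorial : ℕ) := by
      simp [taylorCoeff]
    rw [this, taylorCoeff, e0.eq_of_nhds, Function.iterate_succ_apply', Nat.factorial_succ]
    push_cast
    field_simp
  · simp only [Fin.mk_one] at *
    have : taylorCoeff f (d + Finsupp.single 1 1) =
        ((partialDeriv 0)^[d 0] ((partialDeriv 1)^[d 1 + 1] ((partialDeriv 2)^[d 2] f))) 0 /
        ((d 0).factorial * (d 1 + 1).factorial * (d 2).factorial : ℕ) := by
      simp [taylorCoeff]
    rw [this, taylorCoeff, (iterate_partialDeriv_congr e1 0 (d 0)).eq_of_nhds,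
      Function.iterate_succ_apply', Nat.factorial_succ]
    push_cast
    field_simp
  · simp only [Fin.reduceFinMk] at *
    have : taylorCoeff f (d + Finsupp.single 2 1) =
        ((partialDeriv 0)^[d 0] ((partialDeriv 1)^[d 1] ((partialDeriv 2)^[d 2 + 1] f))) 0 /
        ((d 0).factorial * (d 1).factorial * (d 2 + 1).factorial : ℕ) := by
      simp [taylorCoeff]
    rw [this, taylorCoeff, (iterate_partialDeriv_congr (iterate_partialDeriv_congr e2 1 (d 1)) 0
      (d 0)).eq_of_nhds, Function.iterate_succ_apply', Nat.factorial_succ]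
    push_cast
    field_simp

/-- The coefficients of degree at most `n` of two power series agree if their constant coefficients
agree and the coefficients of degree less than `n` of their partial derivatives agree. This reduces
identities between Taylor series to `pderiv_taylor`, by induction on the degree. -/
theorem coeff_eq_of_pderiv {n : ℕ} {φ ψ : MvPowerSeries (Fin 3) ℂ}
    (h0 : MvPowerSeries.constantCoeff φ = MvPowerSeries.constantCoeff ψ)
    (h : ∀ i, ∀ d : Fin 3 →₀ ℕ, d.degree < n →
      MvPowerSeries.coeff d (MvPowerSeries.pderiv ℂ i φ) =
        MvPowerSeries.coeff d (MvPowerSeries.pderiv ℂ i ψ)) (d : Fin 3 →₀ ℕ) (hd : d.degree ≤ n) :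
    MvPowerSeries.coeff d φ = MvPowerSeries.coeff d ψ := by
  by_cases hz : d = 0
  · subst hz; simpa using h0
  obtain ⟨i, hi⟩ := Finsupp.ne_iff.mp hz
  have hi : d i ≠ 0 := hi
  have hle : Finsupp.single i 1 ≤ d := by
    rw [Finsupp.single_le_iff]; omega
  have hdd : d - Finsupp.single i 1 + Finsupp.single i 1 = d := tsub_add_cancel_of_le hle
  have hdeg : (d - Finsupp.single i 1).degree < n := by
    have := congrArg Finsupp.degree hdd
    rw [map_add, Finsupp.degree_single] at this
    omega
  have := h i _ hdeg
  rw [MvPowerSeries.coeff_pderiv, MvPowerSeries.coeff_pderiv, hdd] at this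
  exact mul_right_cancel₀ (Nat.cast_add_one_ne_zero _) this

theorem taylor_const (c : ℂ) : taylor (fun _ => c) = MvPowerSeries.C c := by
  refine MvPowerSeries.pderiv.ext (fun i => ?_) ?_
  · have : partialDeriv i (fun _ => c) = fun _ => 0 := by
      funext w; simp [partialDeriv]
    rw [pderiv_taylor analyticAt_const, this, MvPowerSeries.pderiv_C]
    have h : ∀ (n : ℕ) (i : Fin 3), (partialDeriv i)^[n] (fun _ => (0 : ℂ)) = fun _ => 0 := by
      intro n i
      induction n with
      | zero => rfl
      | succ n ih => rw [Function.iterate_succ_apply', ih]; funext w; simp [partialDeriv]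
    ext d
    simp [coeff_taylor, taylorCoeff, h]
  · simp [constantCoeff_taylor]

theorem taylor_add {f g : C3 → ℂ} (hf : AnalyticAt ℂ f 0) (hg : AnalyticAt ℂ g 0) :
    taylor (f + g) = taylor f + taylor g := by
  have : ∀ n : ℕ, ∀ f g : C3 → ℂ, AnalyticAt ℂ f 0 → AnalyticAt ℂ g 0 → ∀ d : Fin 3 →₀ ℕ,
      d.degree ≤ n → MvPowerSeries.coeff d (taylor (f + g)) =
        MvPowerSeries.coeff d (taylor f + taylor g) := by
    intro n
    induction n with
    | zero =>
      intro f g hf hg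
      exact coeff_eq_of_pderiv (by simp [constantCoeff_taylor]) (fun i d hd => by omega)
    | succ n ih =>
      intro f g hf hg
      refine coeff_eq_of_pderiv (by simp [constantCoeff_taylor]) (fun i d hd => ?_)
      rw [pderiv_taylor (hf.add hg), map_add, pderiv_taylor hf, pderiv_taylor hg,
        taylor_congr (partialDeriv_add hf hg i)]
      exact ih _ _ (analyticAt_partialDeriv hf i) (analyticAt_partialDeriv hg i) d (by omega)
  ext d
  exact this _ f g hf hg d le_rfl

theorem taylor_mul {f g : C3 → ℂ} (hf : AnalyticAt ℂ f 0) (hg : AnalyticAt ℂ g 0) :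
    taylor (f * g) = taylor f * taylor g := by
  have : ∀ n : ℕ, ∀ f g : C3 → ℂ, AnalyticAt ℂ f 0 → AnalyticAt ℂ g 0 → ∀ d : Fin 3 →₀ ℕ,
      d.degree ≤ n → MvPowerSeries.coeff d (taylor (f * g)) =
        MvPowerSeries.coeff d (taylor f * taylor g) := by
    intro n
    induction n with
    | zero =>
      intro f g hf hg
      exact coeff_eq_of_pderiv (by simp [constantCoeff_taylor]) (fun i d hd => by omega)
    | succ n ih =>
      intro f g hf hg
      refine coeff_eq_of_pderiv (by simp [constantCoeff_taylor]) (fun i d hd => ?_)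
      have af := analyticAt_partialDeriv hf i
      have ag := analyticAt_partialDeriv hg i
      rw [pderiv_taylor (hf.mul hg), Derivation.leibniz, pderiv_taylor hf, pderiv_taylor hg,
        taylor_congr (partialDeriv_mul hf hg i), taylor_add (hf.mul ag) (hg.mul af), map_add,
        ih _ _ hf ag d (by omega), ih _ _ hg af d (by omega), ← map_add]
      rfl
  ext d
  exact this _ f g hf hg d le_rfl

theorem taylor_coord (i : Fin 3) : taylor (fun w => w i) = MvPowerSeries.X i := by
  have ha : AnalyticAt ℂ (fun w : C3 => w i) 0 := analyticAt_coord i 0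
  refine MvPowerSeries.pderiv.ext (fun j => ?_) ?_
  · have : partialDeriv j (fun w => w i) = fun _ => (Pi.single j 1 : C3) i := by
      funext w
      have := (ContinuousLinearMap.proj (R := ℂ) (φ := fun _ : Fin 3 => ℂ) i).hasFDerivAt (x := w)
      simp only [partialDeriv]
      rw [show (fun w : C3 => w i) =
        ⇑(ContinuousLinearMap.proj (R := ℂ) (φ := fun _ : Fin 3 => ℂ) i)
        from rfl, this.fderiv]
      rfl
    rw [pderiv_taylor ha, this, taylor_const, MvPowerSeries.pderiv_X]
    by_cases h : i = j
    · subst h; simp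
    · simp [h]
  · simp [constantCoeff_taylor]

/-! ### Formal vector fields and saturation -/

namespace MvPowerSeries

theorem coe_le_order_add {k : ℕ} {f g : MvPowerSeries (Fin 3) ℂ} (hf : (k : ℕ∞) ≤ f.order)
    (hg : (k : ℕ∞) ≤ g.order) : (k : ℕ∞) ≤ (f + g).order :=
  (le_min hf hg).trans min_order_le_add

theorem coe_le_order_sum {ι : Type*} {k : ℕ} {s : Finset ι} {f : ι → MvPowerSeries (Fin 3) ℂ}
    (h : ∀ i ∈ s, (k : ℕ∞) ≤ (f i).order) : (k : ℕ∞) ≤ (∑ i ∈ s, f i).order := by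
  classical
  induction s using Finset.induction_on with
  | empty => simp
  | insert a s ha ih =>
    rw [Finset.sum_insert ha]
    exact coe_le_order_add (h a (by simp)) (ih fun i hi => h i (by simp [hi]))

theorem coe_le_order_mul {a b : ℕ} {f g : MvPowerSeries (Fin 3) ℂ} (hf : (a : ℕ∞) ≤ f.order)
    (hg : (b : ℕ∞) ≤ g.order) : ((a + b : ℕ) : ℕ∞) ≤ (f * g).order := by
  push_cast
  exact (add_le_add hf hg).trans le_order_mul

theorem coe_le_order_mul_left {k : ℕ} (f : MvPowerSeries (Fin 3) ℂ) {g : MvPowerSeries (Fin 3) ℂ}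
    (hg : (k : ℕ∞) ≤ g.order) : (k : ℕ∞) ≤ (f * g).order :=
  hg.trans (le_add_self.trans le_order_mul)

theorem coe_le_order_of_mul {k n : ℕ} {f g : MvPowerSeries (Fin 3) ℂ} (hf : f.order = n)
    (h : ((k + n : ℕ) : ℕ∞) ≤ (f * g).order) : (k : ℕ∞) ≤ g.order := by
  rw [order_mul, hf, add_comm k n, Nat.cast_add] at h
  exact (ENat.add_le_add_iff_left (ENat.natCast_ne_top n)).1 h

theorem coe_le_order_pderiv {k : ℕ} {f : MvPowerSeries (Fin 3) ℂ} (h : ((k + 1 : ℕ) : ℕ∞) ≤ f.order)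
    (i : Fin 3) : (k : ℕ∞) ≤ (pderiv ℂ i f).order := by
  refine nat_le_order fun d hd => ?_
  rw [coeff_pderiv, coeff_of_lt_order, zero_mul]
  refine lt_of_lt_of_le ?_ h
  rw [map_add, Finsupp.degree_single]
  exact_mod_cast (by omega : d.degree + 1 < k + 1)

theorem eq_zero_of_forall_le_order {f : MvPowerSeries (Fin 3) ℂ} (h : ∀ k : ℕ, (k : ℕ∞) ≤ f.order) :
    f = 0 := by
  ext d
  rw [coeff_of_lt_order, map_zero]
  exact lt_of_lt_of_le (by exact_mod_cast Nat.lt_succ_self _) (h (d.degree + 1))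

/-- Principal ideals of the ring of formal power series are closed for the adic topology. -/
theorem dvd_of_forall_approx {m f : MvPowerSeries (Fin 3) ℂ}
    (h : ∀ k : ℕ, ∃ a r : MvPowerSeries (Fin 3) ℂ, f = m * a + r ∧ (k : ℕ∞) ≤ r.order) : m ∣ f := by
  by_cases hm : m = 0
  · subst hm
    rw [eq_zero_of_forall_le_order (f := f)]
    intro k
    obtain ⟨a, r, h1, h2⟩ := h k
    rw [h1, zero_mul, zero_add]
    exact h2
  obtain ⟨n, hn⟩ : ∃ n : ℕ, m.order = n := ⟨_, (ne_zero_iff_order_finite.1 hm).symm⟩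
  choose a r h1 h2 using fun k => h (k + n)
  have hcauchy : ∀ k k' : ℕ, k ≤ k' → (k : ℕ∞) ≤ (a k' - a k).order := by
    intro k k' hkk
    refine coe_le_order_of_mul hn ?_
    have : m * (a k' - a k) = r k + -r k' := by linear_combination h1 k - h1 k'
    rw [this]
    refine coe_le_order_add (h2 k) ?_
    rw [order_neg]
    exact le_trans (by exact_mod_cast (by omega : k + n ≤ k' + n)) (h2 k')
  -- The quotients `a k` form a Cauchy sequence, and `A` is its limit: in degree at most `k - 1` it
  -- agrees with `a k`.
  let A : MvPowerSeries (Fin 3) ℂ := fun d => coeff d (a (d.degree + 1))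
  have hA : ∀ k : ℕ, (k : ℕ∞) ≤ (a k - A).order := by
    intro k
    refine nat_le_order fun d hd => ?_
    have := coeff_of_lt_order (f := a k - a (d.degree + 1)) (d := d)
      (lt_of_lt_of_le (by exact_mod_cast Nat.lt_succ_self _) (hcauchy (d.degree + 1) k hd))
    rwa [map_sub] at this ⊢
  refine ⟨A, sub_eq_zero.1 (eq_zero_of_forall_le_order fun k => ?_)⟩
  have : f - m * A = m * (a k - A) + r k := by linear_combination h1 k
  rw [this]
  refine coe_le_order_add ?_ (le_trans (by exact_mod_cast Nat.le_add_right k n) (h2 k))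
  exact coe_le_order_mul_left m (hA k)

end MvPowerSeries

open MvPowerSeries

namespace FormalField

variable {χ : FormalField}

theorem act_X (χ : FormalField) (i : Fin 3) : χ.act (X i) = χ i := by
  simp [act, pderiv_X, Pi.single_apply]

/-- A vector field of multiplicity at least two raises the order. -/
theorem order_act (hχ : ∀ i, 2 ≤ (χ i).order) {k : ℕ} {φ : MvPowerSeries (Fin 3) ℂ}
    (h : (k : ℕ∞) ≤ φ.order) : ((k + 1 : ℕ) : ℕ∞) ≤ (χ.act φ).order := by
  refine coe_le_order_sum fun i _ => ?_
  rcases k with _ | k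
  · rw [mul_comm]
    exact coe_le_order_mul_left _ (le_trans (by norm_num) (hχ i))
  · have := coe_le_order_mul (a := 2) (hχ i) (coe_le_order_pderiv h i)
    rwa [add_comm 2 k] at this

theorem order_act_iterate (hχ : ∀ i, 2 ≤ (χ i).order) {k : ℕ} {φ : MvPowerSeries (Fin 3) ℂ}
    (h : (k : ℕ∞) ≤ φ.order) (n : ℕ) : ((k + n : ℕ) : ℕ∞) ≤ (χ.act^[n] φ).order := by
  induction n with
  | zero => exact h
  | succ n ih =>
    rw [Function.iterate_succ_apply']
    exact order_act hχ ih

/-- If a component of `exp χ` is `x_i + φ`, then `χ i` is `φ` up to the terms of the exponential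
series of index at least two, among which only finitely many matter in each degree. -/
theorem order_sub_exp (hχ : ∀ i, 2 ≤ (χ i).order) {φ : MvPowerSeries (Fin 3) ℂ} {i : Fin 3}
    (hexp : ∀ d : Fin 3 →₀ ℕ, coeff d (X i + φ) = ∑ n ∈ Finset.range (d.degree + 1),
        coeff d (χ.act^[n] (X i)) / (n.factorial : ℂ)) (k : ℕ) :
    ((k + 1 : ℕ) : ℕ∞) ≤ (χ i - (φ - ∑ n ∈ Finset.range k,
      C ((n + 2).factorial : ℂ)⁻¹ * χ.act^[n + 2] (X i))).order := by
  have hX : ((1 : ℕ) : ℕ∞) ≤ (X i : MvPowerSeries (Fin 3) ℂ).order := by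
    refine nat_le_order fun d hd => ?_
    have : d = 0 := (Finsupp.degree_eq_zero_iff d).1 (by omega)
    subst this; simp
  have hit := fun n => order_act_iterate hχ hX n
  refine nat_le_order fun d hd => ?_
  have hzero : ∀ n, d.degree < n + 1 → coeff d (χ.act^[n] (X i)) = 0 := fun n hn =>
    coeff_of_lt_order (lt_of_lt_of_le (by exact_mod_cast (by omega)) (hit n))
  have e : ∑ n ∈ Finset.range (d.degree + 1), coeff d (χ.act^[n] (X i)) / (n.factorial : ℂ) =
      ∑ n ∈ Finset.range (k + 2), coeff d (χ.act^[n] (X i)) / (n.factorial : ℂ) := by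
    refine Finset.sum_subset (fun n hn => ?_) fun n _ hn => ?_
    · simp only [Finset.mem_range] at hn ⊢; omega
    · simp only [Finset.mem_range] at hn
      rw [hzero n (by omega), zero_div]
  have h := hexp d
  rw [e, Finset.sum_range_succ', Finset.sum_range_succ'] at h
  simp only [Function.iterate_zero, id, Function.iterate_one, zero_add, act_X, Nat.factorial,
    Nat.cast_one, div_one, map_add] at h
  simp only [map_sub, map_sum, coeff_C_mul]
  have e2 : ∑ n ∈ Finset.range k, ((n + 2).factorial : ℂ)⁻¹ * coeff d (χ.act^[n + 2] (X i)) =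
      ∑ n ∈ Finset.range k, coeff d (χ.act^[n + 1 + 1] (X i)) /
        (((n + 1 + 1) * ((n + 1) * n.factorial) : ℕ) : ℂ) := by
    refine Finset.sum_congr rfl fun n _ => ?_
    rw [div_eq_inv_mul]
    rfl
  rw [e2]
  simp only [mul_one, Nat.cast_one, div_one] at h
  linear_combination -h

/-- If a component of `exp χ` is `x_i + m v` where `v` does not vanish at the origin, then `m` has
order at least two. -/
theorem two_le_order_of_exp {φ m v : MvPowerSeries (Fin 3) ℂ} {i : Fin 3}
    (hχ : ∀ i, 2 ≤ (χ i).order) (hφ : φ = m * v)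
    (hexp : ∀ d : Fin 3 →₀ ℕ, coeff d (X i + φ) = ∑ n ∈ Finset.range (d.degree + 1),
        coeff d (χ.act^[n] (X i)) / (n.factorial : ℂ))
    (hv : constantCoeff v ≠ 0) : ((2 : ℕ) : ℕ∞) ≤ m.order := by
  have h3 := order_sub_exp hχ hexp 1
  have h4 : ((2 : ℕ) : ℕ∞) ≤ (χ.act^[0 + 2] (X i)).order := by
    have h : ((1 : ℕ) : ℕ∞) ≤ (χ i).order := le_trans (by norm_num) (hχ i)
    have := order_act hχ h
    rwa [← act_X χ i] at this
  have h2 : ((2 : ℕ) : ℕ∞) ≤ φ.order := by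
    have e : φ = χ i + (-(χ i - (φ - ∑ n ∈ Finset.range 1,
        C ((n + 2).factorial : ℂ)⁻¹ * χ.act^[n + 2] (X i)))
        + C ((0 + 2).factorial : ℂ)⁻¹ * χ.act^[0 + 2] (X i)) := by
      rw [Finset.sum_range_one]
      ring
    rw [e]
    refine coe_le_order_add (hχ i) (coe_le_order_add ?_ (coe_le_order_mul_left _ h4))
    rw [order_neg]
    exact h3
  rw [hφ, mul_comm] at h2
  refine coe_le_order_of_mul (n := 0) ?_ h2
  by_contra hne
  exact hv (order_ne_zero_iff_constCoeff_eq_zero.1 hne)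

/-- If the components of `χ`, and `φ`, belong to the ideal `(m)` up to terms of order `k`, then
`χ.act φ` belongs to `(m)` up to terms of order `k + 1`: an error in the components of `χ` is
multiplied by a derivative of a multiple of `m`, of order at least one, and an error in `φ` has its
order raised by `χ`. -/
theorem exists_act_eq_mul_add {m φ : MvPowerSeries (Fin 3) ℂ} (hχ : ∀ i, 2 ≤ (χ i).order)
    (hm : ((2 : ℕ) : ℕ∞) ≤ m.order) {k : ℕ}
    (ih : ∀ i, ∃ a r, χ i = m * a + r ∧ (k : ℕ∞) ≤ r.order)
    (hφ : ∃ a r, φ = m * a + r ∧ (k : ℕ∞) ≤ r.order) :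
    ∃ a r, χ.act φ = m * a + r ∧ ((k + 1 : ℕ) : ℕ∞) ≤ r.order := by
  obtain ⟨a, r, rfl, hr⟩ := hφ
  choose b s hb hs using ih
  refine ⟨∑ j, b j * pderiv ℂ j (m * a), ∑ j, s j * pderiv ℂ j (m * a) + χ.act r, ?_, ?_⟩
  · rw [Finset.mul_sum, ← add_assoc, ← Finset.sum_add_distrib]
    unfold act
    rw [← Finset.sum_add_distrib]
    refine Finset.sum_congr rfl fun j _ => ?_
    rw [map_add, mul_add, add_left_inj]
    nth_rw 1 [hb j]
    ring
  · refine coe_le_order_add (coe_le_order_sum fun j _ => ?_) (order_act hχ hr)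
    refine coe_le_order_mul (hs j) (coe_le_order_pderiv ?_ j)
    rw [mul_comm]
    exact coe_le_order_mul_left _ hm

/-- If `G = exp χ` and `G - id = m V` where `m` has order at least two, then the components of `χ`
belong to the closure of the ideal generated by `m`, hence to this ideal. -/
theorem dvd_of_exp {V : FormalField} {m : MvPowerSeries (Fin 3) ℂ} (hχ : ∀ i, 2 ≤ (χ i).order)
    (hm : ((2 : ℕ) : ℕ∞) ≤ m.order)
    (hexp : ∀ i, ∀ d : Fin 3 →₀ ℕ, coeff d (X i + m * V i) = ∑ n ∈ Finset.range (d.degree + 1),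
        coeff d (χ.act^[n] (X i)) / (n.factorial : ℂ)) (i : Fin 3) : m ∣ χ i := by
  suffices happ : ∀ k : ℕ, ∀ i, ∃ a r, χ i = m * a + r ∧ (k : ℕ∞) ≤ r.order from
    dvd_of_forall_approx fun k => happ k i
  intro k
  induction k with
  | zero => exact fun i => ⟨0, χ i, by ring, by simp⟩
  | succ k ih =>
    have hiter : ∀ i n, ∃ a r, χ.act^[n + 2] (X i) = m * a + r ∧ ((k + 1 : ℕ) : ℕ∞) ≤ r.order := by
      intro i n
      induction n with
      | zero =>
        rw [zero_add, Function.iterate_succ_apply', Function.iterate_one, act_X]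
        exact exists_act_eq_mul_add hχ hm ih (ih i)
      | succ n ihn =>
        rw [show n + 1 + 2 = (n + 2) + 1 by ring, Function.iterate_succ_apply']
        obtain ⟨a, r, e, hr⟩ := ihn
        exact exists_act_eq_mul_add hχ hm ih
          ⟨a, r, e, le_trans (by exact_mod_cast Nat.le_succ k) hr⟩
    intro i
    choose a r ha hr using hiter i
    have h1 := order_sub_exp hχ (hexp i) k
    have h2 : ∑ n ∈ Finset.range k, C ((n + 2).factorial : ℂ)⁻¹ * χ.act^[n + 2] (X i) =
        m * (∑ n ∈ Finset.range k, C ((n + 2).factorial : ℂ)⁻¹ * a n) +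
          ∑ n ∈ Finset.range k, C ((n + 2).factorial : ℂ)⁻¹ * r n := by
      rw [Finset.mul_sum, ← Finset.sum_add_distrib]
      refine Finset.sum_congr rfl fun n _ => ?_
      rw [ha n]; ring
    have h3 : ((k + 1 : ℕ) : ℕ∞) ≤
        (∑ n ∈ Finset.range k, C ((n + 2).factorial : ℂ)⁻¹ * r n).order :=
      coe_le_order_sum fun n _ => coe_le_order_mul_left _ (hr n)
    rw [h2] at h1
    generalize (∑ n ∈ Finset.range k, C ((n + 2).factorial : ℂ)⁻¹ * r n) = ρ at h1 h3
    generalize (∑ n ∈ Finset.range k, C ((n + 2).factorial : ℂ)⁻¹ * a n) = α at h1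
    refine ⟨V i - α, (χ i - (m * V i - (m * α + ρ))) + -ρ, by ring, coe_le_order_add h1 ?_⟩
    rwa [order_neg]

/-- Let `G - id = m V` where `V` does not vanish at the origin. Then the infinitesimal generator `χ`
of `G` is `m U` with `U 0 = V 0`, so that a saturation of `χ` does not vanish at the origin. -/
theorem constantCoeff_saturation_ne_zero {Y V : FormalField} {m : MvPowerSeries (Fin 3) ℂ}
    (hχ : ∀ i, 2 ≤ (χ i).order)
    (hexp : ∀ i, ∀ d : Fin 3 →₀ ℕ, coeff d (X i + m * V i) = ∑ n ∈ Finset.range (d.degree + 1),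
        coeff d (χ.act^[n] (X i)) / (n.factorial : ℂ))
    {i₀ : Fin 3} (hV : constantCoeff (V i₀) ≠ 0) (hY : IsSaturation Y χ) :
    constantCoeff (Y i₀) ≠ 0 := by
  have hdvd := dvd_of_exp hχ (two_le_order_of_exp hχ rfl (hexp i₀) hV) hexp
  choose U hU using hdvd
  obtain ⟨⟨l, hl, hlY⟩, hcop⟩ := hY
  -- If `m = 0`, then `χ = 0`, so that `Y = 0`, whose components have the non-unit `x` as a common
  -- divisor.
  have hm : m ≠ 0 := by
    rintro rfl
    have hY0 : ∀ i, Y i = 0 := fun i => by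
      have := hlY i
      rw [hU i, zero_mul] at this
      exact (mul_eq_zero.1 this.symm).resolve_left hl
    have := hcop (X 0) fun i => by rw [hY0 i]; exact dvd_zero _
    rw [MvPowerSeries.isUnit_iff_constantCoeff] at this
    simp at this
  obtain ⟨δ, hδ⟩ : ∃ n : ℕ, m.order = n := ⟨_, (ne_zero_iff_order_finite.1 hm).symm⟩
  have hχδ : ((δ : ℕ) : ℕ∞) ≤ (χ i₀).order := by
    rw [hU i₀]
    rw [mul_comm]
    exact coe_le_order_mul_left _ hδ.ge
  -- The terms of index at least two of the exponential series have order greater than that of `m`.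
  have hUV : constantCoeff (U i₀) = constantCoeff (V i₀) := by
    have h1 : ((1 + δ : ℕ) : ℕ∞) ≤ (m * (U i₀ - V i₀)).order := by
      have h2 := order_sub_exp hχ (hexp i₀) δ
      have h3 : ((δ + 1 : ℕ) : ℕ∞) ≤ (∑ n ∈ Finset.range δ,
          C ((n + 2).factorial : ℂ)⁻¹ * χ.act^[n + 2] (X i₀)).order := by
        refine coe_le_order_sum fun n _ => coe_le_order_mul_left _ ?_
        have h2 := order_act_iterate hχ hχδ (n + 1)
        rw [← act_X χ i₀, ← Function.iterate_succ_apply] at h2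
        exact le_trans (by exact_mod_cast (by omega)) h2
      generalize (∑ n ∈ Finset.range δ, C ((n + 2).factorial : ℂ)⁻¹ * χ.act^[n + 2] (X i₀)) = σ
        at h2 h3
      have e : m * (U i₀ - V i₀) = (χ i₀ - (m * V i₀ - σ)) + -σ := by rw [hU i₀]; ring
      rw [e, add_comm 1 δ]
      refine coe_le_order_add h2 ?_
      rwa [order_neg]
    have h2 := coe_le_order_of_mul hδ h1
    have h3 := one_le_order_iff_constCoeff_eq_zero.1 (by exact_mod_cast h2)
    rwa [map_sub, sub_eq_zero] at h3
  have hUu : IsUnit (U i₀) := by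
    rw [MvPowerSeries.isUnit_iff_constantCoeff, hUV]
    exact isUnit_iff_ne_zero.2 hV
  obtain ⟨u, hu⟩ := hUu
  -- As `U i₀` is a unit, `Y i₀` divides all the components of `Y`, so that it is a unit.
  have hk : ∀ i, Y i = (Y i₀ * ↑u⁻¹) * U i := by
    intro i
    refine mul_left_cancel₀ hl ?_
    have h1 : m = l * Y i₀ * ↑u⁻¹ := by
      rw [← hlY i₀, hU i₀, ← hu, mul_assoc, Units.mul_inv, mul_one]
    rw [← hlY i, hU i]
    nth_rw 1 [h1]
    ring
  have hku := hcop _ fun i => ⟨_, hk i⟩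
  rw [MvPowerSeries.isUnit_iff_constantCoeff, map_mul] at hku
  exact left_ne_zero_of_mul hku.ne_zero

end FormalField

/-- `G` is `id + m V` with `m`, `V` holomorphic and `V` nonzero at the origin. This implies that
`G` is not singular, and, unlike the definition of singular germs, it does not involve the
infinitesimal generator. -/
def IsNonsingular (G : C3 → C3) : Prop :=
  ∃ (m : C3 → ℂ) (V : Fin 3 → C3 → ℂ), AnalyticAt ℂ m 0 ∧ (∀ i, AnalyticAt ℂ (V i) 0) ∧
    (∃ i, V i 0 ≠ 0) ∧ ∀ᶠ w in 𝓝 (0 : C3), ∀ i, G w i = w i + m w * V i w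

theorem IsNonsingular.not_isSingularGerm {G : C3 → C3} (h : IsNonsingular G) :
    ¬ IsSingularGerm G := by
  obtain ⟨m, V, hm, hV, ⟨i₀, hi₀⟩, hG⟩ := h
  rintro ⟨χ, Y, ⟨hχ, hexp⟩, hY, hY0⟩
  refine FormalField.constantCoeff_saturation_ne_zero (m := taylor m)
    (V := fun i => taylor (V i)) hχ (fun i d => ?_) (i₀ := i₀) ?_ hY (hY0 i₀)
  · rw [← hexp i d, ← taylor_mul hm (hV i), ← taylor_coord,
      ← taylor_add (analyticAt_coord i 0) (hm.mul (hV i))]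
    congr 1
    refine taylor_congr ?_
    filter_upwards [hG] with w hw
    simp [hw i]
  · rwa [constantCoeff_taylor]

/-! ### Homogeneous parts and division by the exceptional coordinate -/

theorem homPart_congr {n : ℕ} {f g : C3 → ℂ} (h : f =ᶠ[𝓝 0] g) : homPart n f = homPart n g := by
  have := taylor_congr h
  funext v
  refine Finset.sum_congr rfl fun d _ => ?_
  rw [← coeff_taylor, this, coeff_taylor]

theorem homPart_zero (f : C3 → ℂ) (v : C3) : homPart 0 f v = f 0 := by
  rw [homPart, Finset.finsuppAntidiag_zero, Finset.sum_singleton, ← coeff_taylor,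
    MvPowerSeries.coeff_zero_eq_constantCoeff_apply, constantCoeff_taylor]
  simp

theorem homPart_add {n : ℕ} {f g : C3 → ℂ} (hf : AnalyticAt ℂ f 0) (hg : AnalyticAt ℂ g 0)
    (v : C3) : homPart n (f + g) v = homPart n f v + homPart n g v := by
  simp only [homPart, ← coeff_taylor, taylor_add hf hg, map_add, add_mul, Finset.sum_add_distrib]

theorem homPart_const {n : ℕ} (c : ℂ) (v : C3) : homPart (n + 1) (fun _ => c) v = 0 := by
  refine Finset.sum_eq_zero fun d hd => ?_
  have hd' : d ≠ 0 := by
    rintro rfl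
    simp [Finset.mem_finsuppAntidiag] at hd
  rw [← coeff_taylor, taylor_const, MvPowerSeries.coeff_C, if_neg hd', zero_mul]

/-- Multiplication by a coordinate shifts the homogeneous parts. -/
theorem homPart_coord_mul {n : ℕ} {f : C3 → ℂ} (hf : AnalyticAt ℂ f 0) (i : Fin 3) (v : C3) :
    homPart (n + 1) ((fun w => w i) * f) v = v i * homPart n f v := by
  classical
  have hsum : ∀ d : Fin 3 →₀ ℕ,
      ∑ j, (Finsupp.single i 1 + d : Fin 3 →₀ ℕ) j = 1 + ∑ j, d j := fun d => by
    simp [Finsupp.single_apply, Finset.sum_add_distrib]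
  simp only [homPart, ← coeff_taylor, taylor_mul (analyticAt_coord i 0) hf, taylor_coord]
  rw [Finset.mul_sum]
  symm
  refine Finset.sum_of_injOn (fun d => Finsupp.single i 1 + d)
    (fun a _ b _ h => add_left_cancel h) ?_ ?_ ?_
  · intro d hd
    simp only [Finset.mem_coe, Finset.mem_finsuppAntidiag] at hd ⊢
    exact ⟨by rw [hsum, hd.1, add_comm], fun _ _ => Finset.mem_univ _⟩
  · intro d hd hn
    rw [MvPowerSeries.X, MvPowerSeries.coeff_monomial_mul, if_neg, zero_mul]
    intro hle
    refine hn ⟨d - Finsupp.single i 1, ?_, add_tsub_cancel_of_le hle⟩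
    simp only [Finset.mem_coe, Finset.mem_finsuppAntidiag] at hd ⊢
    refine ⟨?_, fun _ _ => Finset.mem_univ _⟩
    have h1 : ∑ j, d j = n + 1 := hd.1
    change ∑ j, (d - Finsupp.single i 1 : Fin 3 →₀ ℕ) j = n
    rw [← add_tsub_cancel_of_le hle, hsum] at h1
    omega
  · intro d _
    rw [MvPowerSeries.X, MvPowerSeries.coeff_add_monomial_mul, one_mul]
    have hprod : ∏ j, v j ^ (Finsupp.single i 1 + d : Fin 3 →₀ ℕ) j =
        (∏ j, v j ^ (Finsupp.single i 1 : Fin 3 →₀ ℕ) j) * ∏ j, v j ^ d j := by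
      rw [← Finset.prod_mul_distrib]
      exact Finset.prod_congr rfl fun j _ => by rw [Finsupp.add_apply, pow_add]
    have hsingle : ∏ j, v j ^ (Finsupp.single i 1 : Fin 3 →₀ ℕ) j = v i := by
      rw [Finset.prod_eq_single i]
      · rw [Finsupp.single_eq_same, pow_one]
      · intro j _ hj
        rw [Finsupp.single_eq_of_ne hj, pow_zero]
      · simp
    rw [hprod, hsingle]
    ring

theorem homPart_eq_zero {n k : ℕ} {f : C3 → ℂ} (hf : HasOrderAtLeast n f) (hk : k < n) (v : C3) :
    homPart k f v = 0 := by
  refine Finset.sum_eq_zero fun d hd => ?_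
  rw [← coeff_taylor, MvPowerSeries.coeff_of_lt_order, zero_mul]
  refine lt_of_lt_of_le ?_ hf.2
  have : d.degree = k := by
    rw [Finsupp.degree_eq_sum]
    exact (Finset.mem_finsuppAntidiag.1 hd).1
  rw [this]
  exact_mod_cast hk

/-- Hadamard's lemma for holomorphic germs. -/
theorem exists_hadamard {f : C3 → ℂ} (hf : AnalyticAt ℂ f 0) :
    ∃ g : Fin 3 → C3 → ℂ, (∀ i, AnalyticAt ℂ (g i) 0) ∧
      ∀ᶠ w in 𝓝 (0 : C3), f w = f 0 + ∑ i, w i * g i w := by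
  -- The cofactors are the components of the shifted power series, which takes values in linear
  -- forms.
  obtain ⟨p, r, hp⟩ := hf
  have hrad : 0 < p.shift.radius := by
    rw [FormalMultilinearSeries.radius_shift]
    exact hp.r_pos.trans_le hp.r_le
  have hs := (p.shift.hasFPowerSeriesOnBall hrad)
  have hu := hs.unshift (z := f 0)
  have hpu : p.shift.unshift (f 0) = p := by
    funext n
    rcases n with _ | n
    · ext v
      have := hp.coeff_zero v
      rw [this]
      rfl
    · exact LinearIsometryEquiv.symm_apply_apply
        (continuousMultilinearCurryRightEquiv' ℂ n C3 ℂ) (p (n + 1))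
  rw [hpu] at hu
  refine ⟨fun i w => p.shift.sum w (Pi.single i 1), fun i => ?_, ?_⟩
  · exact (ContinuousLinearMap.apply ℂ ℂ (Pi.single i 1 : C3)).analyticAt _ |>.comp
      hs.analyticAt
  · filter_upwards [hp.eventually_hasSum, hu.eventually_hasSum] with w h1 h2
    rw [zero_add] at h1 h2
    have e := h1.unique h2
    rw [e, sub_zero]
    congr 1
    conv_lhs => rw [← Finset.univ_sum_single w]
    rw [map_sum]
    refine Finset.sum_congr rfl fun i _ => ?_
    rw [show Pi.single i (w i) = w i • (Pi.single i 1 : C3) by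
      rw [← Pi.single_smul, smul_eq_mul, mul_one], map_smul, smul_eq_mul, Finset.univ_sum_single]

/-- The representative with `j`-th coordinate `1` of the direction with coordinates `x` in the
`j`-th chart of the blow-up of a point. -/
def direction (j : Fin 3) (x : C3) : C3 := Function.update x j 1

theorem blowChart_univ (j : Fin 3) (x : C3) : blowChart Finset.univ j x = x j • direction j x := by
  funext s
  by_cases h : s = j
  · subst h; simp [blowChart, direction]
  · simp [blowChart, direction, h, mul_comm]

theorem blowChart_univ_apply (j s : Fin 3) (x : C3) :
    blowChart Finset.univ j x s = direction j x s * x j := by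
  rw [blowChart_univ]; simp [mul_comm]

@[fun_prop]
theorem analyticAt_blowChart (S : Finset (Fin 3)) (j : Fin 3) (x : C3) :
    AnalyticAt ℂ (blowChart S j) x := by
  rw [analyticAt_pi_iff]
  intro s
  unfold blowChart
  split_ifs <;> fun_prop

@[fun_prop]
theorem analyticAt_direction (j : Fin 3) (x : C3) : AnalyticAt ℂ (direction j) x := by
  rw [analyticAt_pi_iff]
  intro s
  by_cases h : s = j
  · subst h; simpa [direction] using analyticAt_const
  · simpa [direction, h] using analyticAt_coord s x

theorem blowChart_univ_eq_zero {j : Fin 3} {x : C3} (hx : x j = 0) :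
    blowChart Finset.univ j x = 0 := by
  rw [blowChart_univ, hx, zero_smul]

/-- The pullback of a germ to a chart of the blow-up of the origin: after subtracting the
homogeneous parts of degree less than `n`, it is divisible by the `n`-th power of the exceptional
coordinate, and the restriction of the quotient to the exceptional divisor is the homogeneous part
of degree `n`. -/
theorem exists_pullback_expansion (n : ℕ) (j : Fin 3) : ∀ f : C3 → ℂ, AnalyticAt ℂ f 0 →
    ∃ g : C3 → ℂ, ∀ x : C3, x j = 0 → AnalyticAt ℂ g x ∧ g x = homPart n f (direction j x) ∧
      ∀ᶠ u in 𝓝 x, f (blowChart Finset.univ j u) =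
        ∑ k ∈ Finset.range n, u j ^ k * homPart k f (direction j u) + u j ^ n * g u := by
  induction n with
  | zero =>
    intro f hf
    refine ⟨fun u => f (blowChart Finset.univ j u), fun x hx => ⟨?_, ?_, by simp⟩⟩
    · have := blowChart_univ_eq_zero hx
      rw [← this] at hf
      exact hf.fun_comp (analyticAt_blowChart _ _ _)
    · simp only [homPart_zero, blowChart_univ_eq_zero hx]
  | succ n ih =>
    intro f hf
    obtain ⟨g, hg, hfg⟩ := exists_hadamard hf
    choose G hG using fun i => ih (g i) (hg i)
    have hhom : ∀ k v, homPart (k + 1) f v = ∑ i, v i * homPart k (g i) v := by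
      intro k v
      have e : f =ᶠ[𝓝 0] (fun _ => f 0) + ((fun w => w 0) * g 0 + ((fun w => w 1) * g 1 +
          (fun w => w 2) * g 2)) := by
        filter_upwards [hfg] with w hw
        rw [hw, Fin.sum_univ_three]
        simp [add_assoc]
      have a := fun i => (analyticAt_coord i 0).mul (hg i)
      rw [homPart_congr e, homPart_add analyticAt_const ((a 0).add ((a 1).add (a 2))),
        homPart_add (a 0) ((a 1).add (a 2)), homPart_add (a 1) (a 2), homPart_const,
        homPart_coord_mul (hg 0), homPart_coord_mul (hg 1), homPart_coord_mul (hg 2),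
        Fin.sum_univ_three]
      ring
    refine ⟨fun u => ∑ i, direction j u i * G i u, fun x hx => ⟨?_, ?_, ?_⟩⟩
    · refine Finset.analyticAt_fun_sum _ fun i _ => ?_
      have h1 := (analyticAt_coord i (direction j x)).fun_comp (analyticAt_direction j x)
      exact h1.mul (hG i x hx).1
    · rw [hhom]
      exact Finset.sum_congr rfl fun i _ => by rw [(hG i x hx).2.1]
    · have hlim : Filter.Tendsto (blowChart Finset.univ j) (𝓝 x) (𝓝 0) := by
        have := (analyticAt_blowChart Finset.univ j x).continuousAt.tendsto
        rwa [blowChart_univ_eq_zero hx] at this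
      filter_upwards [hlim.eventually hfg, (hG 0 x hx).2.2, (hG 1 x hx).2.2, (hG 2 x hx).2.2]
        with u h h0 h1 h2
      rw [h, Fin.sum_univ_three, h0, h1, h2, Finset.sum_range_succ']
      simp only [blowChart_univ_apply, hhom, Fin.sum_univ_three, homPart_zero, mul_add, pow_succ,
        Finset.sum_add_distrib, pow_zero, one_mul]
      have e : ∀ i, ∑ k ∈ Finset.range n, u j ^ k * u j *
          (direction j u i * homPart k (g i) (direction j u)) = direction j u i * u j *
          ∑ k ∈ Finset.range n, u j ^ k * homPart k (g i) (direction j u) := by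
        intro i
        rw [Finset.mul_sum]
        exact Finset.sum_congr rfl fun k _ => by ring
      rw [e, e, e]
      ring

theorem exists_pullback {n : ℕ} {f : C3 → ℂ} (hf : HasOrderAtLeast n f) (j : Fin 3) :
    ∃ g : C3 → ℂ, ∀ x : C3, x j = 0 → AnalyticAt ℂ g x ∧ g x = homPart n f (direction j x) ∧
      ∀ᶠ u in 𝓝 x, f (blowChart Finset.univ j u) = u j ^ n * g u := by
  obtain ⟨g, hg⟩ := exists_pullback_expansion n j f hf.1
  refine ⟨g, fun x hx => ⟨(hg x hx).1, (hg x hx).2.1, ?_⟩⟩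
  filter_upwards [(hg x hx).2.2] with u hu
  rw [hu, Finset.sum_eq_zero, zero_add]
  intro k hk
  rw [homPart_eq_zero hf (Finset.mem_range.1 hk), mul_zero]

/-! ### The local expression of a blow-up -/

namespace CenterPiece

variable {I : Type}

/-- The blow-up of a piece of a center, from its `j`-th chart to the chart of the piece. -/
def blowMap (c : CenterPiece I) (j : Fin 3) (x : C3) : C3 := c.base + blowChart c.dirs j x

/-- The inverse of `blowMap`, outside the exceptional divisor. -/
def blowInv (c : CenterPiece I) (j : Fin 3) (y : C3) : C3 :=
  fun s => if s ∈ c.dirs ∧ s ≠ j then (y s - c.base s) / (y j - c.base j) else y s - c.base s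

variable (c : CenterPiece I) (j : Fin 3)

theorem blowMap_self (x : C3) : c.blowMap j x j = c.base j + x j := by
  simp [blowMap, blowChart]

theorem blowMap_of_mem {s : Fin 3} (hs : s ∈ c.dirs) (hsj : s ≠ j) (x : C3) :
    c.blowMap j x s = c.base s + x s * x j := by
  simp [blowMap, blowChart, hs, hsj]

theorem blowMap_of_notMem {s : Fin 3} (hs : s ∉ c.dirs) (x : C3) :
    c.blowMap j x s = c.base s + x s := by
  simp [blowMap, blowChart, hs]

@[fun_prop]
theorem analyticAt_blowMap (x : C3) : AnalyticAt ℂ (c.blowMap j) x :=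
  analyticAt_const.add (analyticAt_blowChart _ _ _)

theorem continuous_blowMap : Continuous (c.blowMap j) :=
  continuous_iff_continuousAt.2 fun x => (c.analyticAt_blowMap j x).continuousAt

theorem analyticAt_blowInv {y : C3} (hy : y j ≠ c.base j) : AnalyticAt ℂ (c.blowInv j) y := by
  rw [analyticAt_pi_iff]
  intro s
  have := sub_ne_zero.2 hy
  unfold blowInv
  split_ifs
  · fun_prop (disch := assumption)
  · fun_prop

variable {c j}

theorem blowInv_blowMap {x : C3} (hx : x j ≠ 0) : c.blowInv j (c.blowMap j x) = x := by
  funext s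
  by_cases hs : s ∈ c.dirs ∧ s ≠ j
  · simp only [blowInv, if_pos hs, blowMap_self, blowMap_of_mem c j hs.1 hs.2]
    rw [add_sub_cancel_left, add_sub_cancel_left, mul_div_cancel_right₀ _ hx]
  · simp only [blowInv, if_neg hs]
    by_cases hj : s = j
    · subst hj; simp [blowMap_self]
    · rw [blowMap_of_notMem c j (by tauto)]; ring

theorem blowMap_blowInv {y : C3} (hy : y j ≠ c.base j) : c.blowMap j (c.blowInv j y) = y := by
  have h := sub_ne_zero.2 hy
  funext s
  by_cases hs : s ∈ c.dirs ∧ s ≠ j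
  · rw [blowMap_of_mem c j hs.1 hs.2]
    simp only [blowInv, if_pos hs]
    simp only [ne_eq, not_true_eq_false, and_false, if_false]
    field_simp
    ring
  · by_cases hj : s = j
    · subst hj; simp [blowMap_self, blowInv]
    · rw [blowMap_of_notMem c j (by tauto)]
      simp [blowInv, if_neg hs]

theorem blowMap_ne_base {x : C3} (hx : x j ≠ 0) : c.blowMap j x j ≠ c.base j := by
  rw [blowMap_self]; simpa using hx

theorem blowMap_mem_center {x : C3} (hx : x j = 0) {s : Fin 3} (hs : s ∈ c.dirs) :
    c.blowMap j x s = c.base s := by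
  by_cases hj : s = j
  · subst hj; rw [blowMap_self, hx, add_zero]
  · rw [blowMap_of_mem c j hs hj, hx, mul_zero, add_zero]

theorem tendsto_blowInv {x : C3} (hx : x j ≠ 0) :
    Filter.Tendsto (c.blowInv j) (𝓝 (c.blowMap j x)) (𝓝 x) := by
  have := (c.analyticAt_blowInv j (blowMap_ne_base hx)).continuousAt.tendsto
  rwa [blowInv_blowMap hx] at this

theorem eventually_ne_base {y : C3} (hy : y j ≠ c.base j) : ∀ᶠ z in 𝓝 y, z j ≠ c.base j :=
  (continuous_apply j).continuousAt.eventually_ne hy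

end CenterPiece

/-! ### Geometry of modifications given by charts -/

namespace Model

/-- The properties of charts which make them behave as charts of a modification of `ℂ³` which is
injective outside the exceptional divisor: the domain of a chart contains the complement of the
exceptional divisor, which is dense, and on which `proj` is injective. -/
structure IsGood (M : Model) : Prop where
  continuous_proj : ∀ i, Continuous (M.proj i)
  mem_dom : ∀ i x, M.proj i x ≠ 0 → x ∈ M.dom i
  frequently_ne : ∀ i x, ∃ᶠ y in 𝓝 x, M.proj i y ≠ 0
  inj : ∀ i x y, M.proj i x ≠ 0 → M.proj i x = M.proj i y → x = y

theorem isGood_affine : affine.IsGood where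
  continuous_proj _ := continuous_id
  mem_dom _ _ _ := Set.mem_univ _
  frequently_ne _ x := by
    have h : Dense ({0}ᶜ : Set C3) := dense_compl_singleton 0
    exact mem_closure_iff_frequently.1 (h x)
  inj _ _ _ _ h := h

variable {M : Model}

theorem IsGood.proj_eq (hM : M.IsGood) {i j : M.chart} {x y : C3} (h : M.Glued i j x y) :
    M.proj i x = M.proj j y := by
  have hc : IsClosed {q : C3 × C3 | M.proj i q.1 = M.proj j q.2} :=
    isClosed_eq ((hM.continuous_proj i).comp continuous_fst)
      ((hM.continuous_proj j).comp continuous_snd)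
  exact closure_minimal (fun q hq => hq.2.2.1) hc h

theorem IsGood.eq_of_glued (hM : M.IsGood) {i : M.chart} {x y : C3} (h : M.Glued i i x y) :
    x = y := by
  have hc : IsClosed {q : C3 × C3 | q.1 = q.2} := isClosed_eq continuous_fst continuous_snd
  exact closure_minimal (fun q hq => hM.inj i _ _ hq.2.2.2 hq.2.2.1) hc h

theorem IsGood.glued_self (hM : M.IsGood) (i : M.chart) (x : C3) : M.Glued i i x x := by
  refine mem_closure_iff_frequently.2 ?_
  have : Filter.Tendsto (fun y : C3 => (y, y)) (𝓝 x) (𝓝 (x, x)) :=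
    (continuous_id.prodMk continuous_id).tendsto x
  refine this.frequently ((hM.frequently_ne i x).mono fun y hy => ?_)
  exact ⟨hM.mem_dom i y hy, hM.mem_dom i y hy, rfl, hy⟩

section BlowUp

variable {K : Type} (Z : K → CenterPiece M.chart)

/-- A chart of the blow-up of a piece of a center. -/
def pieceChart (k : K) (j : Fin 3) (hj : j ∈ (Z k).dirs) : (M.blowUp Z).chart :=
  Sum.inr ⟨k, ⟨j, hj⟩⟩

/-- The center is contained in the fiber over the origin. -/
def CenterOverZero : Prop :=
  ∀ k x, (∀ s ∈ (Z k).dirs, x s = (Z k).base s) → M.proj (Z k).chart x = 0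

variable {Z}

theorem CenterOverZero.proj_eq_zero (hZ : CenterOverZero Z) (hM : M.IsGood) {i : M.chart} {y : C3}
    (h : M.InCenter Z i y) : M.proj i y = 0 := by
  obtain ⟨k, x, _, hx, hg⟩ := h
  rw [← hM.proj_eq hg]
  exact hZ k x hx

theorem CenterOverZero.ne_zero (hZ : CenterOverZero Z) {k : K} {j : Fin 3}
    {x : C3} (h : M.proj (Z k).chart ((Z k).blowMap j x) ≠ 0) : x j ≠ 0 :=
  fun hx => h (hZ k _ fun _ hs => CenterPiece.blowMap_mem_center hx hs)

theorem IsGood.blowUp (hM : M.IsGood) (hZ : CenterOverZero Z) : (M.blowUp Z).IsGood where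
  continuous_proj := by
    rintro (i | ⟨k, j, hj⟩)
    · exact hM.continuous_proj i
    · exact (hM.continuous_proj _).comp ((Z k).continuous_blowMap j)
  mem_dom := by
    rintro (i | ⟨k, j, hj⟩) x hx
    · exact ⟨hM.mem_dom i x hx, fun h => hx (hZ.proj_eq_zero hM h)⟩
    · exact hM.mem_dom _ _ hx
  frequently_ne := by
    rintro (i | ⟨k, j, hj⟩) x
    · exact hM.frequently_ne i x
    · have hd : ∃ᶠ y in 𝓝 x, y j ≠ 0 := by
        have h1 : Dense ({0}ᶜ : Set ℂ) := dense_compl_singleton 0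
        have h2 := (h1.preimage (isOpenMap_eval (X := fun _ : Fin 3 => ℂ) j)) x
        exact mem_closure_iff_frequently.1 h2
      have key : ∀ y : C3, y j ≠ 0 → ∃ᶠ z in 𝓝 y, M.proj (Z k).chart ((Z k).blowMap j z) ≠ 0 := by
        intro y hy
        refine (CenterPiece.tendsto_blowInv (c := Z k) hy).frequently ?_
        refine ((hM.frequently_ne (Z k).chart ((Z k).blowMap j y)).and_eventually
          (CenterPiece.eventually_ne_base (CenterPiece.blowMap_ne_base hy))).mono ?_
        rintro z ⟨h1, h2⟩
        rwa [CenterPiece.blowMap_blowInv h2]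
      -- A point of the exceptional divisor of the chart is a limit of points outside it, which are
      -- themselves limits of points where `proj` does not vanish.
      intro hcon
      refine hd ((eventually_eventually_nhds.2 hcon).mono fun y hy hyj => key y hyj hy)
  inj := by
    rintro (i | ⟨k, j, hj⟩) x y hx hxy
    · exact hM.inj i x y hx hxy
    · have h := hM.inj _ _ _ hx hxy
      have hxj := hZ.ne_zero hx
      have hx' : M.proj (Z k).chart ((Z k).blowMap j y) ≠ 0 := fun h0 => hx (hxy.trans h0)
      have hyj := hZ.ne_zero hx'
      have h' : (Z k).blowMap j x = (Z k).blowMap j y := h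
      rw [← CenterPiece.blowInv_blowMap (c := Z k) hxj, h', CenterPiece.blowInv_blowMap hyj]

theorem Glued.inl_inl (hM : M.IsGood) (hZ : CenterOverZero Z) {i j : M.chart} {x y : C3}
    (h : M.Glued i j x y) : (M.blowUp Z).Glued (Sum.inl i) (Sum.inl j) x y := by
  have hG := hM.blowUp hZ
  unfold Glued at h ⊢
  refine closure_mono ?_ h
  intro q hq
  refine ⟨?_, ?_, hq.2.2.1, hq.2.2.2⟩
  · exact hG.mem_dom (Sum.inl i) _ hq.2.2.2
  · exact hG.mem_dom (Sum.inl j) _ (hq.2.2.1 ▸ hq.2.2.2 : M.proj j q.2 ≠ 0)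

theorem Glued.of_inr_inl {k : K} {j : Fin 3} {hj : j ∈ (Z k).dirs} {i : M.chart} {x y : C3}
    (h : (M.blowUp Z).Glued (pieceChart Z k j hj) (Sum.inl i) x y) :
    M.Glued (Z k).chart i ((Z k).blowMap j x) y := by
  have hc : Continuous fun q : C3 × C3 => ((Z k).blowMap j q.1, q.2) :=
    (((Z k).continuous_blowMap j).comp continuous_fst).prodMk continuous_snd
  unfold Glued at h ⊢
  refine map_mem_closure (f := fun q : C3 × C3 => ((Z k).blowMap j q.1, q.2)) hc h ?_
  intro q hq
  exact ⟨hq.1, hq.2.1.1, hq.2.2.1, hq.2.2.2⟩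

theorem Glued.inl_inr (hM : M.IsGood) (hZ : CenterOverZero Z) {k : K} {j : Fin 3}
    (hj : j ∈ (Z k).dirs) {i : M.chart} {x y : C3} (hy : y j ≠ 0)
    (h : M.Glued i (Z k).chart x ((Z k).blowMap j y)) :
    (M.blowUp Z).Glued (Sum.inl i) (pieceChart Z k j hj) x y := by
  have hG := hM.blowUp hZ
  refine mem_closure_iff_frequently.2 ?_
  have ht : Filter.Tendsto (fun q : C3 × C3 => (q.1, (Z k).blowInv j q.2))
      (𝓝 (x, (Z k).blowMap j y)) (𝓝 (x, y)) := by
    rw [nhds_prod_eq, nhds_prod_eq]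
    exact Filter.Tendsto.prodMap Filter.tendsto_id (CenterPiece.tendsto_blowInv hy)
  refine ht.frequently ?_
  have he : ∀ᶠ q : C3 × C3 in 𝓝 (x, (Z k).blowMap j y), q.2 j ≠ (Z k).base j :=
    (continuous_snd.tendsto (x, (Z k).blowMap j y)).eventually
      (CenterPiece.eventually_ne_base (CenterPiece.blowMap_ne_base hy))
  refine ((mem_closure_iff_frequently.1 h).and_eventually he).mono ?_
  rintro q ⟨⟨_, _, h3, h4⟩, h5⟩
  have h6 : (M.blowUp Z).proj (pieceChart Z k j hj) ((Z k).blowInv j q.2) =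
      M.proj (Z k).chart q.2 := by
    change M.proj (Z k).chart ((Z k).blowMap j ((Z k).blowInv j q.2)) = _
    rw [CenterPiece.blowMap_blowInv h5]
  exact ⟨hG.mem_dom (Sum.inl i) _ h4, hG.mem_dom _ _ (by rw [h6, ← h3]; exact h4),
    by rw [h6]; exact h3, h4⟩

end BlowUp

/-! ### Lifts -/

/-- A lift is determined by its values outside the exceptional divisor, hence unique. -/
theorem IsGood.isLiftAt_unique (hM : M.IsGood) {f : C3 → C3} (hf : ∀ᶠ w in 𝓝 0, f w = 0 → w = 0)
    {i : M.chart} {x : C3} (hx : M.proj i x = 0) {F G : C3 → C3} (hF : M.IsLiftAt f i x F)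
    (hG : M.IsLiftAt f i x G) : F =ᶠ[𝓝 x] G := by
  have h0 : ∀ᶠ y in 𝓝 x, f (M.proj i y) = 0 → M.proj i y = 0 := by
    have ht : Filter.Tendsto (M.proj i) (𝓝 x) (𝓝 0) := by
      rw [← hx]; exact (hM.continuous_proj i).tendsto x
    exact ht.eventually hf
  have key : ∀ᶠ y in 𝓝 x, M.proj i y ≠ 0 → F y = G y := by
    filter_upwards [h0, hF.2.2, hG.2.2] with y h1 h2 h3 hy
    refine hM.inj i _ _ ?_ (h2.trans h3.symm)
    rw [h2]
    exact fun h => hy (h1 h)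
  filter_upwards [hF.1.eventually_analyticAt, hG.1.eventually_analyticAt,
    eventually_eventually_nhds.2 key] with y h1 h2 h3
  refine tendsto_nhds_unique_of_frequently_eq h1.continuousAt.tendsto h2.continuousAt.tendsto ?_
  exact ((hM.frequently_ne i y).and_eventually h3).mono fun z hz => hz.2 hz.1

end Model

/-- The origin is an isolated zero of a tangent to the identity germ. -/
theorem IsTangentToId.eventually_eq_zero {f : C3 → C3} (hf : IsTangentToId f) :
    ∀ᶠ w in 𝓝 0, f w = 0 → w = 0 := by
  have h := hf.1.differentiableAt.hasFDerivAt.isLittleO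
  have h2 := h.def (c := 1 / 2) (by norm_num)
  filter_upwards [h2] with w hw h0
  rw [hf.2.2, h0, hf.2.1] at hw
  simp only [sub_zero, ContinuousLinearMap.id_apply, zero_sub, norm_neg] at hw
  have := norm_nonneg w
  exact norm_eq_zero.1 (by linarith)

/-- The germ is a simple corner, a degenerate spike or a spinning corner. -/
def IsFinal (G : C3 → C3) : Prop :=
  IsSimpleCorner G ∨ IsDegenerateSpike G ∨ IsSpinningCorner G

section Congr

variable {G G' : C3 → C3}

theorem IsNonsingular.congr (h : IsNonsingular G) (e : G' =ᶠ[𝓝 0] G) : IsNonsingular G' := by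
  obtain ⟨m, V, hm, hV, h0, hG⟩ := h
  refine ⟨m, V, hm, hV, h0, ?_⟩
  filter_upwards [hG, e] with w h1 h2
  rwa [h2]

/-- The change of coordinates `ψ` conjugates the germ `G'` to the germ `G`. -/
structure GermConj (ψ G' G : C3 → C3) : Prop where
  analytic : AnalyticAt ℂ ψ 0
  map_zero : ψ 0 = 0
  invertible : (fderiv ℂ ψ 0).IsInvertible
  conj : ∀ᶠ w in 𝓝 (0 : C3), ψ (G' w) = G (ψ w)
  analytic_left : AnalyticAt ℂ G' 0
  left_zero : G' 0 = 0

variable {ψ : C3 → C3}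

theorem GermConj.isTangentToId (h : GermConj ψ G' G) (hG : IsTangentToId G) : IsTangentToId G' := by
  refine ⟨h.analytic_left, h.left_zero, ?_⟩
  have e : (ψ ∘ G') =ᶠ[𝓝 0] (G ∘ ψ) := h.conj
  have e2 := e.fderiv_eq (𝕜 := ℂ)
  have d1 : DifferentiableAt ℂ ψ (G' 0) := by rw [h.left_zero]; exact h.analytic.differentiableAt
  have d2 : DifferentiableAt ℂ G (ψ 0) := by rw [h.map_zero]; exact hG.1.differentiableAt
  rw [fderiv_comp _ d1 h.analytic_left.differentiableAt, fderiv_comp _ d2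
    h.analytic.differentiableAt, h.left_zero, h.map_zero, hG.2.2] at e2
  ext1 v
  have := DFunLike.congr_fun e2 v
  exact h.invertible.injective this

theorem GermConj.inSomeCoordinates (h : GermConj ψ G' G) {N : C3 → C3}
    (hG : InSomeCoordinates G N) : InSomeCoordinates G' N := by
  obtain ⟨φ, h1, h2, h3, h4⟩ := hG
  have h1' : AnalyticAt ℂ φ (ψ 0) := by rw [h.map_zero]; exact h1
  refine ⟨φ ∘ ψ, h1'.comp h.analytic, by simp [h.map_zero, h2], ?_, ?_⟩
  · rw [fderiv_comp _ h1'.differentiableAt h.analytic.differentiableAt, h.map_zero]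
    exact h3.comp h.invertible
  · have ht : Filter.Tendsto ψ (𝓝 0) (𝓝 0) := by
      have := h.analytic.continuousAt.tendsto
      rwa [h.map_zero] at this
    filter_upwards [h.conj, ht.eventually h4] with w e1 e2
    simp only [Function.comp_apply]
    rw [e1, e2]

theorem GermConj.isFinal (h : GermConj ψ G' G) (hG : IsFinal G) : IsFinal G' := by
  rcases hG with hG | hG | hG
  · obtain ⟨ht, a, b, c, l, m, P, Q, R, h1, h2, h3, h4, h5, h6, h7, h8, h9⟩ := hG
    exact Or.inl ⟨h.isTangentToId ht, a, b, c, l, m, P, Q, R, h1, h2, h3, h4, h5, h6, h7, h8,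
      h.inSomeCoordinates h9⟩
  · obtain ⟨ht, c, l, m, P, Q, R, h1, h2, h3, h4, h5, h6, h7⟩ := hG
    exact Or.inr (Or.inl ⟨h.isTangentToId ht, c, l, m, P, Q, R, h1, h2, h3, h4, h5, h6,
      h.inSomeCoordinates h7⟩)
  · obtain ⟨ht, b, c, P, Q, R, h1, h2, h3, h4, h5, h6⟩ := hG
    exact Or.inr (Or.inr ⟨h.isTangentToId ht, b, c, P, Q, R, h1, h2, h3, h4, h5,
      h.inSomeCoordinates h6⟩)

theorem GermConj.of_eventuallyEq (e : G' =ᶠ[𝓝 0] G) (hG : AnalyticAt ℂ G 0) (h0 : G 0 = 0) :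
    GermConj id G' G where
  analytic := analyticAt_id
  map_zero := rfl
  invertible := by rw [fderiv_id]; exact ⟨ContinuousLinearEquiv.refl ℂ C3, rfl⟩
  conj := e
  analytic_left := hG.congr e.symm
  left_zero := e.eq_of_nhds.trans h0

end Congr

theorem germAt_congr {x : C3} {F G : C3 → C3} (h : F =ᶠ[𝓝 x] G) :
    germAt x F =ᶠ[𝓝 0] germAt x G := by
  have ht : Filter.Tendsto (fun w : C3 => x + w) (𝓝 0) (𝓝 x) := by
    have : Continuous fun w : C3 => x + w := by fun_prop
    simpa using this.tendsto 0
  filter_upwards [ht.eventually h] with w hw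
  simp [germAt, hw]

theorem analyticAt_germAt {x : C3} {F : C3 → C3} (h : AnalyticAt ℂ F x) :
    AnalyticAt ℂ (germAt x F) 0 := by
  have h' : AnalyticAt ℂ F (x + 0) := by rwa [add_zero]
  exact (h'.fun_comp (f := fun w : C3 => x + w) (by fun_prop)).sub analyticAt_const

namespace CenterPiece

variable {I : Type} {c : CenterPiece I} {j : Fin 3}

/-- Outside the exceptional divisor, the blow-up conjugates the lift of a germ to the germ. -/
theorem germConj_germAt {x : C3} (hx : x j ≠ 0) {F F' : C3 → C3}
    (hF' : AnalyticAt ℂ F' x) (hx' : F' x = x)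
    (h : ∀ᶠ y in 𝓝 x, c.blowMap j (F' y) = F (c.blowMap j y)) :
    GermConj (fun w => c.blowMap j (x + w) - c.blowMap j x) (germAt x F')
      (germAt (c.blowMap j x) F) := by
  have ha : AnalyticAt ℂ (fun w : C3 => c.blowMap j (x + w) - c.blowMap j x) 0 :=
    ((c.analyticAt_blowMap j (x + 0)).fun_comp (f := fun w : C3 => x + w) (by fun_prop)).sub
      analyticAt_const
  have hb : AnalyticAt ℂ (fun v : C3 => c.blowInv j (c.blowMap j x + v) - x) 0 := by
    have := c.analyticAt_blowInv j (y := c.blowMap j x + 0) (by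
      rw [add_zero]; exact blowMap_ne_base hx)
    exact (this.fun_comp (f := fun w : C3 => c.blowMap j x + w) (by fun_prop)).sub
      analyticAt_const
  refine ⟨ha, by simp, ?_, ?_, analyticAt_germAt hF', by simp [germAt, hx']⟩
  · have h1 : (fun w : C3 => c.blowMap j (x + w) - c.blowMap j x) ∘
        (fun v : C3 => c.blowInv j (c.blowMap j x + v) - x) =ᶠ[𝓝 0] id := by
      have ht : Filter.Tendsto (fun w : C3 => c.blowMap j x + w) (𝓝 0) (𝓝 (c.blowMap j x)) := by
        have : Continuous fun w : C3 => c.blowMap j x + w := by fun_prop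
        simpa using this.tendsto 0
      filter_upwards [ht.eventually (eventually_ne_base (blowMap_ne_base hx))] with w hw
      simp only [Function.comp_apply, add_sub_cancel, blowMap_blowInv hw, add_sub_cancel_left, id]
    have h2 : (fun v : C3 => c.blowInv j (c.blowMap j x + v) - x) ∘
        (fun w : C3 => c.blowMap j (x + w) - c.blowMap j x) =ᶠ[𝓝 0] id := by
      have ht : ∀ᶠ w : C3 in 𝓝 0, (x + w) j ≠ 0 := by
        have : Continuous fun w : C3 => (x + w) j := by fun_prop
        exact this.continuousAt.eventually_ne (by simpa using hx)
      filter_upwards [ht] with w hw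
      simp only [Function.comp_apply, add_sub_cancel, blowInv_blowMap hw, add_sub_cancel_left, id]
    have e1 := h1.fderiv_eq (𝕜 := ℂ)
    have e2 := h2.fderiv_eq (𝕜 := ℂ)
    rw [fderiv_comp _ (by simpa [blowInv_blowMap hx] using ha.differentiableAt)
      hb.differentiableAt, fderiv_id] at e1
    rw [fderiv_comp _ (by simpa using hb.differentiableAt) ha.differentiableAt, fderiv_id] at e2
    simp only [add_zero, sub_self, blowInv_blowMap hx] at e1 e2
    exact ContinuousLinearMap.IsInvertible.of_inverse e1 e2
  · have ht : Filter.Tendsto (fun w : C3 => x + w) (𝓝 0) (𝓝 x) := by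
      have : Continuous fun w : C3 => x + w := by fun_prop
      simpa using this.tendsto 0
    filter_upwards [ht.eventually h] with w hw
    simp [germAt, hw]

/-- Nonsingularity, in the explicit form `id + m V` with `V 0 ≠ 0`, is transported by the blow-up
outside its exceptional divisor: the components of the new field are those of `V`, or the difference
quotients obtained from `y s / y j`. -/
theorem isNonsingular_germAt_blowInv {x : C3} (hx : x j ≠ 0) {F : C3 → C3}
    (hFx : F (c.blowMap j x) = c.blowMap j x)
    (h : IsNonsingular (germAt (c.blowMap j x) F)) :
    IsNonsingular (germAt x fun y => c.blowInv j (F (c.blowMap j y))) := by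
  obtain ⟨m, V, hm, hV, ⟨s₀, hs₀⟩, hG⟩ := h
  set ψ : C3 → C3 := fun w => c.blowMap j (x + w) - c.blowMap j x with hψ
  have hψ0 : ψ 0 = 0 := by simp [hψ]
  have ha : AnalyticAt ℂ ψ 0 :=
    ((c.analyticAt_blowMap j (x + 0)).fun_comp (f := fun w : C3 => x + w) (by fun_prop)).sub
      analyticAt_const
  have hm' : AnalyticAt ℂ (fun w => m (ψ w)) 0 := by
    rw [← hψ0] at hm; exact hm.fun_comp ha
  have hV' : ∀ s, AnalyticAt ℂ (fun w => V s (ψ w)) 0 := fun s => by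
    have := hV s
    rw [← hψ0] at this; exact this.fun_comp ha
  have hmV : m 0 * V j 0 = 0 := by
    have := hG.self_of_nhds j
    simpa [germAt, hFx] using this.symm
  have hx0 : AnalyticAt ℂ (fun w : C3 => (x + w) j) 0 := by
    simp only [Pi.add_apply]; fun_prop
  have hxs : ∀ s, AnalyticAt ℂ (fun w : C3 => (x + w) s) 0 := by
    intro s; simp only [Pi.add_apply]; fun_prop
  have hden : (x + 0) j + m (ψ 0) * V j (ψ 0) ≠ 0 := by
    rw [hψ0, hmV]; simpa using hx
  have hdenA := hx0.fun_add (hm'.fun_mul (hV' j))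
  refine ⟨fun w => m (ψ w), fun s w => if s ∈ c.dirs ∧ s ≠ j then
    (V s (ψ w) - (x + w) s * V j (ψ w)) / ((x + w) j + m (ψ w) * V j (ψ w)) else V s (ψ w),
    hm', fun s => ?_, ?_, ?_⟩
  · dsimp only
    split_ifs
    · exact ((hV' s).fun_sub ((hxs s).fun_mul (hV' j))).fun_div hdenA hden
    · exact hV' s
  · by_contra! hcon
    have h1 : V j 0 = 0 := by simpa [hψ0] using hcon j
    refine hs₀ ?_
    have h2 := hcon s₀
    simp only [hψ0, h1, mul_zero, sub_zero, add_zero] at h2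
    split_ifs at h2 with hc
    · exact (div_eq_zero_iff.1 h2).resolve_right hx
    · exact h2
  · have ht : Filter.Tendsto ψ (𝓝 0) (𝓝 0) := by
      have := ha.continuousAt.tendsto
      rwa [hψ0] at this
    filter_upwards [ht.eventually hG, hdenA.continuousAt.eventually_ne hden] with w hw hd s
    have hF : ∀ s, F (c.blowMap j (x + w)) s = c.blowMap j (x + w) s + m (ψ w) * V s (ψ w) := by
      intro s
      have := hw s
      simp only [germAt, hψ, add_sub_cancel, Pi.sub_apply] at this
      linear_combination this
    simp only [germAt, Pi.sub_apply, blowInv, hF, blowMap_self]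
    by_cases hs : s ∈ c.dirs ∧ s ≠ j
    · simp only [if_pos hs, blowMap_of_mem c j hs.1 hs.2]
      have : c.base j + (x + w) j + m (ψ w) * V j (ψ w) - c.base j =
        (x + w) j + m (ψ w) * V j (ψ w) := by ring
      rw [this]
      field_simp
      simp only [Pi.add_apply]
      ring
    · simp only [if_neg hs]
      by_cases hj : s = j
      · subst hj; rw [blowMap_self]; simp only [Pi.add_apply]; ring
      · rw [blowMap_of_notMem c j (by tauto)]; simp only [Pi.add_apply]; ring

end CenterPiece

/-! ### Resolution along a modification -/

namespace Model

/-- At the point with coordinates `x` in the chart `i`, the germ `f` has a lift which fixes the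
point, is tangent to the identity, and is either nonsingular, or in one of the three final classes
in case `x` belongs to `S`. -/
def ResolvedAt (M : Model) (f : C3 → C3) (S : Set C3) (i : M.chart) (x : C3) : Prop :=
  ∃ F : C3 → C3, M.IsLiftAt f i x F ∧ IsTangentToId (germAt x F) ∧
    (IsNonsingular (germAt x F) ∨ (x ∈ S ∧ IsFinal (germAt x F)))

/-- In each chart, `f` is resolved at all points of the exceptional divisor outside the sets `C i`,
with finitely many points which may be singular. -/
def ResolvedOff (M : Model) (f : C3 → C3) (C : M.chart → Set C3) : Prop :=
  ∀ i, ∃ S : Set C3, S.Finite ∧ ∀ x ∈ M.dom i, M.proj i x = 0 → x ∉ C i → M.ResolvedAt f S i x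

variable {M : Model} {f : C3 → C3}

theorem ResolvedAt.mono {S S' : Set C3} {i : M.chart} {x : C3} (h : M.ResolvedAt f S i x)
    (hS : S ⊆ S') : M.ResolvedAt f S' i x := by
  obtain ⟨F, h1, h2, h3⟩ := h
  exact ⟨F, h1, h2, h3.imp_right fun h4 => ⟨hS h4.1, h4.2⟩⟩

section BlowUp

variable {K : Type} {Z : K → CenterPiece M.chart}

/-- Outside the exceptional divisor of a blow-up, nothing changes. -/
theorem ResolvedAt.of_blowMap {S : Set C3} {k : K} {j : Fin 3} (hj : j ∈ (Z k).dirs) {x : C3}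
    (hx : x j ≠ 0) (h : M.ResolvedAt f S (Z k).chart ((Z k).blowMap j x)) :
    (M.blowUp Z).ResolvedAt f {y | y j ≠ 0 ∧ (Z k).blowMap j y ∈ S} (pieceChart Z k j hj) x := by
  obtain ⟨F, ⟨hF, hFx, hlift⟩, h2, h3⟩ := h
  set F' : C3 → C3 := fun y => (Z k).blowInv j (F ((Z k).blowMap j y)) with hF'
  have hne := CenterPiece.blowMap_ne_base (c := Z k) hx
  have hFb : AnalyticAt ℂ (fun y => F ((Z k).blowMap j y)) x :=
    hF.fun_comp ((Z k).analyticAt_blowMap j x)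
  have hF'a : AnalyticAt ℂ F' x := by
    have := (Z k).analyticAt_blowInv j hne
    rw [← hFx] at this
    exact AnalyticAt.fun_comp (g := (Z k).blowInv j) (f := fun y => F ((Z k).blowMap j y)) this hFb
  have hF'x : F' x = x := by
    simp only [hF', hFx]
    exact CenterPiece.blowInv_blowMap hx
  have hbl : ∀ᶠ y in 𝓝 x, (Z k).blowMap j (F' y) = F ((Z k).blowMap j y) := by
    have : Filter.Tendsto (fun y => F ((Z k).blowMap j y)) (𝓝 x) (𝓝 ((Z k).blowMap j x)) := by
      have := hFb.continuousAt.tendsto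
      rwa [hFx] at this
    filter_upwards [this.eventually (CenterPiece.eventually_ne_base hne)] with y hy
    exact CenterPiece.blowMap_blowInv hy
  have hconj := CenterPiece.germConj_germAt hx hF'a hF'x hbl
  refine ⟨F', ⟨hF'a, hF'x, ?_⟩, hconj.isTangentToId h2, ?_⟩
  · have ht := (((Z k).continuous_blowMap j).tendsto x).eventually hlift
    filter_upwards [hbl, ht] with y h4 h5
    change M.proj (Z k).chart ((Z k).blowMap j (F' y)) =
      f (M.proj (Z k).chart ((Z k).blowMap j y))
    rw [h4, h5]
  · rcases h3 with h3 | ⟨h3, h4⟩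
    · exact Or.inl (CenterPiece.isNonsingular_germAt_blowInv hx hFx h3)
    · exact Or.inr ⟨⟨hx, h3⟩, hconj.isFinal h4⟩

/-- After blowing up a smooth center, only the points of the new exceptional divisor have to be
examined. -/
theorem ResolvedOff.blowUp {C : M.chart → Set C3} {C' : (M.blowUp Z).chart → Set C3}
    (h : M.ResolvedOff f C)
    (hinl : ∀ i, ∀ x ∈ M.dom i, ¬ M.InCenter Z i x → x ∈ C i → x ∈ C' (Sum.inl i))
    (hinr : ∀ k j (hj : j ∈ (Z k).dirs) (x : C3), x j ≠ 0 →
      (Z k).blowMap j x ∈ C (Z k).chart → x ∈ C' (pieceChart Z k j hj))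
    (hnew : ∀ k j (hj : j ∈ (Z k).dirs), ∃ S : Set C3, S.Finite ∧ ∀ x : C3, x j = 0 →
      x ∉ C' (pieceChart Z k j hj) → (M.blowUp Z).ResolvedAt f S (pieceChart Z k j hj) x) :
    (M.blowUp Z).ResolvedOff f C' := by
  rintro (i | ⟨k, j, hj⟩)
  · obtain ⟨S, hS, hr⟩ := h i
    refine ⟨S, hS, fun x hx h0 hC => ?_⟩
    exact hr x hx.1 h0 fun hxC => hC (hinl i x hx.1 hx.2 hxC)
  · obtain ⟨S, hS, hr⟩ := h (Z k).chart
    obtain ⟨S', hS', hr'⟩ := hnew k j hj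
    refine ⟨{y | y j ≠ 0 ∧ (Z k).blowMap j y ∈ S} ∪ S', ?_, fun x hx h0 hC => ?_⟩
    · refine Set.Finite.union ?_ hS'
      refine Set.Finite.of_finite_image (f := (Z k).blowMap j) (hS.subset ?_) ?_
      · rintro _ ⟨y, hy, rfl⟩
        exact hy.2
      · intro y hy z hz hyz
        rw [← CenterPiece.blowInv_blowMap (c := Z k) hy.1, hyz, CenterPiece.blowInv_blowMap hz.1]
    · by_cases hxj : x j = 0
      · exact (hr' x hxj hC).mono Set.subset_union_right
      · refine ResolvedAt.mono ?_ Set.subset_union_left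
        exact ResolvedAt.of_blowMap hj hxj (hr _ hx h0 fun hxC => hC (hinr k j hj x hxj hxC))

theorem finite_chart_blowUp [Finite K] [Finite M.chart] : Finite (M.blowUp Z).chart :=
  inferInstanceAs (Finite (M.chart ⊕ (Σ k : K, {j : Fin 3 // j ∈ (Z k).dirs})))

end BlowUp

/-- If `f` is resolved at every point of the exceptional divisor, its lift has finitely many
singular points, each of them in one of the three final classes. As the lift is unique, it is enough
to know one lift at each point. -/
theorem ResolvedOff.conclusion [Finite M.chart] (hM : M.IsGood) (hf : ∀ᶠ w in 𝓝 0, f w = 0 → w = 0)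
    (h : M.ResolvedOff f fun _ => ∅) :
    (∀ (i : M.chart), ∀ x ∈ M.dom i, M.proj i x = 0 →
      ∃ F : C3 → C3, M.IsLiftAt f i x F ∧ IsTangentToId (germAt x F)) ∧
    {p : M.Space | ∃ (i : M.chart) (x : M.dom i) (F : C3 → C3),
      p = M.point i x ∧ M.proj i x = 0 ∧
      M.IsLiftAt f i x F ∧ IsSingularGerm (germAt x F)}.Finite ∧
    (∀ (i : M.chart), ∀ x ∈ M.dom i, M.proj i x = 0 →
      ∀ F : C3 → C3, M.IsLiftAt f i x F → IsSingularGerm (germAt x F) →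
        IsSimpleCorner (germAt x F) ∨ IsDegenerateSpike (germAt x F) ∨
          IsSpinningCorner (germAt x F)) := by
  choose S hS hr using h
  have key : ∀ i, ∀ x ∈ M.dom i, M.proj i x = 0 → ∀ F, M.IsLiftAt f i x F →
      IsSingularGerm (germAt x F) → x ∈ S i ∧ IsFinal (germAt x F) := by
    intro i x hx h0 F hF hs
    obtain ⟨G, hG, ht, hG'⟩ := hr i x hx h0 (Set.notMem_empty x)
    have e := germAt_congr (hM.isLiftAt_unique hf h0 hF hG)
    rcases hG' with hG' | ⟨h1, h2⟩
    · exact absurd hs (hG'.congr e).not_isSingularGerm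
    · exact ⟨h1, (GermConj.of_eventuallyEq e ht.1 ht.2.1).isFinal h2⟩
  refine ⟨fun i x hx h0 => ?_, ?_, fun i x hx h0 F hF hs => (key i x hx h0 F hF hs).2⟩
  · obtain ⟨F, h1, h2, _⟩ := hr i x hx h0 (Set.notMem_empty x)
    exact ⟨F, h1, h2⟩
  · have hfin : (⋃ i, M.point i '' {x : M.dom i | (x : C3) ∈ S i}).Finite :=
      Set.finite_iUnion fun i => ((hS i).preimage Subtype.val_injective.injOn).image _
    refine hfin.subset ?_
    rintro p ⟨i, x, F, rfl, h0, hF, hs⟩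
    exact Set.mem_iUnion.2 ⟨i, x, (key i x x.2 h0 F hF hs).1, rfl⟩

/-! ### Lifts in explicit form -/

/-- The lift of `f` at the point with coordinates `x` in the chart `i` is `id + m V`. -/
structure HasLift (M : Model) (f : C3 → C3) (i : M.chart) (x : C3) (m : C3 → ℂ)
    (V : Fin 3 → C3 → ℂ) : Prop where
  analytic_mult : AnalyticAt ℂ m x
  analytic_field : ∀ s, AnalyticAt ℂ (V s) x
  mult_eq_zero : m x = 0
  lift : ∀ᶠ y in 𝓝 x, M.proj i (fun s => y s + m y * V s y) = f (M.proj i y)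

theorem HasLift.congr {i : M.chart} {x : C3} {m m' : C3 → ℂ} {V V' : Fin 3 → C3 → ℂ}
    (h : M.HasLift f i x m V) (hm : AnalyticAt ℂ m' x) (hV : ∀ s, AnalyticAt ℂ (V' s) x)
    (hmx : m' x = 0) (he : ∀ᶠ y in 𝓝 x, ∀ s, m y * V s y = m' y * V' s y) :
    M.HasLift f i x m' V' := by
  refine ⟨hm, hV, hmx, ?_⟩
  filter_upwards [h.lift, he] with y h1 h2
  simp only [h2] at h1
  exact h1

theorem HasLift.isLiftAt {i : M.chart} {x : C3} {m : C3 → ℂ} {V : Fin 3 → C3 → ℂ}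
    (h : M.HasLift f i x m V) : M.IsLiftAt f i x fun y s => y s + m y * V s y := by
  refine ⟨?_, ?_, h.lift⟩
  · rw [analyticAt_pi_iff]
    intro s
    exact (analyticAt_coord s x).fun_add (h.analytic_mult.fun_mul (h.analytic_field s))
  · funext s
    simp [h.mult_eq_zero]

theorem HasLift.isTangentToId {i : M.chart} {x : C3} {m : C3 → ℂ} {V : Fin 3 → C3 → ℂ}
    (h : M.HasLift f i x m V) (hm : fderiv ℂ m x = 0) :
    IsTangentToId (germAt x fun y s => y s + m y * V s y) := by
  have hl := h.isLiftAt
  refine ⟨analyticAt_germAt hl.1, by simp [germAt, hl.2.1], ?_⟩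
  have h1 : HasFDerivAt (fun y : C3 => fun s => y s + m y * V s y)
      (ContinuousLinearMap.id ℂ C3) (x + 0) := by
    rw [add_zero, hasFDerivAt_pi']
    intro s
    have a := (ContinuousLinearMap.proj (R := ℂ) (φ := fun _ : Fin 3 => ℂ) s).hasFDerivAt (x := x)
    have b := h.analytic_mult.differentiableAt.hasFDerivAt.mul
      (h.analytic_field s).differentiableAt.hasFDerivAt
    rw [hm, h.mult_eq_zero] at b
    refine (a.add b).congr_fderiv ?_
    ext v
    simp
  have h2 := h1.comp (0 : C3) ((hasFDerivAt_id (0 : C3)).const_add x)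
  have h3 := h2.sub_const x
  exact h3.fderiv

theorem HasLift.resolvedAt_of_ne {i : M.chart} {x : C3} {m : C3 → ℂ} {V : Fin 3 → C3 → ℂ}
    (h : M.HasLift f i x m V) (hm : fderiv ℂ m x = 0) (hV : ∃ s, V s x ≠ 0) (S : Set C3) :
    M.ResolvedAt f S i x := by
  refine ⟨_, h.isLiftAt, h.isTangentToId hm, Or.inl ?_⟩
  refine ⟨fun w => m (x + w), fun s w => V s (x + w), ?_, fun s => ?_, ?_, ?_⟩
  · have := h.analytic_mult
    rw [← add_zero x] at this
    exact this.fun_comp (f := fun w : C3 => x + w) (by fun_prop)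
  · have := h.analytic_field s
    rw [← add_zero x] at this
    exact this.fun_comp (f := fun w : C3 => x + w) (by fun_prop)
  · simpa using hV
  · refine Filter.Eventually.of_forall fun w s => ?_
    simp only [germAt, Pi.sub_apply, Pi.add_apply]
    ring

theorem HasLift.resolvedAt_of_isFinal {i : M.chart} {x : C3} {m : C3 → ℂ} {V : Fin 3 → C3 → ℂ}
    (h : M.HasLift f i x m V) (hm : fderiv ℂ m x = 0) {S : Set C3} (hx : x ∈ S)
    (hG : IsTangentToId (germAt x fun y s => y s + m y * V s y) →
      IsFinal (germAt x fun y s => y s + m y * V s y)) :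
    M.ResolvedAt f S i x :=
  ⟨_, h.isLiftAt, h.isTangentToId hm, Or.inr ⟨hx, hG (h.isTangentToId hm)⟩⟩

/-- The vector field `V` of the lift `id + m V`, in the `j`-th chart of the blow-up of a center with
directions `S`, of a germ whose displacement has components `m W_s` for `s ∉ S` and `m x_j W_s`
for `s ∈ S`. -/
def blowField (S : Finset (Fin 3)) (j : Fin 3) (m : C3 → ℂ) (W : Fin 3 → C3 → ℂ) (s : Fin 3)
    (u : C3) : ℂ :=
  if s = j then u j * W j u
  else if s ∈ S then (W s u - u s * W j u) / (1 + m u * W j u) else W s u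

section BlowUp

variable {K : Type} {Z : K → CenterPiece M.chart}

/-- The lift to a chart of a blow-up of a germ `F`, itself not necessarily presented as `id + m V`,
whose displacement has been divided by a multiplier `m` and, in the directions transverse to the
center, by the exceptional coordinate. -/
theorem hasLift_blowUp_of {k : K} {j : Fin 3} (hj : j ∈ (Z k).dirs) {x : C3} {F : C3 → C3}
    (hF : ∀ᶠ y in 𝓝 ((Z k).blowMap j x), M.proj (Z k).chart (F y) = f (M.proj (Z k).chart y))
    {m : C3 → ℂ} {W : Fin 3 → C3 → ℂ} (hm : AnalyticAt ℂ m x) (hW : ∀ s, AnalyticAt ℂ (W s) x)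
    (hmx : m x = 0)
    (hFW : ∀ᶠ u in 𝓝 x, ∀ s, F ((Z k).blowMap j u) s =
      (Z k).blowMap j u s + m u * if s ∈ (Z k).dirs then u j * W s u else W s u) :
    (M.blowUp Z).HasLift f (pieceChart Z k j hj) x m (blowField (Z k).dirs j m W) := by
  have hden : AnalyticAt ℂ (fun u => 1 + m u * W j u) x :=
    analyticAt_const.fun_add (hm.fun_mul (hW j))
  have hne : 1 + m x * W j x ≠ 0 := by simp [hmx]
  refine ⟨hm, fun s => ?_, hmx, ?_⟩
  · unfold blowField
    split_ifs
    · exact (analyticAt_coord j x).fun_mul (hW j)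
    · exact ((hW s).fun_sub ((analyticAt_coord s x).fun_mul (hW j))).fun_div hden hne
    · exact hW s
  · have ht := (((Z k).continuous_blowMap j).tendsto x).eventually hF
    filter_upwards [ht, hFW, hden.continuousAt.eventually_ne hne] with u h1 h2 h3
    change M.proj (Z k).chart ((Z k).blowMap j _) = f (M.proj (Z k).chart ((Z k).blowMap j u))
    rw [← h1]
    congr 1
    funext s
    rw [h2]
    by_cases hsj : s = j
    · subst hsj
      rw [CenterPiece.blowMap_self, CenterPiece.blowMap_self, if_pos hj]
      simp only [blowField, if_true]
      ring
    · by_cases hs : s ∈ (Z k).dirs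
      · rw [CenterPiece.blowMap_of_mem _ _ hs hsj, CenterPiece.blowMap_of_mem _ _ hs hsj, if_pos hs]
        simp only [blowField, if_true, if_neg hsj, if_pos hs]
        field_simp
        ring
      · rw [CenterPiece.blowMap_of_notMem _ _ hs, CenterPiece.blowMap_of_notMem _ _ hs, if_neg hs]
        simp only [blowField, if_neg hsj, if_neg hs]
        ring

/-- The lift of a germ `id + m V` to a chart of a blow-up. The new multiplier `m'` takes in the
power of the exceptional coordinate by which `V` is divisible after the blow-up. -/
theorem HasLift.blowUp {k : K} {j : Fin 3} (hj : j ∈ (Z k).dirs) {x : C3}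
    {m m' : C3 → ℂ} {V W : Fin 3 → C3 → ℂ}
    (h : M.HasLift f (Z k).chart ((Z k).blowMap j x) m V) (hm' : AnalyticAt ℂ m' x)
    (hW : ∀ s, AnalyticAt ℂ (W s) x) (hmx : m' x = 0)
    (hVW : ∀ᶠ u in 𝓝 x, ∀ s, m ((Z k).blowMap j u) * V s ((Z k).blowMap j u) =
      m' u * if s ∈ (Z k).dirs then u j * W s u else W s u) :
    (M.blowUp Z).HasLift f (pieceChart Z k j hj) x m' (blowField (Z k).dirs j m' W) := by
  refine hasLift_blowUp_of hj (F := fun y s => y s + m y * V s y) h.lift hm' hW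
    hmx ?_
  filter_upwards [hVW] with u hu s
  rw [← hu s]

end BlowUp

end Model

/-- A multiplier divisible by the square of an exceptional coordinate makes the lift tangent to the
identity. -/
theorem fderiv_sq_mul {p q : C3 → ℂ} {x : C3} (hp : AnalyticAt ℂ p x) (hq : AnalyticAt ℂ q x)
    (h0 : p x = 0) : fderiv ℂ (fun u => p u ^ 2 * q u) x = 0 := by
  have h := (hp.differentiableAt.hasFDerivAt.pow 2).mul hq.differentiableAt.hasFDerivAt
  have h2 := h.fderiv
  rw [show (fun u => p u ^ 2 * q u) = (fun u => p u ^ 2) * q from rfl, h2]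
  ext v
  simp [h0]

/-- The monomial `x ^ a * y ^ b * z ^ c`. -/
def mono (a b c : ℕ) (u : C3) : ℂ := u 0 ^ a * u 1 ^ b * u 2 ^ c

@[fun_prop]
theorem analyticAt_mono (a b c : ℕ) (x : C3) : AnalyticAt ℂ (mono a b c) x := by
  unfold mono; fun_prop

/-! ### Recognition of the final classes -/

theorem inSomeCoordinates_of_linear {G N : C3 → C3} (L : C3 ≃L[ℂ] C3)
    (h : ∀ᶠ w in 𝓝 (0 : C3), L (G w) = N (L w)) : InSomeCoordinates G N :=
  ⟨L, (L : C3 →L[ℂ] C3).analyticAt 0, map_zero L, by rw [L.fderiv]; exact ⟨L, rfl⟩, h⟩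

section Coordinates

variable (L : C3 ≃L[ℂ] C3) {x : C3} {g : C3 → ℂ}

theorem analyticAt_comp_add_symm (hg : AnalyticAt ℂ g x) :
    AnalyticAt ℂ (fun v => g (x + L.symm v)) 0 := by
  have h : AnalyticAt ℂ g (x + L.symm 0) := by rwa [map_zero, add_zero]
  exact h.fun_comp (f := fun v => x + L.symm v)
    (analyticAt_const.fun_add ((L.symm : C3 →L[ℂ] C3).analyticAt 0))

theorem inMax_comp_add_symm (hg : AnalyticAt ℂ g x) (h0 : g x = 0) :
    InMax fun v => g (x + L.symm v) :=
  ⟨analyticAt_comp_add_symm L hg, by simpa using h0⟩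

theorem inMaxSq_comp_add_symm (hg : AnalyticAt ℂ g x) (h0 : g x = 0) (h1 : fderiv ℂ g x = 0) :
    InMaxSq fun v => g (x + L.symm v) := by
  refine ⟨analyticAt_comp_add_symm L hg, by simpa using h0, ?_⟩
  have h : HasFDerivAt g (0 : C3 →L[ℂ] ℂ) (x + L.symm 0) := by
    rw [map_zero, add_zero, ← h1]; exact hg.differentiableAt.hasFDerivAt
  have h2 := h.comp (0 : C3) ((L.symm : C3 →L[ℂ] C3).hasFDerivAt.const_add x)
  rw [ContinuousLinearMap.zero_comp] at h2
  exact h2.fderiv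

end Coordinates

theorem fderiv_mul_eq_zero {p q : C3 → ℂ} {x : C3} (hp : AnalyticAt ℂ p x) (hq : AnalyticAt ℂ q x)
    (hp0 : p x = 0) (hq0 : q x = 0) : HasFDerivAt (fun u => p u * q u) (0 : C3 →L[ℂ] ℂ) x := by
  have h := hp.differentiableAt.hasFDerivAt.mul hq.differentiableAt.hasFDerivAt
  refine h.congr_fderiv ?_
  ext v
  simp [hp0, hq0]

/-- A partial derivative, read off from the restriction to a line. -/
theorem fderiv_single_eq {g : C3 → ℂ} {x : C3} {i : Fin 3} (hg : AnalyticAt ℂ g x) {k : ℂ → ℂ}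
    {d : ℂ} (hk : ∀ t, g (x + t • (Pi.single i 1 : C3)) = t * k t) (hd : DifferentiableAt ℂ k 0)
    (hkd : k 0 = d) : fderiv ℂ g x (Pi.single i 1) = d := by
  have h1 : HasFDerivAt g (fderiv ℂ g x) (x + (0 : ℂ) • (Pi.single i 1 : C3)) := by
    rw [zero_smul, add_zero]; exact hg.differentiableAt.hasFDerivAt
  have h2 : HasDerivAt (fun t : ℂ => x + t • (Pi.single i 1 : C3)) (Pi.single i 1 : C3) 0 := by
    simpa using ((hasDerivAt_id (0 : ℂ)).smul_const (Pi.single i 1 : C3)).const_add x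
  have h3 := h1.comp_hasDerivAt (0 : ℂ) h2
  have h4 : (g ∘ fun t : ℂ => x + t • (Pi.single i 1 : C3)) = fun t => t * k t := funext hk
  rw [h4] at h3
  have h5 := (hasDerivAt_id (0 : ℂ)).fun_mul hd.hasDerivAt
  rw [h3.unique h5]
  simp [hkd]

/-- The permutation of coordinates `w ↦ w ∘ e`. -/
def permEquiv (e : Equiv.Perm (Fin 3)) : C3 ≃L[ℂ] C3 :=
  (LinearEquiv.funCongrLeft ℂ ℂ e).toContinuousLinearEquiv

theorem permEquiv_apply (e : Equiv.Perm (Fin 3)) (w : C3) (s : Fin 3) :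
    permEquiv e w s = w (e s) := rfl

theorem permEquiv_symm_apply (e : Equiv.Perm (Fin 3)) (w : C3) (s : Fin 3) :
    (permEquiv e).symm w (e s) = w s := by
  have := congrFun ((permEquiv e).apply_symm_apply w) s
  exact this

theorem apply_fin_three_ext {v w : C3} (h0 : v 0 = w 0) (h1 : v 1 = w 1) (h2 : v 2 = w 2) :
    v = w := by
  funext s; fin_cases s <;> assumption

/-- A germ `id + m V` whose multiplier `m` is, up to a unit, a monomial, and such that the vector
field `V` is tangent to the coordinate planes where `m` vanishes and has there two suitable
eigenvalues, is a simple corner. The permutation `e` selects the planes: `α` and `β` are the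
eigenvalues for the coordinates `e 0` and `e 1`. -/
theorem isSimpleCorner_of_eigenvalues {x : C3} {m : C3 → ℂ} {V : Fin 3 → C3 → ℂ}
    (e : Equiv.Perm (Fin 3)) {a b c : ℕ} (ha : 1 ≤ a) (hb : 1 ≤ b)
    {U α β γ : C3 → ℂ} (hU : AnalyticAt ℂ U x) (hα : AnalyticAt ℂ α x) (hβ : AnalyticAt ℂ β x)
    (hV : AnalyticAt ℂ (V (e 2)) x)
    (hx0 : x (e 0) = 0) (hx1 : x (e 1) = 0)
    (hm : ∀ᶠ y in 𝓝 x, m y = y (e 0) ^ a * y (e 1) ^ b * y (e 2) ^ c * U y)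
    (hVα : ∀ᶠ y in 𝓝 x, V (e 0) y = y (e 0) * α y) (hVβ : ∀ᶠ y in 𝓝 x, V (e 1) y = y (e 1) * β y)
    (hV0 : V (e 2) x = 0)
    (hVγ : 0 < c → x (e 2) = 0 ∧ AnalyticAt ℂ γ x ∧ ∀ᶠ y in 𝓝 x, V (e 2) y = y (e 2) * γ y)
    (hUx : U x ≠ 0) (hαx : α x ≠ 0) (hq : ∀ q : ℚ, 0 < q → β x ≠ α x * (q : ℂ))
    (ht : IsTangentToId (germAt x fun y s => y s + m y * V s y)) :
    IsSimpleCorner (germAt x fun y s => y s + m y * V s y) := by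
  set L := permEquiv e with hL
  have hLs : ∀ v s, (x + L.symm v) (e s) = x (e s) + v s := fun v s => by
    rw [Pi.add_apply, permEquiv_symm_apply]
  have tx : Filter.Tendsto (fun w : C3 => x + w) (𝓝 0) (𝓝 x) := by
    have : Continuous fun w : C3 => x + w := by fun_prop
    simpa using this.tendsto 0
  have tv : Filter.Tendsto (fun v : C3 => x + L.symm v) (𝓝 0) (𝓝 x) := by
    have : Continuous fun v : C3 => x + L.symm v := by fun_prop
    simpa using this.tendsto 0
  refine ⟨ht, a, b, c, U x * α x, U x * β x,
    fun v => (fun y => U y * α y - U x * α x) (x + L.symm v),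
    fun v => (fun y => U y * β y - U x * β x) (x + L.symm v),
    fun v => (fun y => U y * V (e 2) y) (x + L.symm v), ha, hb, mul_ne_zero hUx hαx,
    ?_, ?_, ?_, ?_, ?_, ?_⟩
  · intro q hq0 h
    refine hq q hq0 (mul_left_cancel₀ hUx ?_)
    rw [h]; ring
  · exact inMax_comp_add_symm L ((hU.fun_mul hα).fun_sub analyticAt_const) (sub_self _)
  · exact inMax_comp_add_symm L ((hU.fun_mul hβ).fun_sub analyticAt_const) (sub_self _)
  · exact inMax_comp_add_symm L (hU.fun_mul hV) (by simp [hV0])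
  · intro hc
    obtain ⟨hx2, hγ, hVγ⟩ := hVγ hc
    refine ⟨fun v => (fun y => U y * γ y) (x + L.symm v),
      analyticAt_comp_add_symm L (hU.fun_mul hγ), ?_⟩
    filter_upwards [tv.eventually hVγ] with v hv
    simp only [hv, hLs, hx2]
    ring
  · refine inSomeCoordinates_of_linear L ?_
    have hcx : ∀ w : C3, (x (e 2) + w (e 2)) ^ c = w (e 2) ^ c := by
      intro w
      rcases Nat.eq_zero_or_pos c with rfl | hc
      · simp
      · rw [(hVγ hc).1, zero_add]
    filter_upwards [tx.eventually hm, tx.eventually hVα, tx.eventually hVβ] with w h1 h2 h3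
    have hg : ∀ s, L (germAt x (fun y s => y s + m y * V s y) w) s =
        w (e s) + m (x + w) * V (e s) (x + w) := by
      intro s
      rw [hL, permEquiv_apply]
      simp only [germAt, Pi.sub_apply, Pi.add_apply]
      ring
    have hLw : ∀ s, L w s = w (e s) := fun s => rfl
    have hsw : x + L.symm (L w) = x + w := by rw [L.symm_apply_apply]
    refine apply_fin_three_ext ?_ ?_ ?_
    · rw [hg, h1, h2]
      simp only [Matrix.cons_val_zero, hLw, hsw, Pi.add_apply, hx0, hx1, zero_add, hcx]
      ring
    · rw [hg, h1, h3]
      simp only [Matrix.cons_val_one, Matrix.cons_val_zero, hLw, hsw, Pi.add_apply, hx0, hx1,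
        zero_add, hcx]
      ring
    · rw [hg, h1]
      simp only [Matrix.cons_val, hLw, hsw, Pi.add_apply, hx0, hx1, zero_add, hcx]
      ring

/-- The linear change of coordinates `(x, y, z) ↦ (x + p y + q z, s y, z)`. -/
def shearEquiv (p q s : ℂ) (hs : s ≠ 0) : C3 ≃L[ℂ] C3 :=
  LinearEquiv.toContinuousLinearEquiv
    { toFun := fun w => ![w 0 + p * w 1 + q * w 2, s * w 1, w 2]
      invFun := fun w => ![w 0 - p * (w 1 / s) - q * w 2, w 1 / s, w 2]
      map_add' := fun v w => by
        refine apply_fin_three_ext ?_ ?_ ?_ <;> simp <;> ring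
      map_smul' := fun r w => by
        refine apply_fin_three_ext ?_ ?_ ?_ <;> simp <;> ring
      left_inv := fun w => by
        refine apply_fin_three_ext ?_ ?_ ?_ <;> simp [hs]
        ring
      right_inv := fun w => by
        refine apply_fin_three_ext ?_ ?_ ?_ <;> simp <;> field_simp
        ring }

/-- The linear change of coordinates `(x, y, z) ↦ (p x + q y + r z, p x - q y + s z, z)`. -/
def splitEquiv (p q r s : ℂ) (hp : p ≠ 0) (hq : q ≠ 0) : C3 ≃L[ℂ] C3 :=
  LinearEquiv.toContinuousLinearEquiv
    { toFun := fun w => ![p * w 0 + q * w 1 + r * w 2, p * w 0 - q * w 1 + s * w 2, w 2]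
      invFun := fun w => ![(w 0 + w 1 - (r + s) * w 2) / (2 * p),
        (w 0 - w 1 - (r - s) * w 2) / (2 * q), w 2]
      map_add' := fun v w => by
        refine apply_fin_three_ext ?_ ?_ ?_ <;> simp <;> ring
      map_smul' := fun r w => by
        refine apply_fin_three_ext ?_ ?_ ?_ <;> simp <;> ring
      left_inv := fun w => by
        refine apply_fin_three_ext ?_ ?_ ?_ <;> simp <;> field_simp <;> ring
      right_inv := fun w => by
        refine apply_fin_three_ext ?_ ?_ ?_ <;> simp <;> field_simp <;> ring }

theorem apply_eq_sum_perm (D : C3 →L[ℂ] ℂ) (e : Equiv.Perm (Fin 3)) (v : C3) :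
    D v = v (e 0) * D (Pi.single (e 0) 1) + v (e 1) * D (Pi.single (e 1) 1) +
      v (e 2) * D (Pi.single (e 2) 1) := by
  have h1 : D v = ∑ i, v i * D (Pi.single i 1) := by
    conv_lhs => rw [← Finset.univ_sum_single v]
    rw [map_sum]
    refine Finset.sum_congr rfl fun i _ => ?_
    rw [show Pi.single i (v i) = v i • (Pi.single i 1 : C3) by
      rw [← Pi.single_smul, smul_eq_mul, mul_one], map_smul, smul_eq_mul]
  rw [h1, ← Equiv.sum_comp e, Fin.sum_univ_three]

/-- A germ `id + y ^ b z ^ c V` such that `V` is tangent to `{y = 0}` and to `{z = 0}`, with zero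
eigenvalues for `y` and `z` and a nonzero one for `x`, is a spinning corner. Here `x`, `y`, `z` are
the coordinates `e 0`, `e 1`, `e 2`. The coefficient of `x` is normalized to `1` by a change of
scale on `y`. -/
theorem isSpinningCorner_of_eigenvalue {x : C3} {m : C3 → ℂ} {V : Fin 3 → C3 → ℂ}
    (e : Equiv.Perm (Fin 3)) {b c : ℕ} (hb : 1 ≤ b) (hc : 1 ≤ c)
    {β γ : C3 → ℂ} (hV : AnalyticAt ℂ (V (e 0)) x) (hβ : AnalyticAt ℂ β x)
    (hγ : AnalyticAt ℂ γ x) (hx1 : x (e 1) = 0) (hx2 : x (e 2) = 0)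
    (hm : ∀ᶠ y in 𝓝 x, m y = y (e 1) ^ b * y (e 2) ^ c)
    (hVβ : ∀ᶠ y in 𝓝 x, V (e 1) y = y (e 1) * β y)
    (hVγ : ∀ᶠ y in 𝓝 x, V (e 2) y = y (e 2) * γ y)
    (hV0 : V (e 0) x = 0) (hβ0 : β x = 0) (hγ0 : γ x = 0)
    (hl : fderiv ℂ (V (e 0)) x (Pi.single (e 0) 1) ≠ 0)
    (ht : IsTangentToId (germAt x fun y s => y s + m y * V s y)) :
    IsSpinningCorner (germAt x fun y s => y s + m y * V s y) := by
  set D := fderiv ℂ (V (e 0)) x with hD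
  set l := D (Pi.single (e 0) 1) with hl'
  -- The scale `s` on `y` satisfies `s ^ b = l`, and the shear `x + p y + q z` is the linear form
  -- which is an eigenvector for `l`.
  obtain ⟨s, hs⟩ := IsAlgClosed.exists_pow_nat_eq l (Nat.pos_of_ne_zero (by omega : b ≠ 0))
  have hs0 : s ≠ 0 := by
    rintro rfl
    rw [zero_pow (by omega)] at hs
    exact hl hs.symm
  set p := D (Pi.single (e 1) 1) / l with hp
  set q := D (Pi.single (e 2) 1) / l with hq
  set L := (permEquiv e).trans (shearEquiv p q s hs0) with hL
  have hLw : ∀ w, L w = ![w (e 0) + p * w (e 1) + q * w (e 2), s * w (e 1), w (e 2)] :=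
    fun w => rfl
  have tx : Filter.Tendsto (fun w : C3 => x + w) (𝓝 0) (𝓝 x) := by
    have : Continuous fun w : C3 => x + w := by fun_prop
    simpa using this.tendsto 0
  set A : C3 → ℂ := fun y => (V (e 0) y + p * (y (e 1) * β y) + q * (y (e 2) * γ y)) / l -
    ((y (e 0) - x (e 0)) + p * (y (e 1) - x (e 1)) + q * (y (e 2) - x (e 2))) with hA
  have hAa : AnalyticAt ℂ A x := by
    simp only [hA]
    fun_prop (disch := assumption)
  have hA0 : A x = 0 := by
    simp [hA, hV0, hβ0, hγ0]
  have hA1 : fderiv ℂ A x = 0 := by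
    have c0 := (ContinuousLinearMap.proj (R := ℂ) (φ := fun _ : Fin 3 => ℂ) (e 0)).hasFDerivAt
      (x := x)
    have c1 := (ContinuousLinearMap.proj (R := ℂ) (φ := fun _ : Fin 3 => ℂ) (e 1)).hasFDerivAt
      (x := x)
    have c2 := (ContinuousLinearMap.proj (R := ℂ) (φ := fun _ : Fin 3 => ℂ) (e 2)).hasFDerivAt
      (x := x)
    have d1 := fderiv_mul_eq_zero (analyticAt_coord (e 1) x) hβ hx1 hβ0
    have d2 := fderiv_mul_eq_zero (analyticAt_coord (e 2) x) hγ hx2 hγ0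
    have d0 : HasFDerivAt (V (e 0)) D x := hV.differentiableAt.hasFDerivAt
    have h := ((((d0.fun_add (d1.const_mul p)).fun_add (d2.const_mul q)).mul_const l⁻¹).fun_sub
      (((c0.sub_const (x (e 0))).fun_add ((c1.sub_const (x (e 1))).const_mul p)).fun_add
        ((c2.sub_const (x (e 2))).const_mul q)))
    simp only [← div_eq_mul_inv] at h
    refine HasFDerivAt.fderiv (h.congr_fderiv ?_)
    ext1 v
    simp only [sub_apply, smul_apply, add_apply, ContinuousLinearMap.proj_apply, smul_eq_mul,
      zero_apply]
    rw [apply_eq_sum_perm D e v, ← hl', hp, hq]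
    field_simp
    ring
  refine ⟨ht, b, c, fun v => A (x + L.symm v), fun v => (fun y => β y / l) (x + L.symm v),
    fun v => (fun y => γ y / l) (x + L.symm v), hb, hc, inMaxSq_comp_add_symm L hAa hA0 hA1,
    inMax_comp_add_symm L (hβ.fun_div analyticAt_const hl) (by simp [hβ0]),
    inMax_comp_add_symm L (hγ.fun_div analyticAt_const hl) (by simp [hγ0]),
    inSomeCoordinates_of_linear L ?_⟩
  filter_upwards [tx.eventually hm, tx.eventually hVβ, tx.eventually hVγ] with w h1 h2 h3
  have hg : ∀ s, germAt x (fun y s => y s + m y * V s y) w s = w s + m (x + w) * V s (x + w) := by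
    intro s
    simp only [germAt, Pi.sub_apply, Pi.add_apply]
    ring
  have hsw : x + L.symm (L w) = x + w := by rw [L.symm_apply_apply]
  simp only [hsw]
  simp only [hLw, hg, h1, h2, h3, Pi.add_apply, hx1, hx2, zero_add]
  have hsl : s ^ (b + 1) = s * l := by rw [pow_succ, hs]; ring
  refine apply_fin_three_ext ?_ ?_ ?_
  · simp only [Matrix.cons_val_zero, Matrix.cons_val_one, Matrix.cons_val, mul_pow, hs, hA,
      Pi.add_apply, hx1, hx2, zero_add]
    field_simp
    ring
  · simp only [Matrix.cons_val_zero, Matrix.cons_val_one, Matrix.cons_val, mul_pow, hsl]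
    field_simp
    ring
  · simp only [Matrix.cons_val_zero, Matrix.cons_val_one, Matrix.cons_val, mul_pow, hs]
    field_simp
    ring

/-- A germ `id + z ^ c V` such that `V` is tangent to `{z = 0}`, with zero eigenvalue for `z`, and
such that the linear part of `V` on `{z = 0}` exchanges the axes, hence has opposite eigenvalues, is
a degenerate spike. Here `x`, `y`, `z` are the coordinates `e 0`, `e 1`, `e 2`. -/
theorem isDegenerateSpike_of_exchange {x : C3} {m : C3 → ℂ} {V : Fin 3 → C3 → ℂ}
    (e : Equiv.Perm (Fin 3)) {c : ℕ} (hc : 1 ≤ c)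
    {γ : C3 → ℂ} (hV : AnalyticAt ℂ (V (e 0)) x) (hV' : AnalyticAt ℂ (V (e 1)) x)
    (hγ : AnalyticAt ℂ γ x) (hx2 : x (e 2) = 0)
    (hm : ∀ᶠ y in 𝓝 x, m y = y (e 2) ^ c)
    (hVγ : ∀ᶠ y in 𝓝 x, V (e 2) y = y (e 2) * γ y)
    (hV0 : V (e 0) x = 0) (hV0' : V (e 1) x = 0) (hγ0 : γ x = 0)
    (h00 : fderiv ℂ (V (e 0)) x (Pi.single (e 0) 1) = 0)
    (h01 : fderiv ℂ (V (e 0)) x (Pi.single (e 1) 1) ≠ 0)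
    (h10 : fderiv ℂ (V (e 1)) x (Pi.single (e 0) 1) ≠ 0)
    (h11 : fderiv ℂ (V (e 1)) x (Pi.single (e 1) 1) = 0)
    (ht : IsTangentToId (germAt x fun y s => y s + m y * V s y)) :
    IsDegenerateSpike (germAt x fun y s => y s + m y * V s y) := by
  set D := fderiv ℂ (V (e 0)) x with hD
  set D' := fderiv ℂ (V (e 1)) x with hD'
  set d := D (Pi.single (e 1) 1) with hd
  set d' := D' (Pi.single (e 0) 1) with hd'
  -- The linear part of `V` on `{z = 0}` is `(d y, d' x)`, with eigenvalues `l` and `-l`; the linear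
  -- forms `d' x + l y + r z` and `d' x - l y + s z` are eigenvectors.
  obtain ⟨l, hl⟩ := IsAlgClosed.exists_pow_nat_eq (d * d') (by norm_num : 0 < 2)
  have hl0 : l ≠ 0 := by
    rintro rfl
    rw [zero_pow (by norm_num)] at hl
    exact mul_ne_zero h01 h10 hl.symm
  set r := D' (Pi.single (e 2) 1) + l * D (Pi.single (e 2) 1) / d with hr
  set s := D' (Pi.single (e 2) 1) - l * D (Pi.single (e 2) 1) / d with hs
  set L := (permEquiv e).trans (splitEquiv d' l r s h10 hl0) with hL
  have hLw : ∀ w, L w = ![d' * w (e 0) + l * w (e 1) + r * w (e 2),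
    d' * w (e 0) - l * w (e 1) + s * w (e 2), w (e 2)] := fun w => rfl
  have tx : Filter.Tendsto (fun w : C3 => x + w) (𝓝 0) (𝓝 x) := by
    have : Continuous fun w : C3 => x + w := by fun_prop
    simpa using this.tendsto 0
  have key : ∀ k t : ℂ, k ^ 2 = d * d' →
      t = D' (Pi.single (e 2) 1) + k * D (Pi.single (e 2) 1) / d →
      AnalyticAt ℂ (fun y => d' * V (e 0) y + k * V (e 1) y + t * (y (e 2) * γ y) -
        k * (d' * (y (e 0) - x (e 0)) + k * (y (e 1) - x (e 1)) + t * (y (e 2) - x (e 2)))) x ∧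
      fderiv ℂ (fun y => d' * V (e 0) y + k * V (e 1) y + t * (y (e 2) * γ y) -
        k * (d' * (y (e 0) - x (e 0)) + k * (y (e 1) - x (e 1)) + t * (y (e 2) - x (e 2)))) x =
          0 := by
    intro k t hk htt
    refine ⟨by fun_prop, ?_⟩
    have c0 := (ContinuousLinearMap.proj (R := ℂ) (φ := fun _ : Fin 3 => ℂ) (e 0)).hasFDerivAt
      (x := x)
    have c1 := (ContinuousLinearMap.proj (R := ℂ) (φ := fun _ : Fin 3 => ℂ) (e 1)).hasFDerivAt
      (x := x)
    have c2 := (ContinuousLinearMap.proj (R := ℂ) (φ := fun _ : Fin 3 => ℂ) (e 2)).hasFDerivAt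
      (x := x)
    have d2 := fderiv_mul_eq_zero (analyticAt_coord (e 2) x) hγ hx2 hγ0
    have d0 : HasFDerivAt (V (e 0)) D x := hV.differentiableAt.hasFDerivAt
    have d1 : HasFDerivAt (V (e 1)) D' x := hV'.differentiableAt.hasFDerivAt
    have h := (((d0.const_mul d').fun_add (d1.const_mul k)).fun_add (d2.const_mul t)).fun_sub
      (((((c0.sub_const (x (e 0))).const_mul d').fun_add
        ((c1.sub_const (x (e 1))).const_mul k)).fun_add
        ((c2.sub_const (x (e 2))).const_mul t)).const_mul k)
    refine HasFDerivAt.fderiv (h.congr_fderiv ?_)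
    ext1 v
    simp only [sub_apply, smul_apply, add_apply, ContinuousLinearMap.proj_apply, smul_eq_mul,
      zero_apply]
    rw [apply_eq_sum_perm D e v, apply_eq_sum_perm D' e v, ← hd, ← hd', h00, h11, htt]
    field_simp
    linear_combination (-(v (e 1)) * d - v (e 2) * D (Pi.single (e 2) 1)) * hk
  obtain ⟨a1, a2⟩ := key l r hl hr
  obtain ⟨b1, b2⟩ := key (-l) s (by rw [neg_sq, hl]) (by rw [hs]; ring)
  refine ⟨ht, c, l, -l, _, _, fun v => γ (x + L.symm v), hc, hl0, ⟨-1, by norm_num, by simp⟩,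
    inMaxSq_comp_add_symm L a1 (by simp [hV0, hV0', hγ0]) a2,
    inMaxSq_comp_add_symm L b1 (by simp [hV0, hV0', hγ0]) b2,
    inMax_comp_add_symm L hγ hγ0, inSomeCoordinates_of_linear L ?_⟩
  filter_upwards [tx.eventually hm, tx.eventually hVγ] with w h1 h2
  have hg : ∀ s, germAt x (fun y s => y s + m y * V s y) w s = w s + m (x + w) * V s (x + w) := by
    intro s
    simp only [germAt, Pi.sub_apply, Pi.add_apply]
    ring
  have hsw : x + L.symm (L w) = x + w := by rw [L.symm_apply_apply]
  simp only [hsw]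
  simp only [hLw, hg, h1, h2, Pi.add_apply, hx2, zero_add]
  refine apply_fin_three_ext ?_ ?_ ?_
  · simp only [Matrix.cons_val_zero, Matrix.cons_val_one, Matrix.cons_val]
    ring
  · simp only [Matrix.cons_val_zero, Matrix.cons_val_one, Matrix.cons_val]
    ring
  · simp only [Matrix.cons_val]
    ring

/-! ### The first blow-up -/


theorem forall_fin_three {p : Fin 3 → Prop} (h0 : p 0) (h1 : p 1) (h2 : p 2) : ∀ s, p s := by
  intro s; fin_cases s <;> assumption

/-- The cubic part of the displacement of `exampleGerm`. -/
def cubicPart (s : Fin 3) (v : C3) : ℂ :=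
  ![v 1 * v 2 * (v 1 - v 2), v 0 * (v 0 ^ 2 - v 2 ^ 2), v 0 * v 2 * (v 1 - v 2)] s

@[fun_prop]
theorem analyticAt_cubicPart (s : Fin 3) (x : C3) : AnalyticAt ℂ (cubicPart s) x := by
  revert s
  refine forall_fin_three ?_ ?_ ?_
  · change AnalyticAt ℂ (fun v : C3 => v 1 * v 2 * (v 1 - v 2)) x; fun_prop
  · change AnalyticAt ℂ (fun v : C3 => v 0 * (v 0 ^ 2 - v 2 ^ 2)) x; fun_prop
  · change AnalyticAt ℂ (fun v : C3 => v 0 * v 2 * (v 1 - v 2)) x; fun_prop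

theorem cubicPart_zero (v : C3) : cubicPart 0 v = v 1 * v 2 * (v 1 - v 2) := rfl

theorem cubicPart_one (v : C3) : cubicPart 1 v = v 0 * (v 0 ^ 2 - v 2 ^ 2) := rfl

theorem cubicPart_two (v : C3) : cubicPart 2 v = v 0 * v 2 * (v 1 - v 2) := rfl

theorem cubicPart_smul (s : Fin 3) (c : ℂ) (v : C3) :
    cubicPart s (c • v) = c ^ 3 * cubicPart s v := by
  revert s
  refine forall_fin_three ?_ ?_ ?_
  · simp only [cubicPart_zero, Pi.smul_apply, smul_eq_mul]; ring
  · simp only [cubicPart_one, Pi.smul_apply, smul_eq_mul]; ring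
  · simp only [cubicPart_two, Pi.smul_apply, smul_eq_mul]; ring

/-- The characteristic directions of `exampleGerm`: besides `[0 : 0 : 1]` and `[0 : 1 : 1]`, they
are the directions of `p₃`, `p₄` and `p₅`. -/
theorem characteristic_directions {v : C3} {l : ℂ} (h : ∀ s, cubicPart s v = v s * l) :
    (v 0 = 0 ∧ v 1 = 0) ∨ (v 0 = 0 ∧ v 1 = v 2) ∨ (v 0 = v 2 ∧ v 1 = v 2) ∨
      (v 0 = -v 2 ∧ v 1 = v 2) ∨ (v 0 = 0 ∧ v 2 = 0) := by
  have h0 := h 0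
  have h1 := h 1
  have h2 := h 2
  rw [cubicPart_zero] at h0
  rw [cubicPart_one] at h1
  rw [cubicPart_two] at h2
  by_cases hz : v 2 = 0
  · rw [hz] at h0 h1
    have h3 : v 0 ^ 4 = 0 := by
      have e : v 0 * l = 0 := by rw [← h0]; ring
      linear_combination v 0 * h1 + v 1 * e
    exact Or.inr (Or.inr (Or.inr (Or.inr ⟨pow_eq_zero_iff (by norm_num) |>.1 h3, hz⟩)))
  have hl : l = v 0 * (v 1 - v 2) := mul_left_cancel₀ hz (by linear_combination -h2)
  by_cases hy : v 1 = v 2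
  · rw [hl, hy, sub_self, mul_zero, mul_zero] at h1
    have h3 : v 0 * ((v 0 - v 2) * (v 0 + v 2)) = 0 := by linear_combination h1
    rcases mul_eq_zero.1 h3 with h3 | h3
    · exact Or.inr (Or.inl ⟨h3, hy⟩)
    rcases mul_eq_zero.1 h3 with h3 | h3
    · exact Or.inr (Or.inr (Or.inl ⟨sub_eq_zero.1 h3, hy⟩))
    · exact Or.inr (Or.inr (Or.inr (Or.inl ⟨eq_neg_of_add_eq_zero_left h3, hy⟩)))
  have h3 : v 1 * v 2 = v 0 ^ 2 := by
    refine mul_right_cancel₀ (sub_ne_zero.2 hy) ?_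
    rw [hl] at h0
    linear_combination h0
  have hx : v 0 = 0 := by
    rw [hl] at h1
    have h4 : v 0 * (v 1 - v 2) ^ 2 = 0 := by linear_combination -h1 - v 0 * h3
    exact (mul_eq_zero.1 h4).resolve_right (pow_ne_zero 2 (sub_ne_zero.2 hy))
  rw [hx] at h3
  exact Or.inl ⟨hx, (mul_eq_zero.1 (h3.trans (zero_pow two_ne_zero))).resolve_right hz⟩

section FirstBlowUp

variable {P Q R : C3 → ℂ}

/-- The lift in the `j`-th chart of the first blow-up. Its multiplier is the square of the
exceptional coordinate, and on the exceptional divisor its field only depends on the cubic part; the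
quartic parts appear in the coefficient of the exceptional coordinate. -/
theorem hasLift_model1 (hP : HasOrderAtLeast 4 P) (hQ : HasOrderAtLeast 4 Q)
    (hR : HasOrderAtLeast 4 R) (j : Fin 3) :
    ∃ g : Fin 3 → C3 → ℂ, ∀ x : C3, x j = 0 →
      (∀ s, AnalyticAt ℂ (g s) x ∧ g s x = homPart 4 (![P, Q, R] s) (direction j x)) ∧
      model1.HasLift (exampleGerm P Q R) (affine.newChart () 0 j) x (fun u => u j ^ 2)
        (blowField Finset.univ j (fun u => u j ^ 2)
          fun s u => cubicPart s (direction j u) + u j * g s u) := by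
  have hall : ∀ s, HasOrderAtLeast 4 (![P, Q, R] s) := forall_fin_three hP hQ hR
  choose g hg using fun s => exists_pullback (hall s) j
  refine ⟨g, fun x hx => ⟨fun s => ⟨(hg s x hx).1, (hg s x hx).2.1⟩, ?_⟩⟩
  refine hasLift_blowUp_of (M := affine) (Z := fun _ : Unit => ⟨(), 0, Finset.univ⟩) (k := ())
    (Finset.mem_univ j) (F := exampleGerm P Q R) (Filter.Eventually.of_forall fun y => rfl)
    (by fun_prop) (fun s => ?_) (by simp [hx]) ?_
  · have := (hg s x hx).1
    have h2 := (analyticAt_cubicPart s (direction j x)).fun_comp (analyticAt_direction j x)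
    fun_prop
  · filter_upwards [(hg 0 x hx).2.2, (hg 1 x hx).2.2, (hg 2 x hx).2.2] with u h0 h1 h2
    have hf : ∀ w s, exampleGerm P Q R w s = w s + cubicPart s w + ![P, Q, R] s w := by
      intro w
      refine forall_fin_three ?_ ?_ ?_
      · rfl
      · rfl
      · rfl
    have hb : (⟨(), 0, Finset.univ⟩ : CenterPiece affine.chart).blowMap j u =
        blowChart Finset.univ j u := by
      simp [CenterPiece.blowMap]
    have hgu : ∀ s, ![P, Q, R] s (blowChart Finset.univ j u) = u j ^ 4 * g s u :=
      forall_fin_three h0 h1 h2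
    intro s
    rw [hf, hb, hgu, if_pos (Finset.mem_univ s), blowChart_univ, cubicPart_smul]
    ring

end FirstBlowUp

theorem direction_self (j : Fin 3) (x : C3) : direction j x j = 1 := Function.update_self ..

theorem direction_of_ne {j s : Fin 3} (h : s ≠ j) (x : C3) : direction j x s = x s :=
  Function.update_of_ne h ..

theorem proj_newChart_affine (j : Fin 3) (u : C3) :
    model1.proj (affine.newChart () 0 j) u = u j • direction j u := by
  change (0 : C3) + blowChart Finset.univ j u = _
  rw [zero_add, blowChart_univ]

theorem centerOverZero_affine :
    CenterOverZero (M := affine) fun _ : Unit => ⟨(), 0, Finset.univ⟩ :=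
  fun _ _ h => funext fun s => h s (Finset.mem_univ s)

theorem isGood_model1 : model1.IsGood := isGood_affine.blowUp centerOverZero_affine

/-- Two points of the exceptional divisor of the blow-up of the origin are the same if they
correspond to the same direction. -/
theorem glued_of_direction {q j : Fin 3} {u v : C3} (hv : v q = 0) (hu : u j = 0) {c : ℂ}
    (h : direction j u = c • direction q v) :
    model1.Glued (affine.newChart () 0 q) (affine.newChart () 0 j) v u := by
  have hcont : Continuous fun t : ℂ =>
      ((Function.update v q (t * c), Function.update u j t) : C3 × C3) := by
    refine Continuous.prodMk ?_ ?_
    · exact continuous_const.update q (by fun_prop)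
    · exact continuous_const.update j continuous_id
  have ht := (hcont.tendsto 0).mono_left (nhdsWithin_le_nhds (s := {0}ᶜ))
  have e : ((Function.update v q (0 * c), Function.update u j 0) : C3 × C3) = (v, u) := by
    have e1 : Function.update v q 0 = v := by
      conv_rhs => rw [← Function.update_eq_self q v, hv]
    have e2 : Function.update u j 0 = u := by
      conv_rhs => rw [← Function.update_eq_self j u, hu]
    rw [zero_mul, e1, e2]
  rw [e] at ht
  have hdir : ∀ (j : Fin 3) (u : C3) (t : ℂ), direction j (Function.update u j t) = direction j u :=
    fun j u t => by simp [direction]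
  refine mem_closure_of_tendsto ht ?_
  filter_upwards [self_mem_nhdsWithin] with t htn
  have h1 : model1.proj (affine.newChart () 0 j) (Function.update u j t) = t • direction j u := by
    rw [proj_newChart_affine, hdir, Function.update_self]
  have h2 : model1.proj (affine.newChart () 0 q) (Function.update v q (t * c)) =
      t • direction j u := by
    rw [proj_newChart_affine, hdir, Function.update_self, h, mul_smul]
  have h3 : t • direction j u ≠ 0 := by
    intro h0
    have := congrFun h0 j
    rw [Pi.smul_apply, direction_self, smul_eq_mul, mul_one] at this
    exact htn this
  exact ⟨isGood_model1.mem_dom _ _ (by rw [h2]; exact h3),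
    isGood_model1.mem_dom _ _ (by rw [h1]; exact h3), h2.trans h1.symm, by
      rw [h2]; exact h3⟩

/-- The coordinates, in a chart `i`, of the points which have coordinates `(1, 1, 0)` or
`(-1, 1, 0)` in the chart `c`: in the modifications considered below, these are `p₃` and `p₄`. -/
def OverPoints (M : Model) (c i : M.chart) : Set C3 :=
  {x | M.Glued c i ![1, 1, 0] x ∨ M.Glued c i ![-1, 1, 0] x}

theorem fderiv_sq_coord {j : Fin 3} {x : C3} (hx : x j = 0) :
    fderiv ℂ (fun u : C3 => u j ^ 2) x = 0 := by
  have := fderiv_sq_mul (analyticAt_coord j x) (analyticAt_const (v := (1 : ℂ))) hx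
  simpa using this

/-- At the directions `[0 : 0 : 1]` and `[0 : 1 : 1]`, in the chart `chart1z`, the linear part of
the field on the exceptional divisor exchanges the axes. -/
theorem isFinal_firstBlowUp_two {x : C3} (hx0 : x 0 = 0) (hx1 : x 1 = 0 ∨ x 1 = 1) (hx2 : x 2 = 0)
    {g : Fin 3 → C3 → ℂ} (hg : ∀ s, AnalyticAt ℂ (g s) x) {V : Fin 3 → C3 → ℂ}
    (hV : V = blowField Finset.univ 2 (fun u => u 2 ^ 2)
          fun s u => cubicPart s (direction 2 u) + u 2 * g s u)
    (hVa : ∀ s, AnalyticAt ℂ (V s) x)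
    (ht : IsTangentToId (germAt x fun y s => y s + y 2 ^ 2 * V s y)) :
    IsFinal (germAt x fun y s => y s + y 2 ^ 2 * V s y) := by
  have hd : ∀ u : C3, direction 2 u 0 = u 0 ∧ direction 2 u 1 = u 1 ∧ direction 2 u 2 = 1 :=
    fun u => ⟨rfl, rfl, rfl⟩
  have hW := analyticAt_cubicPart 2 (direction 2 x) |>.fun_comp (analyticAt_direction 2 x)
  have e0 : ∀ y, y 2 = 0 → V 0 y = (y 1 - 1) * (y 1 - y 0 ^ 2) := by
    intro y hy
    simp [hV, blowField, cubicPart_zero, cubicPart_two, hd, hy]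
    ring
  have e1 : ∀ y, y 2 = 0 → V 1 y = y 0 * (y 0 ^ 2 - 1 - y 1 * (y 1 - 1)) := by
    intro y hy
    simp [hV, blowField, cubicPart_one, cubicPart_two, hd, hy]
    ring
  refine Or.inr (Or.inl (isDegenerateSpike_of_exchange (m := fun y => y 2 ^ 2) (Equiv.refl _)
    (by norm_num) (γ := fun u => cubicPart 2 (direction 2 u) + u 2 * g 2 u) (hVa 0) (hVa 1)
    (by have := hg 2; fun_prop) hx2 (Filter.Eventually.of_forall fun y => rfl)
    (Filter.Eventually.of_forall fun y => ?_) ?_ ?_ ?_ ?_ ?_ ?_ ?_ ht))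
  · simp [hV, blowField]
  · change V 0 x = 0
    rw [e0 x hx2, hx0]
    rcases hx1 with h | h <;> simp [h]
  · change V 1 x = 0
    rw [e1 x hx2, hx0, zero_mul]
  · simp [cubicPart_two, hd, hx0, hx2]
  · refine fderiv_single_eq (hVa 0) (k := fun t => (x 1 - 1) * (-t)) (fun t => ?_) (by fun_prop)
      (by simp)
    rw [e0 _ (by simp [hx2])]
    have h : x 1 * (x 1 - 1) = 0 := by rcases hx1 with h | h <;> simp [h]
    have e : (x 1 - 1) * (x 1 - t ^ 2) = t * ((x 1 - 1) * -t) := by linear_combination h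
    simpa [hx0] using e
  · change fderiv ℂ (V 0) x (Pi.single 1 1) ≠ 0
    rw [fderiv_single_eq (hVa 0) (k := fun t => 2 * x 1 + t - 1) (d := 2 * x 1 - 1) (fun t => ?_)
      (by fun_prop) (by simp)]
    · rcases hx1 with h | h <;> norm_num [h]
    · rw [e0 _ (by simp [hx2])]
      have h : x 1 * (x 1 - 1) = 0 := by rcases hx1 with h | h <;> simp [h]
      have e : (x 1 + t - 1) * (x 1 + t) = t * (2 * x 1 + t - 1) := by linear_combination h
      simpa [hx0] using e
  · change fderiv ℂ (V 1) x (Pi.single 0 1) ≠ 0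
    rw [fderiv_single_eq (hVa 1) (k := fun t => t ^ 2 - 1) (d := -1) (fun t => ?_)
      (by fun_prop) (by simp)]
    · norm_num
    · rw [e1 _ (by simp [hx2])]
      simp [hx0]
      rcases hx1 with h | h <;> simp [h]
  · refine fderiv_single_eq (hVa 1) (k := fun t => 0) (fun t => ?_) (by fun_prop) (by simp)
    rw [show (Equiv.refl (Fin 3)) 1 = 1 from rfl, e1 _ (by simp [hx2])]
    simp [hx0]

/-- The direction `[0 : 1 : 1]` again, as a point of the chart `chart1y`. -/
theorem isFinal_firstBlowUp_one {x : C3} (hx0 : x 0 = 0) (hx1 : x 1 = 0) (hx2 : x 2 = 1)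
    {g : Fin 3 → C3 → ℂ} (hg : ∀ s, AnalyticAt ℂ (g s) x) {V : Fin 3 → C3 → ℂ}
    (hV : V = blowField Finset.univ 1 (fun u => u 1 ^ 2)
          fun s u => cubicPart s (direction 1 u) + u 1 * g s u)
    (hVa : ∀ s, AnalyticAt ℂ (V s) x)
    (ht : IsTangentToId (germAt x fun y s => y s + y 1 ^ 2 * V s y)) :
    IsFinal (germAt x fun y s => y s + y 1 ^ 2 * V s y) := by
  have hd : ∀ u : C3, direction 1 u 0 = u 0 ∧ direction 1 u 1 = 1 ∧ direction 1 u 2 = u 2 :=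
    fun u => ⟨rfl, rfl, rfl⟩
  have hW := analyticAt_cubicPart 1 (direction 1 x) |>.fun_comp (analyticAt_direction 1 x)
  have e0 : ∀ y, y 1 = 0 → V 0 y = y 2 * (1 - y 2) - y 0 ^ 2 * (y 0 ^ 2 - y 2 ^ 2) := by
    intro y hy
    simp [hV, blowField, cubicPart_zero, cubicPart_one, hd, hy]
    ring
  have e2 : ∀ y, y 1 = 0 → V 2 y = y 0 * y 2 * (1 - y 2) - y 2 * y 0 * (y 0 ^ 2 - y 2 ^ 2) := by
    intro y hy
    simp [hV, blowField, cubicPart_one, cubicPart_two, hd, hy]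
    ring
  refine Or.inr (Or.inl (isDegenerateSpike_of_exchange (m := fun y => y 1 ^ 2) (Equiv.swap 1 2)
    (by norm_num) (γ := fun u => cubicPart 1 (direction 1 u) + u 1 * g 1 u) (hVa 0) (hVa 2)
    (by have := hg 1; fun_prop) hx1 (Filter.Eventually.of_forall fun y => rfl)
    (Filter.Eventually.of_forall fun y => ?_) ?_ ?_ ?_ ?_ ?_ ?_ ?_ ht))
  · change V 1 y = y 1 * _
    simp [hV, blowField]
  · change V 0 x = 0
    rw [e0 x hx1, hx0, hx2]; ring
  · change V 2 x = 0
    rw [e2 x hx1, hx0]; ring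
  · simp [cubicPart_one, hd, hx0, hx1]
  · refine fderiv_single_eq (hVa 0) (k := fun t => -t * (t ^ 2 - 1)) (fun t => ?_) (by fun_prop)
      (by simp)
    change V 0 (x + t • Pi.single 0 1) = _
    rw [e0 _ (by simp [hx1])]
    simp [hx0, hx2]
    ring
  · change fderiv ℂ (V 0) x (Pi.single 2 1) ≠ 0
    rw [fderiv_single_eq (hVa 0) (k := fun t => -(1 + t)) (d := -1) (fun t => ?_)
      (by fun_prop) (by simp)]
    · norm_num
    · rw [e0 _ (by simp [hx1])]
      simp [hx0, hx2]
      ring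
  · change fderiv ℂ (V 2) x (Pi.single 0 1) ≠ 0
    rw [fderiv_single_eq (hVa 2) (k := fun t => 1 - t ^ 2) (d := 1) (fun t => ?_)
      (by fun_prop) (by simp)]
    · norm_num
    · rw [e2 _ (by simp [hx1])]
      simp [hx0, hx2]
      ring
  · refine fderiv_single_eq (hVa 2) (k := fun t => 0) (fun t => ?_) (by fun_prop) (by simp)
    change V 2 (x + t • Pi.single 2 1) = _
    rw [e2 _ (by simp [hx1])]
    simp [hx0]

/-- A singular point of the first exceptional divisor is a characteristic direction. Besides `p₃`,
`p₄` and `p₅`, there remain two of them, both degenerate spikes; they have the coordinates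
`(0, 0, 0)` and `(0, 1, 0)` in `chart1z`, and the second one has the coordinates `(0, 0, 1)` in `chart1y`.
-/
theorem resolved_firstBlowUp {P Q R : C3 → ℂ} (hP : HasOrderAtLeast 4 P) (hQ : HasOrderAtLeast 4 Q)
    (hR : HasOrderAtLeast 4 R) (j : Fin 3) :
    ∃ S : Set C3, S.Finite ∧ ∀ x : C3, x j = 0 →
      ¬ (affine.newChart () 0 j = chart1y ∧ x = 0) →
      x ∉ OverPoints model1 chart1z (affine.newChart () 0 j) →
      model1.ResolvedAt (exampleGerm P Q R) S (affine.newChart () 0 j) x := by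
  obtain ⟨g, hg⟩ := hasLift_model1 hP hQ hR j
  refine ⟨{![0, 0, 0], ![0, 1, 0], ![0, 0, 1]}, by simp, fun x hx h5 h34 => ?_⟩
  obtain ⟨hga, hlift⟩ := hg x hx
  set V := blowField Finset.univ j (fun u => u j ^ 2)
    fun s u => cubicPart s (direction j u) + u j * g s u with hV
  have hm := fderiv_sq_coord hx
  by_cases hns : ∃ s, V s x ≠ 0
  · exact hlift.resolvedAt_of_ne hm hns _
  push Not at hns
  -- The field vanishes at `x` if and only if the cubic part is radial in the direction of `x`.
  have hchar : ∀ s, cubicPart s (direction j x) =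
      direction j x s * cubicPart j (direction j x) := by
    intro s
    by_cases hs : s = j
    · subst hs; rw [direction_self, one_mul]
    · have := hns s
      simp only [hV, blowField, if_neg hs, Finset.mem_univ, if_true, hx] at this
      rw [direction_of_ne hs]
      simp at this
      linear_combination this
  have hd1 := direction_self j x
  have hglue : ∀ v : C3, v 2 = 0 → direction j x = direction j x 2 • direction 2 v →
      model1.Glued chart1z (affine.newChart () 0 j) v x := by
    intro v hv h
    exact glued_of_direction hv hx h
  have hj3 : j = 0 ∨ j = 1 ∨ j = 2 := by fin_cases j <;> simp
  rcases characteristic_directions hchar with ⟨h0, h1⟩ | ⟨h0, h1⟩ | ⟨h0, h1⟩ | ⟨h0, h1⟩ | ⟨h0, h1⟩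
  · have hj : j = 2 := by
      rcases hj3 with rfl | rfl | rfl
      · exact absurd (h0.symm.trans hd1) zero_ne_one
      · exact absurd (h1.symm.trans hd1) zero_ne_one
      · rfl
    subst hj
    replace h0 : x 0 = 0 := h0
    replace h1 : x 1 = 0 := h1
    refine hlift.resolvedAt_of_isFinal hm ?_ (isFinal_firstBlowUp_two h0 (Or.inl h1) hx
      (fun s => (hga s).1) hV hlift.analytic_field)
    exact Or.inl (apply_fin_three_ext h0 h1 hx)
  · have hj : j = 1 ∨ j = 2 := by
      rcases hj3 with rfl | h | h
      · exact absurd (h0.symm.trans hd1) zero_ne_one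
      · exact Or.inl h
      · exact Or.inr h
    have h0' : x 0 = 0 := by rcases hj with rfl | rfl <;> exact h0
    rcases hj with rfl | rfl
    · have hx2 : x 2 = 1 := h1.symm.trans hd1
      refine hlift.resolvedAt_of_isFinal hm ?_ (isFinal_firstBlowUp_one h0' hx hx2
        (fun s => (hga s).1) hV hlift.analytic_field)
      exact Or.inr (Or.inr (apply_fin_three_ext h0' hx hx2))
    · have hx1 : x 1 = 1 := h1.trans hd1
      refine hlift.resolvedAt_of_isFinal hm ?_ (isFinal_firstBlowUp_two h0' (Or.inr hx1) hx
        (fun s => (hga s).1) hV hlift.analytic_field)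
      exact Or.inr (Or.inl (apply_fin_three_ext h0' hx1 hx))
  · refine absurd (Or.inl (hglue ![1, 1, 0] rfl (apply_fin_three_ext ?_ ?_ ?_))) h34
    · exact h0.trans (mul_one _).symm
    · exact h1.trans (mul_one _).symm
    · exact (mul_one _).symm
  · refine absurd (Or.inr (hglue ![-1, 1, 0] rfl (apply_fin_three_ext ?_ ?_ ?_))) h34
    · exact h0.trans (mul_neg_one _).symm
    · exact h1.trans (mul_one _).symm
    · exact (mul_one _).symm
  · have hj : j = 1 := by
      rcases hj3 with rfl | rfl | rfl
      · exact absurd (h0.symm.trans hd1) zero_ne_one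
      · rfl
      · exact absurd (h1.symm.trans hd1) zero_ne_one
    subst hj
    exact absurd ⟨rfl, apply_fin_three_ext h0 hx h1⟩ h5

/-! ### Blowing up the points `p₃` and `p₄` -/

/-- Eigenvalues whose ratio is a negative rational satisfy the condition on simple corners. -/
theorem ne_mul_rat {α β : ℂ} (hα : α ≠ 0) {r : ℚ} (hr : 0 < r) (h : β = -(r : ℂ) * α) (q : ℚ)
    (hq : 0 < q) : β ≠ α * (q : ℂ) := by
  intro h'
  have h1 : α * ((q + r : ℚ) : ℂ) = 0 := by push_cast; linear_combination h - h'
  rcases mul_eq_zero.1 h1 with h1 | h1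
  · exact hα h1
  · rw [Rat.cast_eq_zero] at h1; linarith

/-- The blow-up of the point `c`, in its `j`-th chart. -/
def pointMap (c : C3) (j : Fin 3) (u : C3) : C3 := c + u j • direction j u

theorem blowMap_point {I : Type} (i : I) (c : C3) (j : Fin 3) (u : C3) :
    (⟨i, c, Finset.univ⟩ : CenterPiece I).blowMap j u = pointMap c j u := by
  change c + blowChart Finset.univ j u = _
  rw [blowChart_univ]
  rfl

theorem pointMap_apply (c : C3) (j : Fin 3) (u : C3) (s : Fin 3) :
    pointMap c j u s = c s + u j * direction j u s := rfl

theorem pointMap_of_eq_zero {c u : C3} {j : Fin 3} (h : u j = 0) : pointMap c j u = c := by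
  rw [pointMap, h, zero_smul, add_zero]

theorem analyticAt_pointMap (c : C3) (j : Fin 3) (x : C3) : AnalyticAt ℂ (pointMap c j) x := by
  have : pointMap c j = fun u => c + blowChart Finset.univ j u := funext fun u => by
    rw [blowChart_univ]; rfl
  rw [this]
  exact analyticAt_const.fun_add (analyticAt_blowChart _ _ _)

theorem AnalyticAt.comp_pointMap {c x : C3} {j : Fin 3} {g : C3 → ℂ} (hg : AnalyticAt ℂ g c)
    (hx : x j = 0) : AnalyticAt ℂ (fun u => g (pointMap c j u)) x :=
  hg.fun_comp_of_eq (analyticAt_pointMap c j x) (pointMap_of_eq_zero hx)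

theorem eventually_pointMap {c x : C3} {j : Fin 3} {p : C3 → Prop} (h : ∀ᶠ y in 𝓝 c, p y)
    (hx : x j = 0) : ∀ᶠ u in 𝓝 x, p (pointMap c j u) := by
  have ht := (analyticAt_pointMap c j x).continuousAt.tendsto
  rw [pointMap_of_eq_zero hx] at ht
  exact ht.eventually h

/-- `HasLift.blowUp` for the blow-up of a point at which the field `V` vanishes: the pullback of `V`
is divisible by the exceptional coordinate. -/
theorem Model.HasLift.blowPoint {M : Model} {f : C3 → C3} {i : M.chart} {c x : C3} {j : Fin 3}
    {m m' : C3 → ℂ} {V W : Fin 3 → C3 → ℂ} (h : M.HasLift f i c m V) (hx : x j = 0)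
    (hm' : AnalyticAt ℂ m' x) (hW : ∀ s, AnalyticAt ℂ (W s) x)
    (hmm : ∀ᶠ u in 𝓝 x, m (pointMap c j u) = m' u)
    (hVW : ∀ᶠ u in 𝓝 x, ∀ s, V s (pointMap c j u) = u j * W s u) :
    (M.blowPoint i c).HasLift f (M.newChart i c j) x m' (blowField Finset.univ j m' W) := by
  refine HasLift.blowUp (Z := fun _ : Unit => ⟨i, c, Finset.univ⟩) (k := ())
    (Finset.mem_univ j) (V := V) (m := m) ?_ hm' hW ?_ ?_
  · change M.HasLift f i (CenterPiece.blowMap ⟨i, c, Finset.univ⟩ j x) m V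
    rw [blowMap_point, pointMap_of_eq_zero hx]
    exact h
  · rw [← hmm.self_of_nhds, pointMap_of_eq_zero hx]
    exact h.mult_eq_zero
  · filter_upwards [hVW, hmm] with u hu hu' s
    rw [blowMap_point, hu, hu', if_pos (Finset.mem_univ s)]

theorem blowField_self (S : Finset (Fin 3)) (j : Fin 3) (m : C3 → ℂ) (W : Fin 3 → C3 → ℂ) (u : C3) :
    blowField S j m W j u = u j * W j u := if_pos rfl

theorem blowField_of_mem {S : Finset (Fin 3)} {j s : Fin 3} (hs : s ∈ S) (hsj : s ≠ j) (m : C3 → ℂ)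
    (W : Fin 3 → C3 → ℂ) (u : C3) :
    blowField S j m W s u = (W s u - u s * W j u) / (1 + m u * W j u) := by
  rw [blowField, if_neg hsj, if_pos hs]

theorem blowField_of_notMem {S : Finset (Fin 3)} {j s : Fin 3} (hs : s ∉ S) (hj : j ∈ S)
    (m : C3 → ℂ) (W : Fin 3 → C3 → ℂ) (u : C3) : blowField S j m W s u = W s u := by
  rw [blowField, if_neg (by rintro rfl; exact hs hj), if_neg hs]

/-- The blow-up of a point `c` of the exceptional divisor `{z = 0}` at which the field `V` of the
lift `id + z ^ 2 V` has the linear part `(α z, β x + γ y + δ z, 0)` with `α β γ ≠ 0`, in coordinates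
centered at `c`. There are two singular points on the new exceptional divisor: a simple corner in
the direction `[0 : 1 : 0]` and a spinning corner in the direction `[γ : -β : 0]`. -/
theorem resolvedAt_blowPoint {M : Model} {f : C3 → C3} {i : M.chart} {c : C3}
    {V a : Fin 3 → C3 → ℂ} {b : Fin 3 → C3 → ℂ} {k : C3 → ℂ}
    (h : M.HasLift f i c (fun u => u 2 ^ 2) V) (hc : c 2 = 0)
    (ha : ∀ s, AnalyticAt ℂ (a s) c) (hb : ∀ s, AnalyticAt ℂ (b s) c) (hk : AnalyticAt ℂ k c)
    (hV0 : ∀ᶠ y in 𝓝 c, V 0 y = ∑ s, (y s - c s) * a s y)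
    (hV1 : ∀ᶠ y in 𝓝 c, V 1 y = ∑ s, (y s - c s) * b s y)
    (hV2 : ∀ᶠ y in 𝓝 c, V 2 y = y 2 * k y)
    (ha0 : a 0 c = 0) (ha1 : a 1 c = 0) (ha2 : a 2 c ≠ 0) (hb0 : b 0 c ≠ 0) (hb1 : b 1 c ≠ 0)
    (hk0 : k c = 0) (j : Fin 3) :
    ∃ S : Set C3, S.Finite ∧ ∀ x : C3, x j = 0 →
      (M.blowPoint i c).ResolvedAt f S (M.newChart i c j) x := by
  set W : Fin 3 → C3 → ℂ := ![fun u => ∑ s, direction j u s * a s (pointMap c j u),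
    fun u => ∑ s, direction j u s * b s (pointMap c j u),
    fun u => direction j u 2 * k (pointMap c j u)] with hWdef
  have key : ∀ x : C3, x j = 0 → (∀ s, AnalyticAt ℂ (W s) x) ∧
      (M.blowPoint i c).HasLift f (M.newChart i c j) x (fun u => u j ^ 2 * direction j u 2 ^ 2)
        (blowField Finset.univ j (fun u => u j ^ 2 * direction j u 2 ^ 2) W) := by
    intro x hx
    have hdir : ∀ s, AnalyticAt ℂ (fun u => direction j u s) x := fun s =>
      (analyticAt_pi_iff.1 (analyticAt_direction j x)) s
    have hWa : ∀ s, AnalyticAt ℂ (W s) x := by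
      have h1 := fun s => (ha s).comp_pointMap hx
      have h2 := fun s => (hb s).comp_pointMap hx
      have h3 := hk.comp_pointMap hx
      refine forall_fin_three ?_ ?_ ?_
      · exact Finset.analyticAt_fun_sum Finset.univ fun s _ => (hdir s).fun_mul (h1 s)
      · exact Finset.analyticAt_fun_sum Finset.univ fun s _ => (hdir s).fun_mul (h2 s)
      · exact (hdir 2).fun_mul h3
    refine ⟨hWa, h.blowPoint hx ?_ hWa ?_ ?_⟩
    · exact ((analyticAt_coord j x).fun_pow 2).fun_mul ((hdir 2).fun_pow 2)
    · refine Filter.Eventually.of_forall fun u => ?_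
      rw [pointMap_apply, hc, zero_add, mul_pow]
    · filter_upwards [eventually_pointMap hV0 hx, eventually_pointMap hV1 hx,
        eventually_pointMap hV2 hx] with u h0 h1 h2
      refine forall_fin_three ?_ ?_ ?_
      · rw [h0]
        change _ = u j * ∑ s, direction j u s * a s (pointMap c j u)
        rw [Finset.mul_sum]
        refine Finset.sum_congr rfl fun s _ => ?_
        rw [pointMap_apply]; ring
      · rw [h1]
        change _ = u j * ∑ s, direction j u s * b s (pointMap c j u)
        rw [Finset.mul_sum]
        refine Finset.sum_congr rfl fun s _ => ?_
        rw [pointMap_apply]; ring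
      · rw [h2]
        change _ = u j * (_ * _)
        rw [pointMap_apply, hc]; ring
  have hW0 : ∀ x, x j = 0 → W 0 x = direction j x 2 * a 2 c := by
    intro x hx
    change ∑ s, direction j x s * a s (pointMap c j x) = _
    rw [pointMap_of_eq_zero hx, Fin.sum_univ_three, ha0, ha1]; ring
  have hW1 : ∀ x, x j = 0 → W 1 x =
      direction j x 0 * b 0 c + direction j x 1 * b 1 c + direction j x 2 * b 2 c := by
    intro x hx
    change ∑ s, direction j x s * b s (pointMap c j x) = _
    rw [pointMap_of_eq_zero hx, Fin.sum_univ_three]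
  have hW2 : ∀ x, x j = 0 → W 2 x = 0 := by
    intro x hx
    change direction j x 2 * k (pointMap c j x) = _
    rw [pointMap_of_eq_zero hx, hk0, mul_zero]
  have hW2' : ∀ u, W 2 u = direction j u 2 * k (pointMap c j u) := fun u => rfl
  clear_value W
  have hmx : ∀ x : C3, x j = 0 → fderiv ℂ (fun u : C3 => u j ^ 2 * direction j u 2 ^ 2) x = 0 :=
    fun x hx => fderiv_sq_mul (analyticAt_coord j x)
      ((analyticAt_pi_iff.1 (analyticAt_direction j x) 2).fun_pow 2) hx
  have hV : ∀ s, s ≠ j → ∀ x, x j = 0 → blowField Finset.univ j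
      (fun u => u j ^ 2 * direction j u 2 ^ 2) W s x = W s x - x s * W j x := by
    intro s hs x hx
    rw [blowField_of_mem (Finset.mem_univ s) hs, hx]
    simp
  -- `{z = 0}` remains invariant: the field has the cofactor `γ` along it, which is minus the speed
  -- `W j` of the exceptional coordinate on the new exceptional divisor, as the cofactor `k`
  -- vanishes at `c`.
  have hγ : ∀ x, x j = 0 → AnalyticAt ℂ (fun u => (k (pointMap c j u) - W j u) /
      (1 + (u j ^ 2 * direction j u 2 ^ 2) * W j u)) x ∧
      (k (pointMap c j x) - W j x) / (1 + (x j ^ 2 * direction j x 2 ^ 2) * W j x) = - W j x := by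
    intro x hx
    have h1 := hk.comp_pointMap hx
    have h2 := (key x hx).1 j
    have h3 := (analyticAt_pi_iff.1 (analyticAt_direction j x)) 2
    constructor
    · refine (h1.fun_sub h2).fun_div ?_ (by simp [hx])
      fun_prop
    · rw [pointMap_of_eq_zero hx, hk0, hx]; simp
  have hV2γ : j ≠ 2 → ∀ u, blowField Finset.univ j (fun u => u j ^ 2 * direction j u 2 ^ 2) W 2 u =
      u 2 * ((k (pointMap c j u) - W j u) / (1 + (u j ^ 2 * direction j u 2 ^ 2) * W j u)) := by
    intro hj u
    rw [blowField_of_mem (Finset.mem_univ 2) hj.symm, hW2']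
    rw [direction_of_ne hj.symm]
    ring
  have hj3 : j = 0 ∨ j = 1 ∨ j = 2 := by fin_cases j <;> simp
  rcases hj3 with rfl | rfl | rfl
  -- In the `x`-chart, the spinning corner `[γ : -β : 0]` is the only singular point.
  · refine ⟨{![0, -b 0 c / b 1 c, 0]}, by simp, fun x hx => ?_⟩
    obtain ⟨hWa, hl⟩ := key x hx
    by_cases hns : ∃ s, blowField Finset.univ 0
      (fun u => u 0 ^ 2 * direction 0 u 2 ^ 2) W s x ≠ 0
    · exact hl.resolvedAt_of_ne (hmx x hx) hns _
    push Not at hns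
    have hx2 : x 2 = 0 := by
      have h2 := hns 2
      rw [hV 2 (by decide) x hx, hW2 x hx, hW0 x hx] at h2
      have h3 : x 2 * x 2 * a 2 c = 0 := by
        rw [direction_of_ne (by decide)] at h2; linear_combination -h2
      simpa [ha2] using h3
    have hx1 : b 0 c + x 1 * b 1 c = 0 := by
      have h1 := hns 1
      rw [hV 1 (by decide) x hx, hW1 x hx, hW0 x hx, direction_self, direction_of_ne (by decide),
        direction_of_ne (by decide), hx2] at h1
      linear_combination h1
    refine hl.resolvedAt_of_isFinal (hmx x hx) ?_ fun ht => Or.inr (Or.inr ?_)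
    · refine apply_fin_three_ext hx ?_ hx2
      change x 1 = -b 0 c / b 1 c
      field_simp
      linear_combination hx1
    · refine isSpinningCorner_of_eigenvalue (Equiv.swap 0 1) (b := 2) (c := 2) (by norm_num)
        (by norm_num) (hl.analytic_field 1) (hWa 0) (hγ x hx).1 hx hx2
        (Filter.Eventually.of_forall fun u => rfl) (Filter.Eventually.of_forall fun u => rfl)
        (Filter.Eventually.of_forall (hV2γ (by decide))) (hns 1) ?_ ?_ ?_ ht
      · rw [hW0 x hx, direction_of_ne (by decide), hx2, zero_mul]
      · refine (hγ x hx).2.trans ?_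
        rw [hW0 x hx, direction_of_ne (by decide), hx2, zero_mul, neg_zero]
      · change fderiv ℂ (blowField Finset.univ 0 _ W 1) x (Pi.single 1 1) ≠ 0
        rw [fderiv_single_eq (hl.analytic_field 1) (k := fun _ => b 1 c) (fun t => ?_) (by fun_prop)
          rfl]
        · exact hb1
        · have e : (x + t • (Pi.single 1 1 : C3)) 0 = 0 := by simp [hx]
          rw [hV 1 (by decide) _ e, hW1 _ e, hW0 _ e, direction_self, direction_of_ne (by decide),
            direction_of_ne (by decide)]
          simp [hx2]
          linear_combination hx1
  -- Both singular points are visible in the `y`-chart.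
  · refine ⟨{0, ![-b 1 c / b 0 c, 0, 0]}, by simp, fun x hx => ?_⟩
    obtain ⟨hWa, hl⟩ := key x hx
    by_cases hns : ∃ s, blowField Finset.univ 1
      (fun u => u 1 ^ 2 * direction 1 u 2 ^ 2) W s x ≠ 0
    · exact hl.resolvedAt_of_ne (hmx x hx) hns _
    push Not at hns
    have h2 : x 2 * W 1 x = 0 := by
      have h2 := hns 2
      rw [hV 2 (by decide) x hx, hW2 x hx] at h2
      linear_combination -h2
    have h0 : x 2 * a 2 c - x 0 * W 1 x = 0 := by
      have h0 := hns 0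
      rwa [hV 0 (by decide) x hx, hW0 x hx, direction_of_ne (by decide)] at h0
    have hx2 : x 2 = 0 := by
      rcases mul_eq_zero.1 h2 with h | h
      · exact h
      rw [h, mul_zero, sub_zero] at h0
      exact (mul_eq_zero.1 h0).resolve_right ha2
    have hW1x : W 1 x = x 0 * b 0 c + b 1 c := by
      rw [hW1 x hx, direction_self, direction_of_ne (by decide), direction_of_ne (by decide), hx2]
      ring
    have h3 : x 0 * W 1 x = 0 := by rw [hx2, zero_mul, zero_sub, neg_eq_zero] at h0; exact h0
    by_cases hx0 : x 0 = 0
    · have hW1c : W 1 x = b 1 c := by rw [hW1x, hx0, zero_mul, zero_add]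
      refine hl.resolvedAt_of_isFinal (hmx x hx) (Or.inl (apply_fin_three_ext hx0 hx hx2))
        fun ht => Or.inl ?_
      refine isSimpleCorner_of_eigenvalues ((Equiv.swap 0 1).trans (Equiv.swap 0 2)) (a := 2)
        (b := 2) (c := 0) (U := fun _ => 1) (γ := fun _ => 0) (by norm_num) (by norm_num)
        analyticAt_const (hWa 1) (hγ x hx).1 (hl.analytic_field 0) hx hx2
        (Filter.Eventually.of_forall fun u => ?_) (Filter.Eventually.of_forall fun u => rfl)
        (Filter.Eventually.of_forall (hV2γ (by decide))) (hns 0) (fun h => absurd h (lt_irrefl 0))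
        one_ne_zero ?_ (fun q hq => ?_) ht
      · change u 1 ^ 2 * u 2 ^ 2 = u 1 ^ 2 * u 2 ^ 2 * u 0 ^ 0 * 1
        rw [pow_zero, mul_one, mul_one]
      · rw [hW1c]; exact hb1
      · refine ne_of_eq_of_ne (hγ x hx).2 ?_
        rw [hW1c]
        exact ne_mul_rat hb1 zero_lt_one (by simp) q hq
    · have hW10 : W 1 x = 0 := (mul_eq_zero.1 h3).resolve_left hx0
      have hx0' : x 0 * b 0 c + b 1 c = 0 := hW1x.symm.trans hW10
      refine hl.resolvedAt_of_isFinal (hmx x hx)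
        (Or.inr (apply_fin_three_ext ?_ hx hx2)) fun ht => Or.inr (Or.inr ?_)
      · change x 0 = -b 1 c / b 0 c
        field_simp
        linear_combination hx0'
      · refine isSpinningCorner_of_eigenvalue (Equiv.refl _) (b := 2) (c := 2) (by norm_num)
          (by norm_num) (hl.analytic_field 0) (hWa 1) (hγ x hx).1 hx hx2
          (Filter.Eventually.of_forall fun u => rfl) (Filter.Eventually.of_forall fun u => rfl)
          (Filter.Eventually.of_forall (hV2γ (by decide))) (hns 0) hW10 ?_ ?_ ht
        · exact (hγ x hx).2.trans (by rw [hW10, neg_zero])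
        · change fderiv ℂ (blowField Finset.univ 1 _ W 0) x (Pi.single 0 1) ≠ 0
          rw [fderiv_single_eq (hl.analytic_field 0) (k := fun t => b 1 c - t * b 0 c) (d := b 1 c)
            (fun t => ?_) (by fun_prop) (by simp)]
          · exact hb1
          · have e : (x + t • (Pi.single 0 1 : C3)) 1 = 0 := by simp [hx]
            rw [hV 0 (by decide) _ e, hW1 _ e, hW0 _ e, direction_self,
              direction_of_ne (by decide), direction_of_ne (by decide)]
            simp [hx2]
            linear_combination -(x 0 + 2 * t) * hx0'
  -- In the `z`-chart, the `x`-component of the field does not vanish, since `α ≠ 0`.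
  · refine ⟨∅, Set.finite_empty, fun x hx => ?_⟩
    obtain ⟨-, hl⟩ := key x hx
    refine hl.resolvedAt_of_ne (hmx x hx) ⟨0, ?_⟩ _
    rw [hV 0 (by decide) x hx, hW0 x hx, hW2 x hx, direction_self]
    simpa using ha2

/-- The blow-up of the points `p₃` (`ε = 1`) and `p₄` (`ε = -1`). The linear part of the field at
these points is `((g 0 - ε g 2) z, 2 x - ε y + δ z, 0)` in centered coordinates, where `g` is given
on the exceptional divisor by the quartic parts of the germ; the coefficient of `z` in the first
component is, by assumption, nonzero. -/
theorem resolvedAt_blowPoint_of_firstBlowUp {M : Model} {f : C3 → C3} {i : M.chart} {c : C3} {ε : ℂ}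
    (hε : ε ^ 2 = 1) (hc0 : c 0 = ε) (hc1 : c 1 = 1) (hc2 : c 2 = 0) {g : Fin 3 → C3 → ℂ}
    (hg : ∀ s, AnalyticAt ℂ (g s) c)
    (h : M.HasLift f i c (fun u => u 2 ^ 2) (blowField Finset.univ 2 (fun u => u 2 ^ 2)
      fun s u => cubicPart s (direction 2 u) + u 2 * g s u))
    (hne : g 0 c ≠ ε * g 2 c) (j : Fin 3) :
    ∃ S : Set C3, S.Finite ∧ ∀ x : C3, x j = 0 →
      (M.blowPoint i c).ResolvedAt f S (M.newChart i c j) x := by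
  set W2 : C3 → ℂ := fun u => u 0 * (u 1 - 1) + u 2 * g 2 u with hW2
  have hd0 : ∀ u : C3, direction 2 u 0 = u 0 := fun u => rfl
  have hd1 : ∀ u : C3, direction 2 u 1 = u 1 := fun u => rfl
  have hd2 : ∀ u : C3, direction 2 u 2 = 1 := fun u => rfl
  have hg0 := hg 0
  have hg1 := hg 1
  have hg2 := hg 2
  have hε0 : ε ≠ 0 := by rintro rfl; norm_num at hε
  have hW2a : AnalyticAt ℂ W2 c := by fun_prop
  have hD : AnalyticAt ℂ (fun u => 1 + u 2 ^ 2 * W2 u) c := by fun_prop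
  have hDc : 1 + c 2 ^ 2 * W2 c ≠ 0 := by simp [hc2]
  have hW2u : ∀ u, cubicPart 2 (direction 2 u) + u 2 * g 2 u = W2 u := fun u => by
    rw [cubicPart_two, hd0, hd1, hd2]; ring
  refine resolvedAt_blowPoint
    (a := ![fun _ => 0, fun u => (u 1 - u 0 ^ 2) / (1 + u 2 ^ 2 * W2 u),
      fun u => (g 0 u - u 0 * g 2 u) / (1 + u 2 ^ 2 * W2 u)])
    (b := ![fun u => u 0 * (u 0 + ε) / (1 + u 2 ^ 2 * W2 u),
      fun u => -(u 0 * u 1) / (1 + u 2 ^ 2 * W2 u),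
      fun u => (g 1 u - u 1 * g 2 u) / (1 + u 2 ^ 2 * W2 u)]) (k := W2)
    h hc2 (forall_fin_three ?_ ?_ ?_) (forall_fin_three ?_ ?_ ?_) hW2a
    (Filter.Eventually.of_forall fun u => ?_) (Filter.Eventually.of_forall fun u => ?_)
    (Filter.Eventually.of_forall fun u => ?_) rfl ?_ ?_ ?_ ?_ ?_ j
  · exact analyticAt_const
  · exact AnalyticAt.fun_div (by fun_prop) hD hDc
  · exact AnalyticAt.fun_div (by fun_prop) hD hDc
  · exact AnalyticAt.fun_div (by fun_prop) hD hDc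
  · exact AnalyticAt.fun_div (by fun_prop) hD hDc
  · exact AnalyticAt.fun_div (by fun_prop) hD hDc
  · rw [blowField_of_mem (Finset.mem_univ _) (by decide), Fin.sum_univ_three, hW2u]
    simp only [Matrix.cons_val, cubicPart_zero, hd1, hd2, hc0, hc1, hc2, hW2]
    ring
  · rw [blowField_of_mem (Finset.mem_univ _) (by decide), Fin.sum_univ_three, hW2u]
    simp only [Matrix.cons_val, cubicPart_one, hd0, hd2, hc0, hc1, hc2, hW2, div_eq_mul_inv]
    linear_combination u 0 * (1 + u 2 ^ 2 * (u 0 * (u 1 - 1) + u 2 * g 2 u))⁻¹ * hε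
  · rw [blowField_self, hW2u]
  · simp [hc0, hc1, hε]
  · simpa [hc0, hc2, sub_eq_zero] using hne
  · simp [hc0, hc2, hε0, ← two_mul]
  · simp [hc0, hc1, hc2, hε0]
  · simp [hW2, hc1, hc2]

/-! ### Blowing up the point `p₅` -/

/-- The vector field of the lift at the origin of `chart2x`. The first two components are tangent to
the two components `{x = 0}` and `{y = 0}` of the exceptional divisor. -/
def cornerField (A B : Fin 3 → C3 → ℂ) (a e : C3 → ℂ) : Fin 3 → C3 → ℂ :=
  ![fun u => u 0 * ∑ s, u s * A s u, fun u => u 1 * ∑ s, u s * B s u,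
    fun u => u 1 * a u + (u 0 * u 2 - u 2 ^ 2) * e u]

/-- The conditions on the coefficients of `cornerField` which are relevant for its blow-ups: its
leading terms are `(x (z + α y), y (β y - z), ρ y + x z - z ^ 2)`, where `α` and `β` do not matter.
The number `ρ` is the coefficient of `y ^ 4` in the third component of the germ. -/
structure IsCornerData (A B : Fin 3 → C3 → ℂ) (a e : C3 → ℂ) (ρ : ℂ) : Prop where
  analytic_A : ∀ s, AnalyticAt ℂ (A s) 0
  analytic_B : ∀ s, AnalyticAt ℂ (B s) 0
  analytic_a : AnalyticAt ℂ a 0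
  analytic_e : AnalyticAt ℂ e 0
  A_zero : A 0 0 = 0
  A_two : A 2 0 = 1
  B_zero : B 0 0 = 0
  B_two : B 2 0 = -1
  a_eq : a 0 = ρ
  e_eq : e 0 = 1
  ne_zero : ρ ≠ 0

theorem IsCornerData.analyticAt_cornerField {A B : Fin 3 → C3 → ℂ} {a e : C3 → ℂ} {ρ : ℂ}
    (h : IsCornerData A B a e ρ) (s : Fin 3) : AnalyticAt ℂ (cornerField A B a e s) 0 := by
  have h2 := h.analytic_a
  have h3 := h.analytic_e
  revert s
  refine forall_fin_three ?_ ?_ ?_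
  · exact (analyticAt_coord 0 0).fun_mul (Finset.analyticAt_fun_sum Finset.univ fun s _ =>
      (analyticAt_coord s 0).fun_mul (h.analytic_A s))
  · exact (analyticAt_coord 1 0).fun_mul (Finset.analyticAt_fun_sum Finset.univ fun s _ =>
      (analyticAt_coord s 0).fun_mul (h.analytic_B s))
  · change AnalyticAt ℂ (fun u => u 1 * a u + (u 0 * u 2 - u 2 ^ 2) * e u) 0
    fun_prop

section SecondBlowUp

variable {M : Model} {f : C3 → C3} {i : M.chart} {g : Fin 3 → C3 → ℂ}

/-- The `y`-component of the displacement of `exampleGerm` over `p₅`, divided by `y ^ 3` and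
pulled back to the `j`-th chart of the blow-up of `p₅`. -/
def secondSpeed (g : Fin 3 → C3 → ℂ) (j : Fin 3) (u : C3) : ℂ :=
  u j * (direction j u 0 * (u j ^ 2 * (direction j u 0 ^ 2 - direction j u 2 ^ 2)) +
    direction j u 1 * g 1 (pointMap 0 j u))

/-- The pullback, to the `j`-th chart of the blow-up of `p₅`, of the field of the lift at `p₅`,
divided by the `j`-th coordinate. The denominator is the pullback of the one in `blowField`. -/
def secondField (g : Fin 3 → C3 → ℂ) (j : Fin 3) : Fin 3 → C3 → ℂ :=
  ![fun u => (direction j u 2 * (1 - u j * direction j u 2) +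
      direction j u 1 * g 0 (pointMap 0 j u) - direction j u 0 * secondSpeed g j u) /
        (1 + u j ^ 2 * direction j u 1 ^ 2 * secondSpeed g j u),
    fun u => direction j u 1 * secondSpeed g j u,
    fun u => (u j * direction j u 0 * direction j u 2 * (1 - u j * direction j u 2) +
      direction j u 1 * g 2 (pointMap 0 j u) - direction j u 2 * secondSpeed g j u) /
        (1 + u j ^ 2 * direction j u 1 ^ 2 * secondSpeed g j u)]

theorem analyticAt_direction_apply (j s : Fin 3) (x : C3) :
    AnalyticAt ℂ (fun u => direction j u s) x :=
  (analyticAt_pi_iff.1 (analyticAt_direction j x)) s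

theorem analyticAt_secondSpeed (hg : ∀ s, AnalyticAt ℂ (g s) 0) {j : Fin 3} {x : C3}
    (hx : x j = 0) : AnalyticAt ℂ (secondSpeed g j) x := by
  have h0 := analyticAt_direction_apply j 0 x
  have h1 := analyticAt_direction_apply j 1 x
  have h2 := analyticAt_direction_apply j 2 x
  have h3 := (hg 1).comp_pointMap hx
  exact (analyticAt_coord j x).fun_mul (AnalyticAt.fun_add (by fun_prop) (h1.fun_mul h3))

theorem secondSpeed_of_eq_zero {j : Fin 3} {x : C3} (hx : x j = 0) : secondSpeed g j x = 0 := by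
  rw [secondSpeed, hx, zero_mul]

theorem analyticAt_secondField (hg : ∀ s, AnalyticAt ℂ (g s) 0) {j : Fin 3} {x : C3} (hx : x j = 0)
    (s : Fin 3) : AnalyticAt ℂ (secondField g j s) x := by
  have h0 := analyticAt_direction_apply j 0 x
  have h1 := analyticAt_direction_apply j 1 x
  have h2 := analyticAt_direction_apply j 2 x
  have h3 := (hg 0).comp_pointMap hx
  have h4 := (hg 2).comp_pointMap hx
  have h5 := analyticAt_secondSpeed hg hx
  have h6 : 1 + x j ^ 2 * direction j x 1 ^ 2 * secondSpeed g j x ≠ 0 := by simp [hx]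
  revert s
  refine forall_fin_three ?_ ?_ ?_
  · exact (((AnalyticAt.fun_add (by fun_prop) (h1.fun_mul h3))).fun_sub (h0.fun_mul h5)).fun_div
      (by fun_prop) h6
  · exact h1.fun_mul h5
  · exact (((AnalyticAt.fun_add (by fun_prop) (h1.fun_mul h4))).fun_sub (h2.fun_mul h5)).fun_div
      (by fun_prop) h6

theorem secondField_of_eq_zero {j : Fin 3} {x : C3} (hx : x j = 0) :
    secondField g j 0 x = direction j x 2 + direction j x 1 * g 0 0 ∧ secondField g j 1 x = 0 ∧
      secondField g j 2 x = direction j x 1 * g 2 0 := by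
  simp [secondField, secondSpeed_of_eq_zero hx, pointMap_of_eq_zero hx, hx]

theorem hasLift_secondBlowUp (hg : ∀ s, AnalyticAt ℂ (g s) 0)
    (h : M.HasLift f i 0 (fun u => u 1 ^ 2) (blowField Finset.univ 1 (fun u => u 1 ^ 2)
      fun s u => cubicPart s (direction 1 u) + u 1 * g s u)) {j : Fin 3} {x : C3} (hx : x j = 0) :
    (M.blowPoint i 0).HasLift f (M.newChart i 0 j) x (fun u => u j ^ 2 * direction j u 1 ^ 2)
      (blowField Finset.univ j (fun u => u j ^ 2 * direction j u 1 ^ 2) (secondField g j)) := by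
  have hd0 : ∀ u : C3, direction 1 u 0 = u 0 := fun u => rfl
  have hd1 : ∀ u : C3, direction 1 u 1 = 1 := fun u => rfl
  have hd2 : ∀ u : C3, direction 1 u 2 = u 2 := fun u => rfl
  have hp : ∀ u s, pointMap 0 j u s = u j * direction j u s := fun u s => by
    rw [pointMap_apply, Pi.zero_apply, zero_add]
  refine h.blowPoint hx ?_ (analyticAt_secondField hg hx) ?_ ?_
  · have := analyticAt_direction_apply j 1 x
    fun_prop
  · refine Filter.Eventually.of_forall fun u => ?_
    rw [hp, mul_pow]
  · refine Filter.Eventually.of_forall fun u => ?_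
    have h1 : cubicPart 1 (direction 1 (pointMap 0 j u)) + pointMap 0 j u 1 * g 1 (pointMap 0 j u) =
        secondSpeed g j u := by
      simp only [cubicPart_one, hd0, hd2, hp, secondSpeed]
      ring
    refine forall_fin_three ?_ ?_ ?_
    · rw [blowField_of_mem (Finset.mem_univ _) (by decide), h1]
      simp only [cubicPart_zero, hd1, hd2, hp, secondField, Matrix.cons_val, div_eq_mul_inv]
      ring
    · rw [blowField_self, h1]
      simp only [hp, secondField, Matrix.cons_val]
      ring
    · rw [blowField_of_mem (Finset.mem_univ _) (by decide), h1]
      simp only [cubicPart_two, hd0, hd1, hd2, hp, secondField, Matrix.cons_val, div_eq_mul_inv]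
      ring

/-- After the blow-up of `p₅`, only the origin of the `x`-chart is singular: at `p₅`, the linear
part of the field is `(z + g 0 0 y, 0, ρ y)` with `ρ ≠ 0`, which is nilpotent with kernel the
`x`-axis. -/
theorem resolvedAt_secondBlowUp (hg : ∀ s, AnalyticAt ℂ (g s) 0) (hρ : g 2 0 ≠ 0)
    (h : M.HasLift f i 0 (fun u => u 1 ^ 2) (blowField Finset.univ 1 (fun u => u 1 ^ 2)
      fun s u => cubicPart s (direction 1 u) + u 1 * g s u)) {j : Fin 3} {x : C3} (hx : x j = 0)
    (h0 : ¬ (j = 0 ∧ x = 0)) (S : Set C3) :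
    (M.blowPoint i 0).ResolvedAt f S (M.newChart i 0 j) x := by
  refine (hasLift_secondBlowUp hg h hx).resolvedAt_of_ne (fderiv_sq_mul (analyticAt_coord j x)
    ((analyticAt_direction_apply j 1 x).fun_pow 2) hx) ?_ S
  by_contra! hns
  obtain ⟨e0, e1, e2⟩ := secondField_of_eq_zero (g := g) hx
  have hV : ∀ s, s ≠ j → secondField g j s x - x s * secondField g j j x = 0 := by
    intro s hs
    have := hns s
    rwa [blowField_of_mem (Finset.mem_univ s) hs, hx, zero_pow two_ne_zero, zero_mul, zero_mul,
      add_zero, div_one] at this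
  have hj3 : j = 0 ∨ j = 1 ∨ j = 2 := by fin_cases j <;> simp
  rcases hj3 with rfl | rfl | rfl
  · have h1 := hV 1 (by decide)
    have h2 := hV 2 (by decide)
    rw [e0, e1, direction_of_ne (by decide), direction_of_ne (by decide)] at h1
    rw [e0, e2, direction_of_ne (by decide), direction_of_ne (by decide)] at h2
    have hx1 : x 1 = 0 := by
      rcases mul_eq_zero.1 (show x 1 * (x 2 + x 1 * g 0 0) = 0 by linear_combination -h1) with h | h
      · exact h
      · rw [h, mul_zero, sub_zero] at h2
        exact (mul_eq_zero.1 h2).resolve_right hρ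
    have hx2 : x 2 = 0 := by
      rw [hx1] at h2
      have : x 2 * x 2 = 0 := by linear_combination -h2
      simpa using this
    exact h0 ⟨rfl, apply_fin_three_ext hx hx1 hx2⟩
  · have h2 := hV 2 (by decide)
    rw [e1, e2, direction_self, mul_zero, sub_zero, one_mul] at h2
    exact hρ h2
  · have h0 := hV 0 (by decide)
    have h1 := hV 1 (by decide)
    rw [e1, e2, direction_of_ne (by decide)] at h1
    rw [e0, e2, direction_self, direction_of_ne (by decide)] at h0
    have hx1 : x 1 = 0 := by
      have : x 1 * x 1 * g 2 0 = 0 := by linear_combination -h1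
      simpa [hρ] using this
    rw [hx1] at h0
    simp at h0

/-- The lift at the origin of the `x`-chart over `p₅`. -/
theorem hasLift_secondBlowUp_zero (hg : ∀ s, AnalyticAt ℂ (g s) 0) (hρ : g 2 0 ≠ 0)
    (h : M.HasLift f i 0 (fun u => u 1 ^ 2) (blowField Finset.univ 1 (fun u => u 1 ^ 2)
      fun s u => cubicPart s (direction 1 u) + u 1 * g s u)) :
    ∃ (A B : Fin 3 → C3 → ℂ) (a e : C3 → ℂ), IsCornerData A B a e (g 2 0) ∧
      (M.blowPoint i 0).HasLift f (M.newChart i 0 0) 0 (mono 2 2 0) (cornerField A B a e) := by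
  have hx : (0 : C3) 0 = 0 := rfl
  have hl := hasLift_secondBlowUp hg h hx
  have hW := analyticAt_secondField hg hx
  have hG := analyticAt_secondSpeed hg hx
  have hd0 : ∀ u : C3, direction 0 u 0 = 1 := fun u => rfl
  have hd1 : ∀ u : C3, direction 0 u 1 = u 1 := fun u => rfl
  have hd2 : ∀ u : C3, direction 0 u 2 = u 2 := fun u => rfl
  have hg0 := (hg 0).comp_pointMap hx
  have hg1 := (hg 1).comp_pointMap hx
  have hg2 := (hg 2).comp_pointMap hx
  have hp : pointMap 0 0 (0 : C3) = 0 := pointMap_of_eq_zero hx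
  -- `D` and `D'` are the denominators of the first and of the second blow-up.
  set κ : C3 → ℂ := fun u => u 0 ^ 2 * (1 - u 2 ^ 2) + u 1 * g 1 (pointMap 0 0 u) with hκ
  set D : C3 → ℂ := fun u => 1 + u 0 ^ 2 * u 1 ^ 2 * secondSpeed g 0 u with hD
  set D' : C3 → ℂ := fun u => 1 + u 0 ^ 2 * u 1 ^ 2 * secondField g 0 0 u with hD'
  have hGκ : ∀ u, secondSpeed g 0 u = u 0 * κ u := by
    intro u
    simp only [secondSpeed, hd0, hd1, hd2, hκ]
    ring
  have hκa : AnalyticAt ℂ κ 0 :=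
    AnalyticAt.fun_add (by fun_prop) ((analyticAt_coord 1 0).fun_mul hg1)
  have hDa : AnalyticAt ℂ D 0 := by fun_prop
  have hD'a : AnalyticAt ℂ D' 0 := by have := hW 0; fun_prop
  have hD0 : D 0 = 1 := by simp [hD]
  have hD'0 : D' 0 = 1 := by simp [hD']
  have hDne : D 0 ≠ 0 := by rw [hD0]; exact one_ne_zero
  have hD'ne : D' 0 ≠ 0 := by rw [hD'0]; exact one_ne_zero
  have hDD'ne : D 0 * D' 0 ≠ 0 := mul_ne_zero hDne hD'ne
  set A : Fin 3 → C3 → ℂ := ![fun u => -κ u / D u, fun u => g 0 (pointMap 0 0 u) / D u,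
    fun u => (1 - u 0 * u 2) / D u] with hA
  have hAa : ∀ s, AnalyticAt ℂ (A s) 0 := by
    refine forall_fin_three ?_ ?_ ?_
    · exact hκa.fun_neg.fun_div hDa hDne
    · exact hg0.fun_div hDa hDne
    · exact AnalyticAt.fun_div (by fun_prop) hDa hDne
  have hA0 := hAa 0
  have hA1 := hAa 1
  have hA2 := hAa 2
  have hWA : ∀ u, secondField g 0 0 u = ∑ s, u s * A s u := by
    intro u
    rw [Fin.sum_univ_three]
    simp only [secondField, hd0, hd1, hd2, hA, Matrix.cons_val, hGκ, hD]
    ring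
  set B : Fin 3 → C3 → ℂ := ![fun u => (κ u - A 0 u) / D' u, fun u => -A 1 u / D' u,
    fun u => -A 2 u / D' u] with hB
  set a : C3 → ℂ := fun u => (g 2 (pointMap 0 0 u) - u 2 * g 0 (pointMap 0 0 u)) / (D u * D' u)
    with ha
  set e : C3 → ℂ := fun u => (1 - u 0 * u 2) / (D u * D' u) with he
  have hdata : IsCornerData A B a e (g 2 0) := by
    refine ⟨hAa, forall_fin_three ?_ ?_ ?_, ?_, ?_, ?_, ?_, ?_, ?_, ?_, ?_, hρ⟩
    · exact (hκa.fun_sub hA0).fun_div hD'a hD'ne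
    · exact hA1.fun_neg.fun_div hD'a hD'ne
    · exact hA2.fun_neg.fun_div hD'a hD'ne
    · exact (hg2.fun_sub ((analyticAt_coord 2 0).fun_mul hg0)).fun_div (hDa.fun_mul hD'a) hDD'ne
    · exact AnalyticAt.fun_div (by fun_prop) (hDa.fun_mul hD'a) hDD'ne
    · simp [hA, hκ]
    · simp [hA, hD0]
    · simp [hB, hA, hκ]
    · simp [hB, hA, hD0, hD'0]
    · simp [ha, hD0, hD'0, hp]
    · simp [he, hD0, hD'0]
  refine ⟨A, B, a, e, hdata, hl.congr (analyticAt_mono _ _ _ _) hdata.analyticAt_cornerField ?_ ?_⟩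
  · simp [mono]
  · filter_upwards [hDa.continuousAt.eventually_ne hDne, hD'a.continuousAt.eventually_ne hD'ne]
      with u hu hu'
    have hm : u 0 ^ 2 * direction 0 u 1 ^ 2 = mono 2 2 0 u := by rw [hd1, mono, pow_zero, mul_one]
    intro s
    rw [hm]
    congr 1
    revert s
    refine forall_fin_three ?_ ?_ ?_
    · rw [blowField_self, hWA]; rfl
    · rw [blowField_of_mem (Finset.mem_univ 1) (by decide)]
      change (direction 0 u 1 * secondSpeed g 0 u - u 1 * secondField g 0 0 u) / D' u =
        u 1 * ∑ s, u s * B s u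
      rw [hGκ, hWA, hd1, Fin.sum_univ_three, Fin.sum_univ_three]
      simp only [hB, Matrix.cons_val]
      ring
    · rw [blowField_of_mem (Finset.mem_univ 2) (by decide)]
      change (secondField g 0 2 u - u 2 * secondField g 0 0 u) / D' u =
        u 1 * a u + (u 0 * u 2 - u 2 ^ 2) * e u
      have e2 : secondField g 0 2 u = (u 0 * u 2 * (1 - u 0 * u 2) +
        u 1 * g 2 (pointMap 0 0 u) - u 2 * (u 0 * κ u)) / D u := by
        simp only [secondField, hd0, hd1, hd2, Matrix.cons_val, hGκ, hD]
        ring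
      rw [e2, hWA, Fin.sum_univ_three]
      simp only [hA, ha, he, Matrix.cons_val]
      field_simp
      ring

end SecondBlowUp

/-! ### The third blow-up -/

section ThirdBlowUp

variable {M : Model} {f : C3 → C3} {i : M.chart} {A B : Fin 3 → C3 → ℂ} {a e : C3 → ℂ} {ρ : ℂ}

/-- The pullback of `∑ s, u s * A s u` to the `j`-th chart of the blow-up of the origin, divided by
the `j`-th coordinate. -/
def pulledSum (A : Fin 3 → C3 → ℂ) (j : Fin 3) (u : C3) : ℂ :=
  ∑ s, direction j u s * A s (pointMap 0 j u)

/-- The multiplier of the lift in the `j`-th chart of the third blow-up. -/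
def thirdMult (j : Fin 3) (u : C3) : ℂ :=
  u j ^ 2 * (u j ^ 2 * (direction j u 0 ^ 2 * direction j u 1 ^ 2))

/-- The pullback of `cornerField` to the `j`-th chart of the blow-up of the origin, divided by the
`j`-th coordinate, in terms of the pullbacks of the coefficients. -/
def thirdField (α β a e : C3 → ℂ) (j : Fin 3) : Fin 3 → C3 → ℂ :=
  ![fun u => u j * direction j u 0 * α u, fun u => u j * direction j u 1 * β u,
    fun u => direction j u 1 * a u +
      u j * (direction j u 0 * direction j u 2 - direction j u 2 ^ 2) * e u]

theorem analyticAt_pulledSum (hA : ∀ s, AnalyticAt ℂ (A s) 0) {j : Fin 3} {x : C3} (hx : x j = 0) :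
    AnalyticAt ℂ (pulledSum A j) x :=
  Finset.analyticAt_fun_sum Finset.univ fun s _ =>
    (analyticAt_direction_apply j s x).fun_mul ((hA s).comp_pointMap hx)

theorem analyticAt_thirdMult (j : Fin 3) (x : C3) : AnalyticAt ℂ (thirdMult j) x := by
  have h0 := analyticAt_direction_apply j 0 x
  have h1 := analyticAt_direction_apply j 1 x
  unfold thirdMult
  fun_prop

theorem fderiv_thirdMult {j : Fin 3} {x : C3} (hx : x j = 0) : fderiv ℂ (thirdMult j) x = 0 := by
  have h0 := analyticAt_direction_apply j 0 x
  have h1 := analyticAt_direction_apply j 1 x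
  exact fderiv_sq_mul (analyticAt_coord j x) (by fun_prop) hx

theorem analyticAt_thirdField {α β a e : C3 → ℂ} {x : C3} (hα : AnalyticAt ℂ α x)
    (hβ : AnalyticAt ℂ β x) (ha : AnalyticAt ℂ a x) (he : AnalyticAt ℂ e x) (j s : Fin 3) :
    AnalyticAt ℂ (thirdField α β a e j s) x := by
  have h0 := analyticAt_direction_apply j 0 x
  have h1 := analyticAt_direction_apply j 1 x
  have h2 := analyticAt_direction_apply j 2 x
  revert s
  refine forall_fin_three ?_ ?_ ?_
  · change AnalyticAt ℂ (fun u => u j * direction j u 0 * α u) x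
    fun_prop
  · change AnalyticAt ℂ (fun u => u j * direction j u 1 * β u) x
    fun_prop
  · change AnalyticAt ℂ (fun u => direction j u 1 * a u +
      u j * (direction j u 0 * direction j u 2 - direction j u 2 ^ 2) * e u) x
    fun_prop

theorem hasLift_thirdBlowUp (hd : IsCornerData A B a e ρ)
    (h : M.HasLift f i 0 (mono 2 2 0) (cornerField A B a e)) {j : Fin 3} {x : C3} (hx : x j = 0) :
    (M.blowPoint i 0).HasLift f (M.newChart i 0 j) x (thirdMult j)
      (blowField Finset.univ j (thirdMult j) (thirdField (pulledSum A j) (pulledSum B j)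
        (fun u => a (pointMap 0 j u)) (fun u => e (pointMap 0 j u)) j)) := by
  have hp : ∀ u s, pointMap 0 j u s = u j * direction j u s := fun u s => by
    rw [pointMap_apply, Pi.zero_apply, zero_add]
  refine h.blowPoint hx (analyticAt_thirdMult j x) (analyticAt_thirdField
    (analyticAt_pulledSum hd.analytic_A hx) (analyticAt_pulledSum hd.analytic_B hx)
    (hd.analytic_a.comp_pointMap hx) (hd.analytic_e.comp_pointMap hx) j)
    (Filter.Eventually.of_forall fun u => ?_) (Filter.Eventually.of_forall fun u => ?_)
  · simp only [mono, hp, thirdMult]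
    ring
  · have hs : ∀ C : Fin 3 → C3 → ℂ,
        ∑ s, pointMap 0 j u s * C s (pointMap 0 j u) = u j * pulledSum C j u := fun C => by
      rw [pulledSum, Finset.mul_sum]
      exact Finset.sum_congr rfl fun s _ => by rw [hp, mul_assoc]
    refine forall_fin_three ?_ ?_ ?_
    · simp only [cornerField, thirdField, Matrix.cons_val, hs]
      rw [hp]
      ring
    · simp only [cornerField, thirdField, Matrix.cons_val, hs]
      rw [hp]
      ring
    · simp only [cornerField, thirdField, Matrix.cons_val, hp]
      ring

/-- The singular points on the exceptional divisor of the third blow-up lie on the line `L`, since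
the linear part of the field is `(0, 0, ρ y)` and `L` is the line `y = 0` of the exceptional
divisor. -/
theorem resolvedAt_thirdBlowUp (hd : IsCornerData A B a e ρ)
    (h : M.HasLift f i 0 (mono 2 2 0) (cornerField A B a e)) {j : Fin 3} {x : C3} (hx : x j = 0)
    (h0 : ¬ (j = 0 ∧ x 1 = 0)) (h2 : ¬ (j = 2 ∧ x 1 = 0)) (S : Set C3) :
    (M.blowPoint i 0).ResolvedAt f S (M.newChart i 0 j) x := by
  refine (hasLift_thirdBlowUp hd h hx).resolvedAt_of_ne (fderiv_thirdMult hx) ?_ S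
  set W := thirdField (pulledSum A j) (pulledSum B j) (fun u => a (pointMap 0 j u))
    (fun u => e (pointMap 0 j u)) j with hW
  have e0 : W 0 x = 0 := by simp [hW, thirdField, hx]
  have e1 : W 1 x = 0 := by simp [hW, thirdField, hx]
  have e2 : W 2 x = direction j x 1 * ρ := by
    simp [hW, thirdField, hx, pointMap_of_eq_zero hx, hd.a_eq]
  have hV : ∀ s, s ≠ j → blowField Finset.univ j (thirdMult j) W s x = W s x - x s * W j x := by
    intro s hs
    rw [blowField_of_mem (Finset.mem_univ s) hs, thirdMult, hx, zero_pow two_ne_zero, zero_mul,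
      zero_mul, add_zero, div_one]
  have hj3 : j = 0 ∨ j = 1 ∨ j = 2 := by fin_cases j <;> simp
  rcases hj3 with rfl | rfl | rfl
  · refine ⟨2, ?_⟩
    rw [hV 2 (by decide), e0, e2, direction_of_ne (by decide), mul_zero, sub_zero]
    exact mul_ne_zero (fun h => h0 ⟨rfl, h⟩) hd.ne_zero
  · refine ⟨2, ?_⟩
    rw [hV 2 (by decide), e1, e2, direction_self, mul_zero, sub_zero, one_mul]
    exact hd.ne_zero
  · refine ⟨1, ?_⟩
    have hx1 : x 1 ≠ 0 := fun h => h2 ⟨rfl, h⟩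
    rw [hV 1 (by decide), e1, e2, direction_of_ne (by decide), zero_sub, neg_ne_zero]
    exact mul_ne_zero hx1 (mul_ne_zero hx1 hd.ne_zero)

end ThirdBlowUp

/-! ### Blowing up the line `L` -/

/-- The properties, along the line `L`, of the coefficients of the field `thirdField`. They are the
only ones which matter for the blow-up of `L`. The function `α₀` is `z` in the `x`-chart and `1` in
the `z`-chart. -/
structure IsLineData (L : Set C3) (α β a e α₀ : C3 → ℂ) (ρ : ℂ) : Prop where
  analytic_α : ∀ q ∈ L, AnalyticAt ℂ α q
  analytic_β : ∀ q ∈ L, AnalyticAt ℂ β q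
  analytic_a : ∀ q ∈ L, AnalyticAt ℂ a q
  analytic_e : ∀ q ∈ L, AnalyticAt ℂ e q
  α_eq : ∀ q ∈ L, α q = α₀ q
  β_eq : ∀ q ∈ L, β q = -α₀ q
  a_eq : ∀ q ∈ L, a q = ρ
  e_eq : ∀ q ∈ L, e q = 1
  ne_zero : ρ ≠ 0

theorem IsCornerData.isLineData_zero {A B : Fin 3 → C3 → ℂ} {a e : C3 → ℂ} {ρ : ℂ}
    (hd : IsCornerData A B a e ρ) :
    IsLineData {q | q 0 = 0 ∧ q 1 = 0} (pulledSum A 0) (pulledSum B 0)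
      (fun u => a (pointMap 0 0 u)) (fun u => e (pointMap 0 0 u)) (fun q => q 2) ρ where
  analytic_α q hq := analyticAt_pulledSum hd.analytic_A hq.1
  analytic_β q hq := analyticAt_pulledSum hd.analytic_B hq.1
  analytic_a q hq := hd.analytic_a.comp_pointMap hq.1
  analytic_e q hq := hd.analytic_e.comp_pointMap hq.1
  α_eq q hq := by
    simp [pulledSum, pointMap_of_eq_zero hq.1, Fin.sum_univ_three, direction_of_ne, hq.2,
      hd.A_zero, hd.A_two]
  β_eq q hq := by
    simp [pulledSum, pointMap_of_eq_zero hq.1, Fin.sum_univ_three, direction_of_ne, hq.2,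
      hd.B_zero, hd.B_two]
  a_eq q hq := by simp [pointMap_of_eq_zero hq.1, hd.a_eq]
  e_eq q hq := by simp [pointMap_of_eq_zero hq.1, hd.e_eq]
  ne_zero := hd.ne_zero

theorem IsCornerData.isLineData_two {A B : Fin 3 → C3 → ℂ} {a e : C3 → ℂ} {ρ : ℂ}
    (hd : IsCornerData A B a e ρ) :
    IsLineData {q | q 1 = 0 ∧ q 2 = 0} (pulledSum A 2) (pulledSum B 2)
      (fun u => a (pointMap 0 2 u)) (fun u => e (pointMap 0 2 u)) (fun _ => 1) ρ where
  analytic_α q hq := analyticAt_pulledSum hd.analytic_A hq.2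
  analytic_β q hq := analyticAt_pulledSum hd.analytic_B hq.2
  analytic_a q hq := hd.analytic_a.comp_pointMap hq.2
  analytic_e q hq := hd.analytic_e.comp_pointMap hq.2
  α_eq q hq := by
    simp [pulledSum, pointMap_of_eq_zero hq.2, Fin.sum_univ_three, direction_of_ne, hq.1,
      hd.A_zero, hd.A_two, direction_self]
  β_eq q hq := by
    simp [pulledSum, pointMap_of_eq_zero hq.2, Fin.sum_univ_three, direction_of_ne, hq.1,
      hd.B_zero, hd.B_two, direction_self]
  a_eq q hq := by simp [pointMap_of_eq_zero hq.2, hd.a_eq]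
  e_eq q hq := by simp [pointMap_of_eq_zero hq.2, hd.e_eq]
  ne_zero := hd.ne_zero

section LineBlowUp

variable {M : Model} {f : C3 → C3} {K : Type} {Z : K → CenterPiece M.chart} {k : K}

/-- `HasLift.blowUp` for a center which is given by coordinate equations, without translation. -/
theorem Model.HasLift.blowLine {S : Finset (Fin 3)} (hd : (Z k).dirs = S) (hb : (Z k).base = 0)
    {j : Fin 3} (hj : j ∈ (Z k).dirs) {x : C3} {m m' : C3 → ℂ} {V W : Fin 3 → C3 → ℂ}
    (h : M.HasLift f (Z k).chart (blowChart S j x) m V) (hm' : AnalyticAt ℂ m' x)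
    (hmx : m' x = 0) (hW : ∀ s, AnalyticAt ℂ (W s) x)
    (hVW : ∀ᶠ u in 𝓝 x, ∀ s, m (blowChart S j u) * V s (blowChart S j u) =
      m' u * if s ∈ S then u j * W s u else W s u) :
    (M.blowUp Z).HasLift f (pieceChart Z k j hj) x m' (blowField S j m' W) := by
  subst hd
  have hβ : (Z k).blowMap j = blowChart (Z k).dirs j := by
    funext u; rw [CenterPiece.blowMap, hb, zero_add]
  exact HasLift.blowUp hj (by rwa [hβ]) hm' hW hmx (by rwa [hβ])

variable {α β a e : C3 → ℂ} {ρ : ℂ}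

theorem AnalyticAt.comp_blowChart {g : C3 → ℂ} {S : Finset (Fin 3)} {j : Fin 3} {x : C3}
    (hg : AnalyticAt ℂ g (blowChart S j x)) : AnalyticAt ℂ (fun u => g (blowChart S j u)) x :=
  hg.fun_comp (analyticAt_blowChart S j x)

theorem thirdMult_of_eq_zero {j : Fin 3} {x : C3} (hx : x j = 0) : thirdMult j x = 0 := by
  simp [thirdMult, hx]

/-- The denominator in the field of the lift in the `j`-th chart of the third blow-up. -/
def thirdDenom (α β a e : C3 → ℂ) (j : Fin 3) (u : C3) : ℂ :=
  1 + thirdMult j u * thirdField α β a e j j u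

theorem thirdDenom_of_eq_zero {j : Fin 3} {x : C3} (hx : x j = 0) : thirdDenom α β a e j x = 1 := by
  rw [thirdDenom, thirdMult_of_eq_zero hx, zero_mul, add_zero]

theorem IsLineData.analyticAt_thirdDenom {L : Set C3} {α₀ : C3 → ℂ}
    (hL : IsLineData L α β a e α₀ ρ) (j : Fin 3) {q : C3} (hq : q ∈ L) :
    AnalyticAt ℂ (thirdDenom α β a e j) q :=
  analyticAt_const.fun_add ((analyticAt_thirdMult j q).fun_mul (analyticAt_thirdField
    (hL.analytic_α q hq) (hL.analytic_β q hq) (hL.analytic_a q hq) (hL.analytic_e q hq) j j))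

/-- The pullback of the coefficients of `thirdField` to a chart of the blow-up of the line, in terms
of new names for the pullbacks. -/
theorem IsLineData.exists_comp_blowChart {L : Set C3} {α₀ : C3 → ℂ}
    (hL : IsLineData L α β a e α₀ ρ) (S : Finset (Fin 3)) (p j : Fin 3) :
    ∃ α' β' a' e' D : C3 → ℂ, (∀ u, α (blowChart S j u) = α' u) ∧
      (∀ u, β (blowChart S j u) = β' u) ∧ (∀ u, a (blowChart S j u) = a' u) ∧
      (∀ u, e (blowChart S j u) = e' u) ∧ (∀ u, thirdDenom α β a e p (blowChart S j u) = D u) ∧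
      IsLineData {u | blowChart S j u ∈ L} α' β' a' e' (fun u => α₀ (blowChart S j u)) ρ ∧
      ∀ u, blowChart S j u ∈ L → AnalyticAt ℂ D u :=
  ⟨_, _, _, _, _, fun _ => rfl, fun _ => rfl, fun _ => rfl, fun _ => rfl, fun _ => rfl,
    { analytic_α := fun _ hq => (hL.analytic_α _ hq).comp_blowChart
      analytic_β := fun _ hq => (hL.analytic_β _ hq).comp_blowChart
      analytic_a := fun _ hq => (hL.analytic_a _ hq).comp_blowChart
      analytic_e := fun _ hq => (hL.analytic_e _ hq).comp_blowChart
      α_eq := fun _ hq => hL.α_eq _ hq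
      β_eq := fun _ hq => hL.β_eq _ hq
      a_eq := fun _ hq => hL.a_eq _ hq
      e_eq := fun _ hq => hL.e_eq _ hq
      ne_zero := hL.ne_zero }, fun _ hu => (hL.analyticAt_thirdDenom p hu).comp_blowChart⟩

theorem fderiv_mono_zero (a b c : ℕ) {x : C3} (hx : x 0 = 0) :
    fderiv ℂ (mono (a + 2) b c) x = 0 := by
  rw [show mono (a + 2) b c = fun u => u 0 ^ 2 * (u 0 ^ a * u 1 ^ b * u 2 ^ c) from
    funext fun u => by rw [mono]; ring]
  exact fderiv_sq_mul (analyticAt_coord 0 x) (by fun_prop) hx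

theorem fderiv_mono_one (a b c : ℕ) {x : C3} (hx : x 1 = 0) :
    fderiv ℂ (mono a (b + 2) c) x = 0 := by
  rw [show mono a (b + 2) c = fun u => u 1 ^ 2 * (u 0 ^ a * u 1 ^ b * u 2 ^ c) from
    funext fun u => by rw [mono]; ring]
  exact fderiv_sq_mul (analyticAt_coord 1 x) (by fun_prop) hx

theorem fderiv_mono_two (a b c : ℕ) {x : C3} (hx : x 2 = 0) :
    fderiv ℂ (mono a b (c + 2)) x = 0 := by
  rw [show mono a b (c + 2) = fun u => u 2 ^ 2 * (u 0 ^ a * u 1 ^ b * u 2 ^ c) from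
    funext fun u => by rw [mono]; ring]
  exact fderiv_sq_mul (analyticAt_coord 2 x) (by fun_prop) hx

/-- The `x`-chart of the blow-up of `L`, over the `x`-chart of the third blow-up. On the new
exceptional divisor `{x = 0}`, the cofactors of the field along `{x = 0}` and `{y = 0}` are `z` and
`-3 z`, and its last component is `ρ y + z (1 - 2 z)`. There is a spinning corner at the origin and
a simple corner at `(0, 0, 1/2)`. -/
theorem resolvedAt_lineBlowUp_zero_zero
    (hL : IsLineData {q | q 0 = 0 ∧ q 1 = 0} α β a e (fun q => q 2) ρ)
    (hl : ∀ q : C3, q 0 = 0 → M.HasLift f (Z k).chart q (thirdMult 0)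
      (blowField Finset.univ 0 (thirdMult 0) (thirdField α β a e 0)))
    (hd : (Z k).dirs = {0, 1}) (hb : (Z k).base = 0) (hj : 0 ∈ (Z k).dirs) :
    ∃ S : Set C3, S.Finite ∧ ∀ x : C3, x 0 = 0 →
      (M.blowUp Z).ResolvedAt f S (pieceChart Z k 0 hj) x := by
  have hq0 : ∀ u, blowChart {0, 1} 0 u 0 = u 0 := fun u => by simp [blowChart]
  have hq1 : ∀ u, blowChart {0, 1} 0 u 1 = u 1 * u 0 := fun u => by simp [blowChart]
  have hq2 : ∀ u, blowChart {0, 1} 0 u 2 = u 2 := fun u => by simp [blowChart]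
  obtain ⟨α', β', a', e', D, hα', hβ', ha', he', hD, hL', hDa⟩ :=
    hL.exists_comp_blowChart {0, 1} 0 0
  set W : Fin 3 → C3 → ℂ := ![fun u => α' u, fun u => u 1 * ((β' u - α' u) / D u),
    fun u => (u 1 * a' u + (u 2 - u 2 ^ 2) * e' u - u 2 * α' u) / D u] with hW
  have hmem : ∀ x : C3, x 0 = 0 → blowChart {0, 1} 0 x ∈ {q : C3 | q 0 = 0 ∧ q 1 = 0} :=
    fun x hx => ⟨(hq0 x).trans hx, by rw [hq1, hx, mul_zero]⟩
  have hα1 : ∀ x : C3, x 0 = 0 → α' x = x 2 := fun x hx => (hL'.α_eq x (hmem x hx)).trans (hq2 x)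
  have hβ1 : ∀ x : C3, x 0 = 0 → β' x = - x 2 := fun x hx =>
    (hL'.β_eq x (hmem x hx)).trans (by rw [hq2])
  have hD1 : ∀ x : C3, x 0 = 0 → D x = 1 := fun x hx =>
    (hD x).symm.trans (thirdDenom_of_eq_zero ((hq0 x).trans hx))
  have key : ∀ x : C3, x 0 = 0 → AnalyticAt ℂ (fun u => (β' u - α' u) / D u) x ∧
      (M.blowUp Z).HasLift f (pieceChart Z k 0 hj) x (mono 7 2 0)
        (blowField {0, 1} 0 (mono 7 2 0) W) := by
    intro x hx
    have h1 := hL'.analytic_α x (hmem x hx)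
    have h2 := hL'.analytic_β x (hmem x hx)
    have h3 := hL'.analytic_a x (hmem x hx)
    have h4 := hL'.analytic_e x (hmem x hx)
    have h5 := hDa x (hmem x hx)
    have hDx : D x ≠ 0 := by rw [hD1 x hx]; exact one_ne_zero
    have h6 : AnalyticAt ℂ (fun u => (β' u - α' u) / D u) x := (h2.fun_sub h1).fun_div h5 hDx
    refine ⟨h6, (hl _ (hmem x hx).1).blowLine hd hb hj (analyticAt_mono _ _ _ x)
      (by simp [mono, hx])
      (forall_fin_three h1 ((analyticAt_coord 1 x).fun_mul h6)
        (AnalyticAt.fun_div (by fun_prop) h5 hDx))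
      (Filter.Eventually.of_forall fun u => ?_)⟩
    -- The field is divisible by `x` after the blow-up, which makes the multiplier `x ^ 7 * y ^ 2`.
    have hm : thirdMult 0 (blowChart {0, 1} 0 u) = u 0 ^ 6 * u 1 ^ 2 := by
      rw [thirdMult, direction_self, direction_of_ne (by decide), hq0, hq1]; ring
    refine forall_fin_three ?_ ?_ ?_
    · rw [hm, blowField_self, if_pos (by decide)]
      simp only [thirdField, hα', direction_self, hq0, hW, Matrix.cons_val, mono]
      ring
    · rw [hm, blowField_of_mem (Finset.mem_univ _) (by decide), if_pos (by decide),
        ← thirdDenom, hD]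
      simp only [thirdField, hα', hβ', direction_self, hq0, hq1, hW, Matrix.cons_val, mono,
        direction_of_ne (show (1 : Fin 3) ≠ 0 by decide), div_eq_mul_inv]
      ring
    · rw [hm, blowField_of_mem (Finset.mem_univ _) (by decide), if_neg (by decide),
        ← thirdDenom, hD]
      simp only [thirdField, hα', ha', he', direction_self, hq0, hq1, hq2, hW, Matrix.cons_val,
        mono, direction_of_ne (show (1 : Fin 3) ≠ 0 by decide),
        direction_of_ne (show (2 : Fin 3) ≠ 0 by decide), div_eq_mul_inv]
      ring
  set V := blowField {0, 1} 0 (mono 7 2 0) W with hV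
  set γ : C3 → ℂ := fun u => ((β' u - α' u) / D u - α' u) / (1 + mono 7 2 0 u * α' u) with hγ
  have hV0 : ∀ u, V 0 u = u 0 * α' u := fun u => blowField_self ..
  have hV1 : ∀ u, V 1 u = u 1 * γ u := by
    intro u
    rw [hV, blowField_of_mem (by decide) (by decide)]
    simp only [hW, Matrix.cons_val, hγ]
    ring
  have hV2 : ∀ u, V 2 u = (u 1 * a' u + (u 2 - u 2 ^ 2) * e' u - u 2 * α' u) / D u := fun u =>
    blowField_of_notMem (by decide) (by decide) ..
  have hm0 : ∀ x : C3, x 0 = 0 → mono 7 2 0 x = 0 := fun x hx => by simp [mono, hx]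
  have hγa : ∀ x : C3, x 0 = 0 → AnalyticAt ℂ γ x := fun x hx => by
    have h1 := hL'.analytic_α x (hmem x hx)
    have h6 := (key x hx).1
    exact (h6.fun_sub h1).fun_div (by fun_prop) (by simp [hm0 x hx])
  have hγ1 : ∀ x : C3, x 0 = 0 → γ x = -3 * x 2 := fun x hx => by
    simp only [hγ, hm0 x hx, hα1 x hx, hβ1 x hx, hD1 x hx]
    ring
  have hV2x : ∀ x : C3, x 0 = 0 → V 2 x = x 1 * ρ + x 2 * (1 - 2 * x 2) := fun x hx => by
    rw [hV2, hα1 x hx, hL'.a_eq x (hmem x hx), hL'.e_eq x (hmem x hx), hD1 x hx]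
    ring
  clear_value V γ
  refine ⟨{0, ![0, 0, 1 / 2]}, by simp, fun x hx => ?_⟩
  have h1 := hL'.analytic_α x (hmem x hx)
  have hlx := (key x hx).2
  have hm := fderiv_mono_zero 5 2 0 hx
  by_cases hns : ∃ s, V s x ≠ 0
  · exact hlx.resolvedAt_of_ne hm hns _
  push Not at hns
  have n1 : x 1 * (-3 * x 2) = 0 := by rw [← hγ1 x hx, ← hV1]; exact hns 1
  have n2 : x 1 * ρ + x 2 * (1 - 2 * x 2) = 0 := by rw [← hV2x x hx]; exact hns 2
  have hx1 : x 1 = 0 := by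
    rcases mul_eq_zero.1 n1 with h | h
    · exact h
    · have hx2 : x 2 = 0 := by simpa using h
      rw [hx2, zero_mul, add_zero] at n2
      exact (mul_eq_zero.1 n2).resolve_right hL.ne_zero
  rw [hx1, zero_mul, zero_add] at n2
  rcases mul_eq_zero.1 n2 with hx2 | hx2
  · refine hlx.resolvedAt_of_isFinal hm (Or.inl (apply_fin_three_ext hx hx1 hx2)) fun ht =>
      Or.inr (Or.inr ?_)
    -- The coordinates play the roles of `y`, `z`, `x`, in this order.
    refine isSpinningCorner_of_eigenvalue ((Equiv.swap 0 1).trans (Equiv.swap 0 2)).symm (b := 7)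
      (c := 2) (by norm_num) (by norm_num) (hlx.analytic_field 2) h1 (hγa x hx) hx hx1
      (Filter.Eventually.of_forall fun u => ?_) (Filter.Eventually.of_forall hV0)
      (Filter.Eventually.of_forall hV1) (hns 2) ((hα1 x hx).trans hx2) ?_ ?_ ht
    · change mono 7 2 0 u = u 0 ^ 7 * u 1 ^ 2
      rw [mono, pow_zero, mul_one]
    · rw [hγ1 x hx, hx2, mul_zero]
    · change fderiv ℂ (V 2) x (Pi.single 2 1) ≠ 0
      rw [fderiv_single_eq (hlx.analytic_field 2) (k := fun t => 1 - 2 * t) (d := 1) (fun t => ?_)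
        (by fun_prop) (by simp)]
      · exact one_ne_zero
      · rw [hV2x _ (by simp [hx])]
        simp [hx1, hx2]
  · have hx2' : x 2 = 1 / 2 := by linear_combination -1 / 2 * hx2
    refine hlx.resolvedAt_of_isFinal hm (Or.inr (apply_fin_three_ext hx hx1 hx2')) fun ht =>
      Or.inl ?_
    refine isSimpleCorner_of_eigenvalues (Equiv.refl _) (a := 7) (b := 2) (c := 0)
      (U := fun _ => 1) (γ := fun _ => 0) (by norm_num) (by norm_num) analyticAt_const h1 (hγa x hx)
      (hlx.analytic_field 2) hx hx1 (Filter.Eventually.of_forall fun u => (mul_one _).symm)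
      (Filter.Eventually.of_forall hV0) (Filter.Eventually.of_forall hV1) (hns 2)
      (fun h => absurd h (lt_irrefl 0)) one_ne_zero ?_ ?_ ht
    · rw [hα1 x hx, hx2']; norm_num
    · refine ne_mul_rat (r := 3) ?_ (by norm_num) ?_
      · rw [hα1 x hx, hx2']; norm_num
      · rw [hα1 x hx, hγ1 x hx]; norm_num

/-- The `y`-chart of the blow-up of `L`, over the `x`-chart of the third blow-up: there are no
singular points on the new exceptional divisor. -/
theorem resolvedAt_lineBlowUp_zero_one
    (hL : IsLineData {q | q 0 = 0 ∧ q 1 = 0} α β a e (fun q => q 2) ρ)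
    (hl : ∀ q : C3, q 0 = 0 → M.HasLift f (Z k).chart q (thirdMult 0)
      (blowField Finset.univ 0 (thirdMult 0) (thirdField α β a e 0)))
    (hd : (Z k).dirs = {0, 1}) (hb : (Z k).base = 0) (hj : 1 ∈ (Z k).dirs) (S : Set C3) {x : C3}
    (hx : x 1 = 0) : (M.blowUp Z).ResolvedAt f S (pieceChart Z k 1 hj) x := by
  have hq0 : ∀ u, blowChart {0, 1} 1 u 0 = u 0 * u 1 := fun u => by simp [blowChart]
  have hq1 : ∀ u, blowChart {0, 1} 1 u 1 = u 1 := fun u => by simp [blowChart]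
  have hq2 : ∀ u, blowChart {0, 1} 1 u 2 = u 2 := fun u => by simp [blowChart]
  obtain ⟨α', β', a', e', D, hα', hβ', ha', he', hD, hL', hDa⟩ :=
    hL.exists_comp_blowChart {0, 1} 0 1
  set W : Fin 3 → C3 → ℂ := ![fun u => u 0 ^ 2 * α' u, fun u => u 0 * ((β' u - α' u) / D u),
    fun u => (a' u + u 0 * ((u 2 - u 2 ^ 2) * e' u - u 2 * α' u)) / D u] with hW
  have hmem : blowChart {0, 1} 1 x ∈ {q : C3 | q 0 = 0 ∧ q 1 = 0} :=
    ⟨by rw [hq0, hx, mul_zero], (hq1 x).trans hx⟩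
  have h1 := hL'.analytic_α x hmem
  have h2 := hL'.analytic_β x hmem
  have h3 := hL'.analytic_a x hmem
  have h4 := hL'.analytic_e x hmem
  have h5 := hDa x hmem
  have hα1 : α' x = x 2 := (hL'.α_eq x hmem).trans (hq2 x)
  have hβ1 : β' x = - x 2 := (hL'.β_eq x hmem).trans (by rw [hq2])
  have ha1 : a' x = ρ := hL'.a_eq x hmem
  have he1 : e' x = 1 := hL'.e_eq x hmem
  have hD1 : D x = 1 := (hD x).symm.trans (thirdDenom_of_eq_zero hmem.1)
  have hDx : D x ≠ 0 := by rw [hD1]; exact one_ne_zero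
  have hlx : (M.blowUp Z).HasLift f (pieceChart Z k 1 hj) x (mono 4 7 0)
      (blowField {0, 1} 1 (mono 4 7 0) W) := by
    refine (hl _ hmem.1).blowLine hd hb hj (analyticAt_mono _ _ _ x) (by simp [mono, hx])
      (forall_fin_three (((analyticAt_coord 0 x).fun_pow 2).fun_mul h1)
        ((analyticAt_coord 0 x).fun_mul ((h2.fun_sub h1).fun_div h5 hDx))
        (AnalyticAt.fun_div (by fun_prop) h5 hDx))
      (Filter.Eventually.of_forall fun u => ?_)
    have hm : thirdMult 0 (blowChart {0, 1} 1 u) = u 0 ^ 4 * u 1 ^ 6 := by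
      rw [thirdMult, direction_self, direction_of_ne (by decide), hq0, hq1]; ring
    refine forall_fin_three ?_ ?_ ?_
    · rw [hm, blowField_self, if_pos (by decide)]
      simp only [thirdField, hα', direction_self, hq0, hW, Matrix.cons_val, mono]
      ring
    · rw [hm, blowField_of_mem (Finset.mem_univ _) (by decide), if_pos (by decide),
        ← thirdDenom, hD]
      simp only [thirdField, hα', hβ', direction_self, hq0, hq1, hW, Matrix.cons_val, mono,
        direction_of_ne (show (1 : Fin 3) ≠ 0 by decide), div_eq_mul_inv]
      ring
    · rw [hm, blowField_of_mem (Finset.mem_univ _) (by decide), if_neg (by decide),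
        ← thirdDenom, hD]
      simp only [thirdField, hα', ha', he', direction_self, hq0, hq1, hq2, hW, Matrix.cons_val,
        mono, direction_of_ne (show (1 : Fin 3) ≠ 0 by decide),
        direction_of_ne (show (2 : Fin 3) ≠ 0 by decide), div_eq_mul_inv]
      ring
  refine hlx.resolvedAt_of_ne (fderiv_mono_one 4 5 0 hx) ?_ _
  by_contra! hns
  have n0 : x 0 ^ 2 * x 2 = 0 := by
    have := hns 0
    rw [blowField_of_mem (by decide) (by decide)] at this
    simp only [hW, Matrix.cons_val, hα1, hβ1, hD1, mono, hx] at this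
    linear_combination (1 / 3) * this
  have n2 : ρ + x 0 * (x 2 * (1 - 2 * x 2)) = 0 := by
    have := hns 2
    rw [blowField_of_notMem (by decide) (by decide)] at this
    simp only [hW, Matrix.cons_val, hα1, ha1, he1, hD1] at this
    linear_combination this
  have n3 : x 0 * x 2 = 0 := by
    rcases mul_eq_zero.1 n0 with h | h
    · rw [(pow_eq_zero_iff two_ne_zero).1 h, zero_mul]
    · rw [h, mul_zero]
  refine hL.ne_zero ?_
  linear_combination n2 - (1 - 2 * x 2) * n3

/-- The `z`-chart of the blow-up of `L`, over the `z`-chart of the third blow-up. The field is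
tangent to the three coordinate planes, with the cofactors `1 - ω`, `-1 - 2 ω` and `ω` where
`ω = ρ y + x - 1` on the new exceptional divisor. There are three singular points on the latter; at each of
them, two of the cofactors are nonzero with a negative rational ratio, so that it is a simple
corner. -/
theorem resolvedAt_lineBlowUp_two_two
    (hL : IsLineData {q | q 1 = 0 ∧ q 2 = 0} α β a e (fun _ => 1) ρ)
    (hl : ∀ q : C3, q 2 = 0 → M.HasLift f (Z k).chart q (thirdMult 2)
      (blowField Finset.univ 2 (thirdMult 2) (thirdField α β a e 2)))
    (hd : (Z k).dirs = {1, 2}) (hb : (Z k).base = 0) (hj : 2 ∈ (Z k).dirs) :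
    ∃ S : Set C3, S.Finite ∧ ∀ x : C3, x 2 = 0 →
      (M.blowUp Z).ResolvedAt f S (pieceChart Z k 2 hj) x := by
  have hq0 : ∀ u, blowChart {1, 2} 2 u 0 = u 0 := fun u => by simp [blowChart]
  have hq1 : ∀ u, blowChart {1, 2} 2 u 1 = u 1 * u 2 := fun u => by simp [blowChart]
  have hq2 : ∀ u, blowChart {1, 2} 2 u 2 = u 2 := fun u => by simp [blowChart]
  obtain ⟨α', β', a', e', D, hα', hβ', ha', he', hD, hL', hDa⟩ :=
    hL.exists_comp_blowChart {1, 2} 2 2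
  set ω : C3 → ℂ := fun u => u 1 * a' u + (u 0 - 1) * e' u with hω
  set γ₀ : C3 → ℂ := fun u => (α' u - ω u) / D u with hγ₀
  set W : Fin 3 → C3 → ℂ := ![fun u => u 0 * γ₀ u, fun u => u 1 * ((β' u - ω u) / D u), ω] with hW
  set γ₁ : C3 → ℂ := fun u => ((β' u - ω u) / D u - ω u) / (1 + mono 2 2 7 u * ω u) with hγ₁
  have hmem : ∀ x : C3, x 2 = 0 → blowChart {1, 2} 2 x ∈ {q : C3 | q 1 = 0 ∧ q 2 = 0} :=
    fun x hx => ⟨by rw [hq1, hx, mul_zero], (hq2 x).trans hx⟩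
  have key : ∀ x : C3, x 2 = 0 → AnalyticAt ℂ ω x ∧ AnalyticAt ℂ γ₀ x ∧ AnalyticAt ℂ γ₁ x ∧
      ω x = ρ * x 1 + x 0 - 1 ∧ γ₀ x = 1 - ω x ∧ γ₁ x = -1 - 2 * ω x ∧
      (M.blowUp Z).HasLift f (pieceChart Z k 2 hj) x (mono 2 2 7)
        (blowField {1, 2} 2 (mono 2 2 7) W) := by
    intro x hx
    have h1 := hL'.analytic_α x (hmem x hx)
    have h2 := hL'.analytic_β x (hmem x hx)
    have h3 := hL'.analytic_a x (hmem x hx)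
    have h4 := hL'.analytic_e x (hmem x hx)
    have h5 := hDa x (hmem x hx)
    have hα1 : α' x = 1 := hL'.α_eq x (hmem x hx)
    have hβ1 : β' x = -1 := hL'.β_eq x (hmem x hx)
    have hD1 : D x = 1 := (hD x).symm.trans (thirdDenom_of_eq_zero (hmem x hx).2)
    have hDx : D x ≠ 0 := by rw [hD1]; exact one_ne_zero
    have hm0 : mono 2 2 7 x = 0 := by simp [mono, hx]
    have h6 : AnalyticAt ℂ ω x := by fun_prop
    have h7 : AnalyticAt ℂ γ₀ x := (h1.fun_sub h6).fun_div h5 hDx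
    have h8 : AnalyticAt ℂ (fun u => (β' u - ω u) / D u) x := (h2.fun_sub h6).fun_div h5 hDx
    refine ⟨h6, h7, (h8.fun_sub h6).fun_div (by fun_prop) (by simp [hm0]), ?_, ?_, ?_,
      (hl _ (hmem x hx).2).blowLine hd hb hj (analyticAt_mono _ _ _ x) hm0
      (forall_fin_three ((analyticAt_coord 0 x).fun_mul h7) ((analyticAt_coord 1 x).fun_mul h8) h6)
      (Filter.Eventually.of_forall fun u => ?_)⟩
    · rw [hω]
      change x 1 * a' x + (x 0 - 1) * e' x = _
      rw [hL'.a_eq x (hmem x hx), hL'.e_eq x (hmem x hx)]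
      ring
    · rw [hγ₀]
      simp only [hα1, hD1, div_one]
    · rw [hγ₁]
      simp only [hβ1, hD1, hm0]
      ring
    have hm : thirdMult 2 (blowChart {1, 2} 2 u) = u 0 ^ 2 * u 1 ^ 2 * u 2 ^ 6 := by
      rw [thirdMult, direction_of_ne (by decide), direction_of_ne (by decide), hq0, hq1, hq2]; ring
    have hω2 : thirdField α β a e 2 2 (blowChart {1, 2} 2 u) = u 2 * ω u := by
      simp only [thirdField, ha', he', direction_self, hq0, hq1, hq2, hω, Matrix.cons_val,
        direction_of_ne (show (1 : Fin 3) ≠ 2 by decide),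
        direction_of_ne (show (0 : Fin 3) ≠ 2 by decide)]
      ring
    refine forall_fin_three ?_ ?_ ?_
    · rw [hm, blowField_of_mem (Finset.mem_univ _) (by decide), if_neg (by decide),
        ← thirdDenom, hD, hω2]
      simp only [thirdField, hα', hq0, hq2, hW, Matrix.cons_val, mono, hγ₀,
        direction_of_ne (show (0 : Fin 3) ≠ 2 by decide), div_eq_mul_inv]
      ring
    · rw [hm, blowField_of_mem (Finset.mem_univ _) (by decide), if_pos (by decide),
        ← thirdDenom, hD, hω2]
      simp only [thirdField, hβ', hq1, hq2, hW, Matrix.cons_val,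
        mono, direction_of_ne (show (1 : Fin 3) ≠ 2 by decide), div_eq_mul_inv]
      ring
    · rw [hm, blowField_self, hω2, if_pos (by decide)]
      simp only [hq2, hW, Matrix.cons_val, mono]
      ring
  set V := blowField {1, 2} 2 (mono 2 2 7) W with hV
  have hV0 : ∀ u, V 0 u = u 0 * γ₀ u := fun u => blowField_of_notMem (by decide) (by decide) ..
  have hV1 : ∀ u, V 1 u = u 1 * γ₁ u := by
    intro u
    rw [hV, blowField_of_mem (by decide) (by decide)]
    simp only [hW, Matrix.cons_val, hγ₁]
    ring
  have hV2 : ∀ u, V 2 u = u 2 * ω u := fun u => blowField_self ..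
  clear_value V γ₀ γ₁ ω
  refine ⟨{0, ![0, 1 / (2 * ρ), 0], ![2, 0, 0]}, by simp, fun x hx => ?_⟩
  obtain ⟨hωa, hγ₀a, hγ₁a, hωx, hγ₀x, hγ₁x, hlx⟩ := key x hx
  have hm := fderiv_mono_two 2 2 5 hx
  by_cases hns : ∃ s, V s x ≠ 0
  · exact hlx.resolvedAt_of_ne hm hns _
  push Not at hns
  have hρ := hL.ne_zero
  rcases mul_eq_zero.1 ((hV0 x).symm.trans (hns 0)) with hx0 | hx0
  · rcases mul_eq_zero.1 ((hV1 x).symm.trans (hns 1)) with hx1 | hx1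
    · have hω1 : ω x = -1 := by rw [hωx, hx0, hx1]; ring
      refine hlx.resolvedAt_of_isFinal hm (Or.inl (apply_fin_three_ext hx0 hx1 hx)) fun ht =>
        Or.inl ?_
      refine isSimpleCorner_of_eigenvalues ((Equiv.swap 0 1).trans (Equiv.swap 0 2)).symm (a := 7)
        (b := 2) (c := 2) (U := fun _ => 1) (γ := γ₁) (by norm_num) (by norm_num) analyticAt_const
        hωa hγ₀a (hlx.analytic_field 1) hx hx0 (Filter.Eventually.of_forall fun u => ?_)
        (Filter.Eventually.of_forall hV2) (Filter.Eventually.of_forall hV0) (hns 1)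
        (fun _ => ⟨hx1, hγ₁a, Filter.Eventually.of_forall hV1⟩) one_ne_zero ?_ ?_ ht
      · change mono 2 2 7 u = u 2 ^ 7 * u 0 ^ 2 * u 1 ^ 2 * 1
        rw [mono]; ring
      · rw [hω1]; norm_num
      · refine ne_mul_rat (r := 2) ?_ (by norm_num) ?_
        · rw [hω1]; norm_num
        · rw [hγ₀x, hω1]; norm_num
    · have hω1 : ω x = -1 / 2 := by rw [hγ₁x] at hx1; linear_combination -1 / 2 * hx1
      have hx1' : x 1 = 1 / (2 * ρ) := by
        field_simp
        rw [hω1, hx0] at hωx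
        linear_combination -2 * hωx
      refine hlx.resolvedAt_of_isFinal hm (Or.inr (Or.inl (apply_fin_three_ext hx0 hx1' hx)))
        fun ht => Or.inl ?_
      refine isSimpleCorner_of_eigenvalues (Equiv.swap 1 2) (a := 2)
        (b := 7) (c := 0) (U := fun u => u 1 ^ 2) (γ := γ₁) (by norm_num) (by norm_num)
        (by fun_prop) hγ₀a hωa (hlx.analytic_field 1) hx0 hx
        (Filter.Eventually.of_forall fun u => ?_)
        (Filter.Eventually.of_forall hV0) (Filter.Eventually.of_forall hV2) (hns 1)
        (fun h => absurd h (lt_irrefl 0)) ?_ ?_ ?_ ht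
      · change mono 2 2 7 u = u 0 ^ 2 * u 2 ^ 7 * u 1 ^ 0 * u 1 ^ 2
        rw [mono]; ring
      · rw [hx1']; exact pow_ne_zero 2 (one_div_ne_zero (mul_ne_zero two_ne_zero hρ))
      · rw [hγ₀x, hω1]; norm_num
      · refine ne_mul_rat (r := 1 / 3) ?_ (by norm_num) ?_
        · rw [hγ₀x, hω1]; norm_num
        · rw [hγ₀x, hω1]; norm_num
  · rw [hγ₀x] at hx0
    have hω1 : ω x = 1 := by linear_combination -hx0
    have hx1 : x 1 = 0 := by
      refine (mul_eq_zero.1 ((hV1 x).symm.trans (hns 1))).resolve_right ?_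
      rw [hγ₁x, hω1]; norm_num
    have hx0' : x 0 = 2 := by rw [hω1, hx1] at hωx; linear_combination -hωx
    refine hlx.resolvedAt_of_isFinal hm (Or.inr (Or.inr (apply_fin_three_ext hx0' hx1 hx)))
      fun ht => Or.inl ?_
    refine isSimpleCorner_of_eigenvalues ((Equiv.swap 0 1).trans (Equiv.swap 0 2)) (a := 2)
      (b := 7) (c := 0) (U := fun u => u 0 ^ 2) (γ := γ₁) (by norm_num) (by norm_num)
      (by fun_prop) hγ₁a hωa (hlx.analytic_field 0) hx1 hx
      (Filter.Eventually.of_forall fun u => ?_)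
      (Filter.Eventually.of_forall hV1) (Filter.Eventually.of_forall hV2) (hns 0)
      (fun h => absurd h (lt_irrefl 0)) ?_ ?_ ?_ ht
    · change mono 2 2 7 u = u 1 ^ 2 * u 2 ^ 7 * u 0 ^ 0 * u 0 ^ 2
      rw [mono]; ring
    · rw [hx0']; norm_num
    · rw [hγ₁x, hω1]; norm_num
    · refine ne_mul_rat (r := 1 / 3) ?_ (by norm_num) ?_
      · rw [hγ₁x, hω1]; norm_num
      · rw [hγ₁x, hω1]; norm_num

/-- The `y`-chart of the blow-up of `L`, over the `z`-chart of the third blow-up. The field is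
tangent to the three coordinate planes, with the cofactors `z - ω`, `-z - ω` and `z + 2 ω` where
`ω = ρ + z (x - 1)` on the new exceptional divisor. There are two singular points on the latter, both
of them simple corners. -/
theorem resolvedAt_lineBlowUp_two_one
    (hL : IsLineData {q | q 1 = 0 ∧ q 2 = 0} α β a e (fun _ => 1) ρ)
    (hl : ∀ q : C3, q 2 = 0 → M.HasLift f (Z k).chart q (thirdMult 2)
      (blowField Finset.univ 2 (thirdMult 2) (thirdField α β a e 2)))
    (hd : (Z k).dirs = {1, 2}) (hb : (Z k).base = 0) (hj : 1 ∈ (Z k).dirs) :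
    ∃ S : Set C3, S.Finite ∧ ∀ x : C3, x 1 = 0 →
      (M.blowUp Z).ResolvedAt f S (pieceChart Z k 1 hj) x := by
  have hq0 : ∀ u, blowChart {1, 2} 1 u 0 = u 0 := fun u => by simp [blowChart]
  have hq1 : ∀ u, blowChart {1, 2} 1 u 1 = u 1 := fun u => by simp [blowChart]
  have hq2 : ∀ u, blowChart {1, 2} 1 u 2 = u 2 * u 1 := fun u => by simp [blowChart]
  obtain ⟨α', β', a', e', D, hα', hβ', ha', he', hD, hL', hDa⟩ :=
    hL.exists_comp_blowChart {1, 2} 2 1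
  set ω : C3 → ℂ := fun u => a' u + u 2 * ((u 0 - 1) * e' u) with hω
  set γ₀ : C3 → ℂ := fun u => (u 2 * α' u - ω u) / D u with hγ₀
  set γ₁ : C3 → ℂ := fun u => (u 2 * β' u - ω u) / D u with hγ₁
  set W : Fin 3 → C3 → ℂ := ![fun u => u 0 * γ₀ u, γ₁, fun u => u 2 * ω u] with hW
  set γ₂ : C3 → ℂ := fun u => (ω u - γ₁ u) / (1 + mono 2 7 4 u * γ₁ u) with hγ₂
  have hmem : ∀ x : C3, x 1 = 0 → blowChart {1, 2} 1 x ∈ {q : C3 | q 1 = 0 ∧ q 2 = 0} :=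
    fun x hx => ⟨(hq1 x).trans hx, by rw [hq2, hx, mul_zero]⟩
  have key : ∀ x : C3, x 1 = 0 → AnalyticAt ℂ γ₀ x ∧ AnalyticAt ℂ γ₁ x ∧ AnalyticAt ℂ γ₂ x ∧
      ω x = ρ + x 2 * (x 0 - 1) ∧ γ₀ x = x 2 - ω x ∧ γ₁ x = -x 2 - ω x ∧ γ₂ x = x 2 + 2 * ω x ∧
      (M.blowUp Z).HasLift f (pieceChart Z k 1 hj) x (mono 2 7 4)
        (blowField {1, 2} 1 (mono 2 7 4) W) := by
    intro x hx
    have h1 := hL'.analytic_α x (hmem x hx)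
    have h2 := hL'.analytic_β x (hmem x hx)
    have h3 := hL'.analytic_a x (hmem x hx)
    have h4 := hL'.analytic_e x (hmem x hx)
    have h5 := hDa x (hmem x hx)
    have hα1 : α' x = 1 := hL'.α_eq x (hmem x hx)
    have hβ1 : β' x = -1 := hL'.β_eq x (hmem x hx)
    have hD1 : D x = 1 := (hD x).symm.trans (thirdDenom_of_eq_zero (hmem x hx).2)
    have hDx : D x ≠ 0 := by rw [hD1]; exact one_ne_zero
    have hm0 : mono 2 7 4 x = 0 := by simp [mono, hx]
    have h6 : AnalyticAt ℂ ω x := by fun_prop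
    have h7 : AnalyticAt ℂ γ₀ x := AnalyticAt.fun_div (by fun_prop) h5 hDx
    have h8 : AnalyticAt ℂ γ₁ x := AnalyticAt.fun_div (by fun_prop) h5 hDx
    have hγ₁x : γ₁ x = -x 2 - ω x := by
      simp only [hγ₁, hβ1, hD1, div_one, mul_neg_one]
    refine ⟨h7, h8, (h6.fun_sub h8).fun_div (by fun_prop) (by simp [hm0]), ?_, ?_, hγ₁x, ?_,
      (hl _ (hmem x hx).2).blowLine hd hb hj (analyticAt_mono _ _ _ x) hm0
      (forall_fin_three ((analyticAt_coord 0 x).fun_mul h7) h8 ((analyticAt_coord 2 x).fun_mul h6))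
      (Filter.Eventually.of_forall fun u => ?_)⟩
    · change a' x + x 2 * ((x 0 - 1) * e' x) = _
      rw [hL'.a_eq x (hmem x hx), hL'.e_eq x (hmem x hx), mul_one]
    · simp only [hγ₀, hα1, hD1, div_one, mul_one]
    · change (ω x - γ₁ x) / (1 + mono 2 7 4 x * γ₁ x) = _
      rw [hm0, hγ₁x]
      ring
    have hm : thirdMult 2 (blowChart {1, 2} 1 u) = u 0 ^ 2 * u 1 ^ 6 * u 2 ^ 4 := by
      rw [thirdMult, direction_of_ne (by decide), direction_of_ne (by decide), hq0, hq1, hq2]; ring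
    have hω2 : thirdField α β a e 2 2 (blowChart {1, 2} 1 u) = u 1 * ω u := by
      simp only [thirdField, ha', he', direction_self, hq0, hq1, hq2, hω, Matrix.cons_val,
        direction_of_ne (show (1 : Fin 3) ≠ 2 by decide),
        direction_of_ne (show (0 : Fin 3) ≠ 2 by decide)]
      ring
    refine forall_fin_three ?_ ?_ ?_
    · rw [hm, blowField_of_mem (Finset.mem_univ _) (by decide), if_neg (by decide),
        ← thirdDenom, hD, hω2]
      simp only [thirdField, hα', hq0, hq2, hW, Matrix.cons_val, mono, hγ₀,
        direction_of_ne (show (0 : Fin 3) ≠ 2 by decide), div_eq_mul_inv]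
      ring
    · rw [hm, blowField_of_mem (Finset.mem_univ _) (by decide), if_pos (by decide),
        ← thirdDenom, hD, hω2]
      simp only [thirdField, hβ', hq1, hq2, hW, Matrix.cons_val, mono, hγ₁,
        direction_of_ne (show (1 : Fin 3) ≠ 2 by decide), div_eq_mul_inv]
      ring
    · rw [hm, blowField_self, hω2, if_pos (by decide)]
      simp only [hq2, hW, Matrix.cons_val, mono]
      ring
  set V := blowField {1, 2} 1 (mono 2 7 4) W with hV
  have hV0 : ∀ u, V 0 u = u 0 * γ₀ u := fun u => blowField_of_notMem (by decide) (by decide) ..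
  have hV1 : ∀ u, V 1 u = u 1 * γ₁ u := fun u => blowField_self ..
  have hV2 : ∀ u, V 2 u = u 2 * γ₂ u := by
    intro u
    rw [hV, blowField_of_mem (by decide) (by decide)]
    simp only [hW, Matrix.cons_val, hγ₂]
    ring
  clear_value V γ₂ γ₀ γ₁ ω
  refine ⟨{0, ![0, 0, 2 * ρ]}, by simp, fun x hx => ?_⟩
  obtain ⟨hγ₀a, hγ₁a, hγ₂a, hωx, hγ₀x, hγ₁x, hγ₂x, hlx⟩ := key x hx
  have hm := fderiv_mono_one 2 5 4 hx
  by_cases hns : ∃ s, V s x ≠ 0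
  · exact hlx.resolvedAt_of_ne hm hns _
  push Not at hns
  have hρ := hL.ne_zero
  have n2 := (hV2 x).symm.trans (hns 2)
  rcases mul_eq_zero.1 ((hV0 x).symm.trans (hns 0)) with hx0 | hx0
  · rcases mul_eq_zero.1 n2 with hx2 | hx2
    · have hω1 : ω x = ρ := by rw [hωx, hx2, zero_mul, add_zero]
      refine hlx.resolvedAt_of_isFinal hm (Or.inl (apply_fin_three_ext hx0 hx hx2)) fun ht =>
        Or.inl ?_
      refine isSimpleCorner_of_eigenvalues ((Equiv.swap 0 1).trans (Equiv.swap 0 2)) (a := 7)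
        (b := 4) (c := 2) (U := fun _ => 1) (γ := γ₀) (by norm_num) (by norm_num) analyticAt_const
        hγ₁a hγ₂a (hlx.analytic_field 0) hx hx2 (Filter.Eventually.of_forall fun u => ?_)
        (Filter.Eventually.of_forall hV1) (Filter.Eventually.of_forall hV2) (hns 0)
        (fun _ => ⟨hx0, hγ₀a, Filter.Eventually.of_forall hV0⟩) one_ne_zero ?_ ?_ ht
      · change mono 2 7 4 u = u 1 ^ 7 * u 2 ^ 4 * u 0 ^ 2 * 1
        rw [mono]; ring
      · rw [hγ₁x, hω1, hx2]; simpa using hρ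
      · refine ne_mul_rat (r := 2) ?_ (by norm_num) ?_
        · rw [hγ₁x, hω1, hx2]; simpa using hρ
        · rw [hγ₁x, hγ₂x, hω1, hx2]; push_cast; ring
    · have hx2' : x 2 = 2 * ρ := by
        rw [hγ₂x, hωx, hx0] at hx2
        linear_combination -hx2
      have hω1 : ω x = -ρ := by rw [hωx, hx0, hx2']; ring
      refine hlx.resolvedAt_of_isFinal hm (Or.inr (apply_fin_three_ext hx0 hx hx2')) fun ht =>
        Or.inl ?_
      have hγ₀3 : γ₀ x = 3 * ρ := by rw [hγ₀x, hx2', hω1]; ring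
      have hγ₀0 : γ₀ x ≠ 0 := by rw [hγ₀3]; exact mul_ne_zero three_ne_zero hρ
      refine isSimpleCorner_of_eigenvalues (Equiv.refl _) (a := 2)
        (b := 7) (c := 0) (U := fun u => u 2 ^ 4) (γ := γ₂) (by norm_num) (by norm_num)
        (by fun_prop) hγ₀a hγ₁a (hlx.analytic_field 2) hx0 hx
        (Filter.Eventually.of_forall fun u => ?_)
        (Filter.Eventually.of_forall hV0) (Filter.Eventually.of_forall hV1) (hns 2)
        (fun h => absurd h (lt_irrefl 0)) ?_ hγ₀0 ?_ ht
      · change mono 2 7 4 u = u 0 ^ 2 * u 1 ^ 7 * u 2 ^ 0 * u 2 ^ 4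
        rw [mono]; ring
      · rw [hx2']; exact pow_ne_zero 4 (mul_ne_zero two_ne_zero hρ)
      · refine ne_mul_rat (r := 1 / 3) hγ₀0 (by norm_num) ?_
        rw [hγ₁x, hγ₀3, hω1, hx2']; push_cast; ring
  · rw [hγ₀x] at hx0
    have hω1 : ω x = x 2 := by linear_combination -hx0
    have hx2 : x 2 = 0 := by
      rw [hγ₂x, hω1] at n2
      have : x 2 * x 2 = 0 := by linear_combination (1 / 3) * n2
      simpa using this
    rw [hω1, hx2] at hωx
    exact absurd (by linear_combination -hωx) hρ

end LineBlowUp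

/-! ### The resolution -/

/-- The value of a homogeneous part in a coordinate direction is the coefficient of a pure power. -/
theorem homPart_single (n : ℕ) (f : C3 → ℂ) (j : Fin 3) :
    homPart n f (direction j 0) = taylorCoeff f (Finsupp.single j n) := by
  rw [homPart, Finset.sum_eq_single (Finsupp.single j n)]
  · rw [Finset.prod_eq_single j, direction_self, one_pow, mul_one]
    · intro i _ hi
      rw [Finsupp.single_eq_of_ne hi, pow_zero]
    · simp
  · intro d hd hne
    obtain ⟨i, hij, hi⟩ : ∃ i, i ≠ j ∧ d i ≠ 0 := by
      by_contra! hcon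
      refine hne ?_
      have hsum := (Finset.mem_finsuppAntidiag.1 hd).1
      rw [Finset.sum_eq_single j (fun i _ hi => hcon i hi) (by simp)] at hsum
      ext i
      by_cases hij : i = j
      · subst hij; rw [Finsupp.single_eq_same, hsum]
      · rw [hcon i hij, Finsupp.single_eq_of_ne hij]
    rw [Finset.prod_eq_zero (Finset.mem_univ i), mul_zero]
    rw [direction_of_ne hij, Pi.zero_apply, zero_pow hi]
  · intro h
    refine absurd (Finset.mem_finsuppAntidiag.2 ⟨?_, Finset.subset_univ _⟩) h
    rw [Finset.sum_eq_single j (fun i _ hi => Finsupp.single_eq_of_ne hi) (by simp),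
      Finsupp.single_eq_same]

theorem HasOrderAtLeast.fderiv_eq_zero {n : ℕ} {f : C3 → ℂ} (hf : HasOrderAtLeast n f)
    (hn : 2 ≤ n) : fderiv ℂ f 0 = 0 := by
  have h : ∀ i, fderiv ℂ f 0 (Pi.single i 1) = 0 := by
    intro i
    change partialDeriv i f 0 = 0
    rw [← constantCoeff_taylor (partialDeriv i f), ← pderiv_taylor hf.1 i,
      ← MvPowerSeries.coeff_zero_eq_constantCoeff_apply]
    refine MvPowerSeries.coeff_of_lt_order ?_
    have h2 : ((1 + 1 : ℕ) : ℕ∞) ≤ (taylor f).order := le_trans (by exact_mod_cast hn) hf.2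
    refine lt_of_lt_of_le ?_ (MvPowerSeries.coe_le_order_pderiv h2 (i := i))
    simp
  ext1 v
  rw [apply_eq_sum_perm _ (Equiv.refl _)]
  simp [h]

theorem isTangentToId_exampleGerm {P Q R : C3 → ℂ} (hP : HasOrderAtLeast 4 P)
    (hQ : HasOrderAtLeast 4 Q) (hR : HasOrderAtLeast 4 R) : IsTangentToId (exampleGerm P Q R) := by
  have key : ∀ s, ∃ c g : C3 → ℂ, AnalyticAt ℂ g 0 ∧ g 0 = 0 ∧ fderiv ℂ g 0 = 0 ∧
      HasFDerivAt c (0 : C3 →L[ℂ] ℂ) 0 ∧ AnalyticAt ℂ c 0 ∧ c 0 = 0 ∧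
      ∀ w, exampleGerm P Q R w s = w s + c w + g w := by
    have h0 : ∀ {f : C3 → ℂ}, HasOrderAtLeast 4 f → f 0 = 0 := fun {f} hf => by
      rw [← homPart_zero f 0]; exact homPart_eq_zero hf (by norm_num) 0
    refine forall_fin_three ?_ ?_ ?_
    · exact ⟨fun w => w 1 * (w 2 * (w 1 - w 2)), P, hP.1, h0 hP, hP.fderiv_eq_zero (by norm_num),
        fderiv_mul_eq_zero (by fun_prop) (by fun_prop) rfl (by simp), by fun_prop, by simp,
        fun w => by change w 0 + w 1 * w 2 * (w 1 - w 2) + P w = _; ring⟩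
    · exact ⟨fun w => w 0 * (w 0 ^ 2 - w 2 ^ 2), Q, hQ.1, h0 hQ, hQ.fderiv_eq_zero (by norm_num),
        fderiv_mul_eq_zero (by fun_prop) (by fun_prop) rfl (by simp), by fun_prop, by simp,
        fun w => rfl⟩
    · exact ⟨fun w => w 0 * (w 2 * (w 1 - w 2)), R, hR.1, h0 hR, hR.fderiv_eq_zero (by norm_num),
        fderiv_mul_eq_zero (by fun_prop) (by fun_prop) rfl (by simp), by fun_prop, by simp,
        fun w => by change w 2 + w 0 * w 2 * (w 1 - w 2) + R w = _; ring⟩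
  choose c g hg hg0 hgd hc hca hc0 he using key
  have hfun : exampleGerm P Q R = fun w s => w s + c s w + g s w :=
    funext fun w => funext fun s => he s w
  refine ⟨?_, ?_, ?_⟩
  · rw [hfun, analyticAt_pi_iff]
    exact fun s => ((analyticAt_coord s 0).fun_add (hca s)).fun_add (hg s)
  · funext s
    rw [he, hc0, hg0]; simp
  · refine HasFDerivAt.fderiv ?_
    rw [hfun, hasFDerivAt_pi']
    intro s
    have a := (ContinuousLinearMap.proj (R := ℂ) (φ := fun _ : Fin 3 => ℂ) s).hasFDerivAt
      (x := (0 : C3))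
    have b := (hg s).differentiableAt.hasFDerivAt
    rw [hgd s] at b
    refine ((a.add (hc s)).add b).congr_fderiv ?_
    ext v
    simp

section Points

variable {M : Model}

theorem centerOverZero_point {i : M.chart} {c : C3} (h : M.proj i c = 0) :
    CenterOverZero fun _ : Unit => (⟨i, c, Finset.univ⟩ : CenterPiece M.chart) := by
  intro _ x hx
  rwa [show x = c from funext fun s => hx s (Finset.mem_univ s)]

theorem proj_newChart {i : M.chart} {c : C3} {j : Fin 3} {x : C3} (hx : x j = 0) :
    (M.blowPoint i c).proj (M.newChart i c j) x = M.proj i c := by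
  change M.proj i (CenterPiece.blowMap ⟨i, c, Finset.univ⟩ j x) = _
  rw [blowMap_point, pointMap_of_eq_zero hx]

theorem inCenter_point_iff {i j : M.chart} {c y : C3} :
    M.InCenter (fun _ : Unit => (⟨i, c, Finset.univ⟩ : CenterPiece M.chart)) j y ↔
      c ∈ M.dom i ∧ M.Glued i j c y := by
  constructor
  · rintro ⟨_, x, hx, h, hg⟩
    have : x = c := funext fun s => h s (Finset.mem_univ s)
    subst this
    exact ⟨hx, hg⟩
  · rintro ⟨h1, h2⟩
    exact ⟨(), c, h1, fun _ _ => rfl, h2⟩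

end Points

/-- The origin of `chart1y` does not belong to `chart1z`: the product of the coordinate `z` of the
former and of the coordinate `y` of the latter is `1` on the overlap, a closed condition. -/
theorem not_glued_zero_chart1z (c : C3) : ¬ model1.Glued chart1y chart1z 0 c := by
  intro h
  have hc : IsClosed {q : C3 × C3 | q.2 1 * q.1 2 = 1} :=
    isClosed_eq (by fun_prop) continuous_const
  have := closure_minimal (fun q hq => ?_) hc h
  · simp at this
  · obtain ⟨_, _, h1, h2⟩ := hq
    have e1 : model1.proj chart1y q.1 = q.1 1 • direction 1 q.1 := proj_newChart_affine 1 q.1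
    have e2 : model1.proj chart1z q.2 = q.2 2 • direction 2 q.2 := proj_newChart_affine 2 q.2
    have hne : q.2 2 ≠ 0 := fun h0 => h2 (by rw [h1, e2, h0, zero_smul])
    rw [e1, e2] at h1
    have a1 : q.1 1 * 1 = q.2 2 * q.2 1 := congrFun h1 1
    have a2 : q.1 1 * q.1 2 = q.2 2 * 1 := congrFun h1 2
    change q.2 1 * q.1 2 = 1
    refine mul_left_cancel₀ hne ?_
    linear_combination a2 - q.1 2 * a1

theorem isGood_model2 : model2.IsGood :=
  isGood_model1.blowUp (centerOverZero_point (proj_newChart rfl))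

theorem proj_chart2x : model2.proj chart2x 0 = 0 :=
  (proj_newChart (i := chart1y) rfl).trans (proj_newChart rfl)

theorem isGood_model3 : model3.IsGood :=
  isGood_model2.blowUp (centerOverZero_point proj_chart2x)

theorem centerOverZero_lineL : CenterOverZero lineL := by
  intro k x hx
  fin_cases k
  · have h0 : x 0 = 0 := hx 0 (by decide)
    exact (proj_newChart (i := chart2x) h0).trans proj_chart2x
  · have h2 : x 2 = 0 := hx 2 (by decide)
    exact (proj_newChart (i := chart2x) h2).trans proj_chart2x

theorem isGood_model4 : model4.IsGood := isGood_model3.blowUp centerOverZero_lineL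

theorem proj_chart4z {c : C3} (h : c 2 = 0) : model4.proj chart4z c = 0 :=
  proj_newChart (M := affine) (i := ()) (c := 0) (j := 2) h

theorem isGood_model5 : model5.IsGood :=
  isGood_model4.blowUp (centerOverZero_point (proj_chart4z rfl))

theorem isGood_model6 : model6.IsGood :=
  isGood_model5.blowUp (centerOverZero_point (proj_chart4z (c := ![-1, 1, 0]) rfl))

/-- The centers of the blow-ups over `p₅` do not meet `chart1z`, so that `chart4z` is the whole of
`chart1z`; in particular it contains `p₃` and `p₄`. -/
theorem mem_dom_chart4z (c : C3) : c ∈ model4.dom chart4z := by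
  have h2 : ∀ x, x = 0 → ¬ model2.Glued chart2x (model1.oldChart chart1y 0 chart1z) x c := by
    rintro x rfl h
    have h := Glued.of_inr_inl h
    rw [blowMap_point, pointMap_of_eq_zero rfl] at h
    exact not_glued_zero_chart1z c h
  have h3 : ∀ j x, x j = 0 → ¬ model3.Glued (model2.newChart chart2x 0 j)
      (model2.oldChart chart2x 0 (model1.oldChart chart1y 0 chart1z)) x c := by
    intro j x hx h
    have h := Glued.of_inr_inl h
    rw [blowMap_point, pointMap_of_eq_zero hx] at h
    exact h2 0 rfl h
  refine ⟨⟨⟨Set.mem_univ _, fun h => ?_⟩, fun h => ?_⟩, ?_⟩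
  · exact not_glued_zero_chart1z c (inCenter_point_iff.1 h).2
  · exact h2 0 rfl (inCenter_point_iff.1 h).2
  · rintro ⟨k, x, -, hx, hg⟩
    fin_cases k
    · exact h3 0 x (hx 0 (by decide)) hg
    · exact h3 2 x (hx 2 (by decide)) hg

theorem mem_dom_chart5z : (![-1, 1, 0] : C3) ∈ model5.dom chart5z := by
  refine ⟨mem_dom_chart4z _, fun h => ?_⟩
  have := congrFun (isGood_model4.eq_of_glued (inCenter_point_iff.1 h).2) 0
  norm_num at this

instance : Finite model6.chart := by
  have h0 : Finite affine.chart := inferInstanceAs (Finite Unit)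
  have h1 : Finite model1.chart := finite_chart_blowUp
  have h2 : Finite model2.chart := finite_chart_blowUp
  have h3 : Finite model3.chart := finite_chart_blowUp
  have h4 : Finite model4.chart := finite_chart_blowUp
  have h5 : Finite model5.chart := finite_chart_blowUp
  exact finite_chart_blowUp

section OverPoints

variable {M : Model} {K : Type} {Z : K → CenterPiece M.chart}

theorem OverPoints.inl (hM : M.IsGood) (hZ : CenterOverZero Z) {c i : M.chart} {x : C3}
    (h : x ∈ OverPoints M c i) : x ∈ OverPoints (M.blowUp Z) (Sum.inl c) (Sum.inl i) :=
  h.imp (Glued.inl_inl hM hZ) (Glued.inl_inl hM hZ)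

theorem OverPoints.inr (hM : M.IsGood) (hZ : CenterOverZero Z) {c : M.chart} {k : K} {j : Fin 3}
    (hj : j ∈ (Z k).dirs) {x : C3} (hx : x j ≠ 0)
    (h : (Z k).blowMap j x ∈ OverPoints M c (Z k).chart) :
    x ∈ OverPoints (M.blowUp Z) (Sum.inl c) (pieceChart Z k j hj) :=
  h.imp (Glued.inl_inr hM hZ hj hx) (Glued.inl_inr hM hZ hj hx)

end OverPoints

/-- The expression of the lift in an old chart is not modified by a blow-up. -/
theorem Model.HasLift.inl {M : Model} {K : Type} {Z : K → CenterPiece M.chart} {f : C3 → C3}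
    {i : M.chart} {x : C3} {m : C3 → ℂ} {V : Fin 3 → C3 → ℂ} (h : M.HasLift f i x m V) :
    (M.blowUp Z).HasLift f (Sum.inl i) x m V :=
  ⟨h.analytic_mult, h.analytic_field, h.mult_eq_zero, h.lift⟩

section Resolution

variable {P Q R : C3 → ℂ}

/-- It remains to examine `p₅`, `p₃` and `p₄`. -/
theorem resolvedOff_model1 (hP : HasOrderAtLeast 4 P) (hQ : HasOrderAtLeast 4 Q)
    (hR : HasOrderAtLeast 4 R) : model1.ResolvedOff (exampleGerm P Q R)
      fun i => {x | (i = chart1y ∧ x = 0) ∨ x ∈ OverPoints model1 chart1z i} := by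
  -- Nothing has to be known at the origin of `ℂ³`, as it is the center of the blow-up.
  refine ResolvedOff.blowUp (M := affine) (C := fun _ => {0}) ?_ ?_ ?_ ?_
  · exact fun i => ⟨∅, Set.finite_empty, fun x _ h0 hx => absurd h0 hx⟩
  · rintro i x - hx rfl
    exact absurd (inCenter_point_iff.2 ⟨Set.mem_univ _, isGood_affine.glued_self i 0⟩) hx
  · intro k j hj x hx h
    refine absurd (congrFun (h : _ = (0 : C3)) j) (CenterPiece.blowMap_ne_base hx)
  · intro k j hj
    obtain ⟨S, hS, h⟩ := resolved_firstBlowUp hP hQ hR j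
    exact ⟨S, hS, fun x hx hC => h x hx (fun h => hC (Or.inl h)) (fun h => hC (Or.inr h))⟩

theorem exists_hasLift_chart1y (hP : HasOrderAtLeast 4 P) (hQ : HasOrderAtLeast 4 Q)
    (hR : HasOrderAtLeast 4 R) (hR040 : taylorCoeff R (Finsupp.single 1 4) ≠ 0) :
    ∃ g : Fin 3 → C3 → ℂ, (∀ s, AnalyticAt ℂ (g s) 0) ∧ g 2 0 ≠ 0 ∧
      model1.HasLift (exampleGerm P Q R) chart1y 0 (fun u => u 1 ^ 2)
        (blowField Finset.univ 1 (fun u => u 1 ^ 2)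
          fun s u => cubicPart s (direction 1 u) + u 1 * g s u) := by
  obtain ⟨g, hg⟩ := hasLift_model1 hP hQ hR 1
  obtain ⟨h1, h2⟩ := hg 0 rfl
  refine ⟨g, fun s => (h1 s).1, ?_, h2⟩
  rw [(h1 2).2, homPart_single]
  exact hR040

/-- It remains to examine the origin of `chart2x`, and `p₃` and `p₄`. -/
theorem resolvedOff_model2 (hP : HasOrderAtLeast 4 P) (hQ : HasOrderAtLeast 4 Q)
    (hR : HasOrderAtLeast 4 R) (hR040 : taylorCoeff R (Finsupp.single 1 4) ≠ 0) :
    model2.ResolvedOff (exampleGerm P Q R)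
      fun i => {x | (i = chart2x ∧ x = 0) ∨
        x ∈ OverPoints model2 (model1.oldChart chart1y 0 chart1z) i} := by
  have hZ := centerOverZero_point (M := model1) (i := chart1y) (c := 0) (proj_newChart rfl)
  refine ResolvedOff.blowUp (M := model1) (resolvedOff_model1 hP hQ hR) ?_ ?_ ?_
  · rintro i x hd hx (⟨rfl, rfl⟩ | h)
    · exact absurd (inCenter_point_iff.2 ⟨hd, isGood_model1.glued_self _ _⟩) hx
    · exact Or.inr (OverPoints.inl isGood_model1 hZ h)
  · rintro k j hj x hx (⟨-, h⟩ | h)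
    · exact absurd (congrFun h j) (CenterPiece.blowMap_ne_base hx)
    · exact Or.inr (OverPoints.inr isGood_model1 hZ hj hx h)
  · intro k j hj
    obtain ⟨g, hg, hρ, hl⟩ := exists_hasLift_chart1y hP hQ hR hR040
    refine ⟨∅, Set.finite_empty, fun x hx hC => resolvedAt_secondBlowUp hg hρ hl hx ?_ _⟩
    rintro ⟨rfl, h⟩
    exact hC (Or.inl ⟨rfl, h⟩)

theorem exists_hasLift_chart2x (hP : HasOrderAtLeast 4 P) (hQ : HasOrderAtLeast 4 Q)
    (hR : HasOrderAtLeast 4 R) (hR040 : taylorCoeff R (Finsupp.single 1 4) ≠ 0) :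
    ∃ (A B : Fin 3 → C3 → ℂ) (a e : C3 → ℂ) (ρ : ℂ), IsCornerData A B a e ρ ∧
      model2.HasLift (exampleGerm P Q R) chart2x 0 (mono 2 2 0) (cornerField A B a e) := by
  obtain ⟨g, hg, hρ, hl⟩ := exists_hasLift_chart1y hP hQ hR hR040
  obtain ⟨A, B, a, e, hd, h⟩ := hasLift_secondBlowUp_zero hg hρ hl
  exact ⟨A, B, a, e, _, hd, h⟩

/-- It remains to examine the line `L`, and `p₃` and `p₄`. -/
theorem resolvedOff_model3 (hP : HasOrderAtLeast 4 P) (hQ : HasOrderAtLeast 4 Q)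
    (hR : HasOrderAtLeast 4 R) (hR040 : taylorCoeff R (Finsupp.single 1 4) ≠ 0) :
    model3.ResolvedOff (exampleGerm P Q R)
      fun i => {x | (i = chart3x ∧ x 0 = 0 ∧ x 1 = 0) ∨ (i = chart3z ∧ x 1 = 0 ∧ x 2 = 0) ∨
        x ∈ OverPoints model3
          (model2.oldChart chart2x 0 (model1.oldChart chart1y 0 chart1z)) i} := by
  have hZ := centerOverZero_point proj_chart2x
  refine ResolvedOff.blowUp (M := model2) (resolvedOff_model2 hP hQ hR hR040) ?_ ?_ ?_
  · rintro i x hd hx (⟨rfl, rfl⟩ | h)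
    · exact absurd (inCenter_point_iff.2 ⟨hd, isGood_model2.glued_self _ _⟩) hx
    · exact Or.inr (Or.inr (OverPoints.inl isGood_model2 hZ h))
  · rintro k j hj x hx (⟨-, h⟩ | h)
    · exact absurd (congrFun h j) (CenterPiece.blowMap_ne_base hx)
    · exact Or.inr (Or.inr (OverPoints.inr isGood_model2 hZ hj hx h))
  · intro k j hj
    obtain ⟨A, B, a, e, ρ, hd, hl⟩ := exists_hasLift_chart2x hP hQ hR hR040
    refine ⟨∅, Set.finite_empty, fun x hx hC => resolvedAt_thirdBlowUp hd hl hx ?_ ?_ _⟩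
    · rintro ⟨rfl, h⟩
      exact hC (Or.inl ⟨rfl, hx, h⟩)
    · rintro ⟨rfl, h⟩
      exact hC (Or.inr (Or.inl ⟨rfl, h, hx⟩))

theorem chart3x_ne_chart3z : chart3x ≠ chart3z := by
  intro h
  have h' := Sum.inr.inj h
  exact absurd (congrArg Subtype.val (eq_of_heq (Sigma.mk.inj h').2)) (by decide)

/-- It remains to examine `p₃` and `p₄`. -/
theorem resolvedOff_model4 (hP : HasOrderAtLeast 4 P) (hQ : HasOrderAtLeast 4 Q)
    (hR : HasOrderAtLeast 4 R) (hR040 : taylorCoeff R (Finsupp.single 1 4) ≠ 0) :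
    model4.ResolvedOff (exampleGerm P Q R) fun i => OverPoints model4 chart4z i := by
  refine ResolvedOff.blowUp (M := model3) (resolvedOff_model3 hP hQ hR hR040) ?_ ?_ ?_
  · rintro i x hd hx (⟨rfl, h0, h1⟩ | ⟨rfl, h1, h2⟩ | h)
    · refine absurd ⟨0, x, hd, fun s hs => ?_, isGood_model3.glued_self _ _⟩ hx
      have : s = 0 ∨ s = 1 := by simpa [lineL] using hs
      rcases this with rfl | rfl
      · exact h0
      · exact h1
    · refine absurd ⟨1, x, hd, fun s hs => ?_, isGood_model3.glued_self _ _⟩ hx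
      have : s = 1 ∨ s = 2 := by simpa [lineL] using hs
      rcases this with rfl | rfl
      · exact h1
      · exact h2
    · exact OverPoints.inl isGood_model3 centerOverZero_lineL h
  · intro k j hj x hx h
    have hb := CenterPiece.blowMap_ne_base (c := lineL k) hx
    have h12 : k = 0 ∨ k = 1 := by fin_cases k <;> simp
    rcases h with ⟨hk, h0, h1⟩ | ⟨hk, h1, h2⟩ | h
    · rcases h12 with rfl | rfl
      · have : j = 0 ∨ j = 1 := by simpa [lineL] using hj
        rcases this with rfl | rfl
        · exact absurd h0 hb
        · exact absurd h1 hb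
      · exact absurd hk.symm chart3x_ne_chart3z
    · rcases h12 with rfl | rfl
      · exact absurd hk chart3x_ne_chart3z
      · have : j = 1 ∨ j = 2 := by simpa [lineL] using hj
        rcases this with rfl | rfl
        · exact absurd h1 hb
        · exact absurd h2 hb
    · exact OverPoints.inr isGood_model3 centerOverZero_lineL hj hx h
  · intro k j hj
    obtain ⟨A, B, a, e, ρ, hd, hl⟩ := exists_hasLift_chart2x hP hQ hR hR040
    have h12 : k = 0 ∨ k = 1 := by fin_cases k <;> simp
    rcases h12 with rfl | rfl
    · have hl' := fun (q : C3) (hq : q 0 = 0) => hasLift_thirdBlowUp hd hl hq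
      have : j = 0 ∨ j = 1 := by simpa [lineL] using hj
      rcases this with rfl | rfl
      · obtain ⟨S, hS, h⟩ := resolvedAt_lineBlowUp_zero_zero (Z := lineL) (k := 0)
          hd.isLineData_zero hl' rfl rfl hj
        exact ⟨S, hS, fun x hx _ => h x hx⟩
      · exact ⟨∅, Set.finite_empty, fun x hx _ =>
          resolvedAt_lineBlowUp_zero_one (Z := lineL) (k := 0) hd.isLineData_zero hl' rfl rfl
            hj _ hx⟩
    · have hl' := fun (q : C3) (hq : q 2 = 0) => hasLift_thirdBlowUp hd hl hq
      have : j = 1 ∨ j = 2 := by simpa [lineL] using hj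
      rcases this with rfl | rfl
      · obtain ⟨S, hS, h⟩ := resolvedAt_lineBlowUp_two_one (Z := lineL) (k := 1)
          hd.isLineData_two hl' rfl rfl hj
        exact ⟨S, hS, fun x hx _ => h x hx⟩
      · obtain ⟨S, hS, h⟩ := resolvedAt_lineBlowUp_two_two (Z := lineL) (k := 1)
          hd.isLineData_two hl' rfl rfl hj
        exact ⟨S, hS, fun x hx _ => h x hx⟩

theorem direction_vec (p q r : ℂ) : direction 2 ![p, q, r] = ![p, q, 1] :=
  apply_fin_three_ext rfl rfl rfl

/-- It remains to examine `p₄`. -/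
theorem resolvedOff_model5 (hP : HasOrderAtLeast 4 P) (hQ : HasOrderAtLeast 4 Q)
    (hR : HasOrderAtLeast 4 R) (hR040 : taylorCoeff R (Finsupp.single 1 4) ≠ 0)
    (hp3 : homPart 4 P ![1, 1, 1] ≠ homPart 4 R ![1, 1, 1]) :
    model5.ResolvedOff (exampleGerm P Q R) fun i => {x | model5.Glued chart5z i ![-1, 1, 0] x} := by
  have hZ := centerOverZero_point (M := model4) (i := chart4z) (c := ![1, 1, 0]) (proj_chart4z rfl)
  refine ResolvedOff.blowUp (M := model4) (resolvedOff_model4 hP hQ hR hR040) ?_ ?_ ?_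
  · rintro i x hd hx (h | h)
    · exact absurd (inCenter_point_iff.2 ⟨mem_dom_chart4z _, h⟩) hx
    · exact Glued.inl_inl isGood_model4 hZ h
  · rintro k j hj x hx (h | h)
    · exact absurd (congrFun (isGood_model4.eq_of_glued h) j).symm (CenterPiece.blowMap_ne_base hx)
    · exact Glued.inl_inr isGood_model4 hZ hj hx h
  · intro k j hj
    obtain ⟨g, hg⟩ := hasLift_model1 hP hQ hR 2
    obtain ⟨h1, h2⟩ := hg ![1, 1, 0] rfl
    obtain ⟨S, hS, h⟩ := resolvedAt_blowPoint_of_firstBlowUp (M := model4) (i := chart4z)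
      (c := ![1, 1, 0]) (ε := 1) (by norm_num) rfl rfl rfl (fun s => (h1 s).1)
      (((h2.inl (Z := _)).inl (Z := _)).inl (Z := _)) (by
        rw [(h1 0).2, (h1 2).2, direction_vec, one_mul]; exact hp3) j
    exact ⟨S, hS, fun x hx _ => h x hx⟩

theorem resolvedOff_model6 (hP : HasOrderAtLeast 4 P) (hQ : HasOrderAtLeast 4 Q)
    (hR : HasOrderAtLeast 4 R) (hR040 : taylorCoeff R (Finsupp.single 1 4) ≠ 0)
    (hp3 : homPart 4 P ![1, 1, 1] ≠ homPart 4 R ![1, 1, 1])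
    (hp4 : homPart 4 P ![-1, 1, 1] ≠ -homPart 4 R ![-1, 1, 1]) :
    model6.ResolvedOff (exampleGerm P Q R) fun _ => ∅ := by
  refine ResolvedOff.blowUp (M := model5) (resolvedOff_model5 hP hQ hR hR040 hp3) ?_ ?_ ?_
  · intro i x hd hx h
    exact absurd (inCenter_point_iff.2 ⟨mem_dom_chart5z, h⟩) hx
  · intro k j hj x hx h
    exact absurd (congrFun (isGood_model5.eq_of_glued h) j).symm (CenterPiece.blowMap_ne_base hx)
  · intro k j hj
    obtain ⟨g, hg⟩ := hasLift_model1 hP hQ hR 2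
    obtain ⟨h1, h2⟩ := hg ![-1, 1, 0] rfl
    obtain ⟨S, hS, h⟩ := resolvedAt_blowPoint_of_firstBlowUp (M := model5) (i := chart5z)
      (c := ![-1, 1, 0]) (ε := -1) (by norm_num) rfl rfl rfl (fun s => (h1 s).1)
      ((((h2.inl (Z := _)).inl (Z := _)).inl (Z := _)).inl (Z := _)) (by
        rw [(h1 0).2, (h1 2).2, direction_vec, neg_one_mul]; exact hp4) j
    exact ⟨S, hS, fun x hx _ => h x hx⟩

end Resolution

end

/-- Let `f` be the germ `exampleGerm P Q R`. It lifts to the modification `model6`, the lift fixes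
the exceptional divisor pointwise and is tangent to the identity at each of its points, it has
finitely many singular points, and at each of them its germ is a simple corner, a degenerate spike
or a spinning corner. -/
theorem proposition3 (P Q R : C3 → ℂ)
    (hP : HasOrderAtLeast 4 P) (hQ : HasOrderAtLeast 4 Q) (hR : HasOrderAtLeast 4 R)
    (hR040 : taylorCoeff R (Finsupp.single 1 4) ≠ 0)
    (hp3 : homPart 4 P ![1, 1, 1] ≠ homPart 4 R ![1, 1, 1])
    (hp4 : homPart 4 P ![-1, 1, 1] ≠ -homPart 4 R ![-1, 1, 1]) :
    (∀ (i : model6.chart), ∀ x ∈ model6.dom i, model6.proj i x = 0 →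
      ∃ F : C3 → C3, model6.IsLiftAt (exampleGerm P Q R) i x F ∧ IsTangentToId (germAt x F)) ∧
    {p : model6.Space | ∃ (i : model6.chart) (x : model6.dom i) (F : C3 → C3),
      p = model6.point i x ∧ model6.proj i x = 0 ∧
      model6.IsLiftAt (exampleGerm P Q R) i x F ∧ IsSingularGerm (germAt x F)}.Finite ∧
    (∀ (i : model6.chart), ∀ x ∈ model6.dom i, model6.proj i x = 0 →
      ∀ F : C3 → C3, model6.IsLiftAt (exampleGerm P Q R) i x F → IsSingularGerm (germAt x F) →
        IsSimpleCorner (germAt x F) ∨ IsDegenerateSpike (germAt x F) ∨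
          IsSpinningCorner (germAt x F)) :=
  (resolvedOff_model6 hP hQ hR hR040 hp3 hp4).conclusion isGood_model6
    (isTangentToId_exampleGerm hP hQ hR).eventually_eq_zero
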